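/- Let $n\ge 2$, $M>0$, $\delta>1$ and $s\in(0,1)$, and write $\langle x\rangle=(1+|x|^2)^{1/2}$. For $K>0$ let $\mathcal V_{\delta,K}$ be the set of real-valued $V\in C^1(\mathbb R^n)$ with $|V(x)|\le K\langle x\rangle^{-\delta}$ for all $x\in\mathbb R^n$, and let $\mathcal V_\delta=\bigcup_{K>0}\mathcal V_{\delta,K}$. On $L^2(\mathbb R^n)$ let $H_0=-\tfrac12\Delta$, and for $V\in\mathcal V_\delta$ let $H=-\tfrac12\Delta+V$, with unitary groups $e^{-itH_0}$ and $e^{-itH}$. For every $V\in\mathcal V_\delta$ the wave operators $$W_\pm u=\lim_{t\to\pm\infty}e^{itH}e^{-itH_0}u,\qquad u\in L^2(\mathbb R^n),$$ exist as strong limits, and the scattering operator is $S_V=W_+^*W_-$. Put $$\|f\|_{L^1_s}=\|\langle\cdot\rangle^s f\|_{L^1(\mathbb R^n)},\qquad \|f\|_{H^{-1}}=\Big(\int_{\mathbb R^n}\langle\xi\rangle^{-2}|\hat f(\xi)|^2\,d\xi\Big)^{1/2},\qquad \hat f(\xi)=(2\pi)^{-n/2}\int_{\mathbb R^n}e^{-ix\cdot\xi}f(x)\,dx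 .$$ (a) There is $\nu\in(0,1)$, depending only on $n,M,\delta,s$, and for every $K>0$ there is $C>0$, depending only on $n,M,\delta,s,K$, such that $$\|V_1-V_2\|_{H^{-1}(\mathbb R^n)}\le C\,\|S_{V_1}-S_{V_2}\|_{\mathcal L(L^2(\mathbb R^n))}^{\nu}$$ for all $V_1,V_2\in\mathcal V_{\delta,K}$ with $V_1-V_2\in L^2(\mathbb R^n)\cap L^1_s(\mathbb R^n)$ and $\|V_1-V_2\|_{L^2(\mathbb R^n)}+\|V_1-V_2\|_{L^1_s(\mathbb R^n)}\le M$. (b) In particular the scattering map $V\mapsto S_V$ is locally injective on $\mathcal V_\delta$: for every $V_0\in\mathcal V_\delta$ it is injective on the set of all $V\in\mathcal V_\delta$ with $\|V-V_0\|_{L^2(\mathbb R^n)}+\|V-V_0\|_{L^1_s(\mathbb R^n)}\le M$. -/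

import Mathlib

open MeasureTheory Filter Topology
open scoped ENNReal FourierTransform SchwartzMap Laplacian

noncomputable section

namespace QuantumScattering

/-- Euclidean space `ℝⁿ`. -/
abbrev Rn (n : ℕ) : Type := EuclideanSpace ℝ (Fin n)

/-- The Hilbert space `L²(ℝⁿ)` of complex-valued square integrable functions. -/
abbrev L2 (n : ℕ) : Type := Lp ℂ 2 (volume : Measure (Rn n))

/-- The weight `⟨x⟩ = (1 + |x|²)^{1/2}`. -/
def bracket {n : ℕ} (x : Rn n) : ℝ := Real.sqrt (1 + ‖x‖ ^ 2)

/-- The real `C¹` potentials with `|V(x)| ≤ K ⟨x⟩^{-δ}` for all `x`. -/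
def shortRangeWith (n : ℕ) (δ K : ℝ) : Set (Rn n → ℝ) :=
  {V | ContDiff ℝ 1 V ∧ ∀ x, |V x| ≤ K * bracket x ^ (-δ)}

/-- The real `C¹` potentials with `|V(x)| ≤ K ⟨x⟩^{-δ}` for all `x`, for some constant `K`. -/
def shortRange (n : ℕ) (δ : ℝ) : Set (Rn n → ℝ) :=
  {V | ∃ K : ℝ, V ∈ shortRangeWith n δ K}

/-- The norm `‖f‖_{L²} + ‖⟨·⟩^s f‖_{L¹}`, with value `∞` if `f ∉ L² ∩ L¹_s`. -/
def weightedNorm {n : ℕ} (s : ℝ) (f : Rn n → ℝ) : ℝ≥0∞ :=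
  eLpNorm f 2 volume + eLpNorm (fun x => bracket x ^ s * f x) 1 volume

/-- The Fourier transform `(2π)^{-n/2} ∫ e^{-i x·ξ} f(x) dx` of an integrable function. -/
def fourierHat {n : ℕ} (f : Rn n → ℝ) (ξ : Rn n) : ℂ :=
  (((2 * Real.pi) ^ (-(n : ℝ) / 2) : ℝ) : ℂ) *
    ∫ x : Rn n, Complex.exp (-(Complex.I * ((inner ℝ x ξ : ℝ) : ℂ))) * (f x : ℂ)

/-- The Sobolev norm `‖f‖_{H^r} = (∫ ⟨ξ⟩^{2r} |f̂(ξ)|² dξ)^{1/2}` of an integrable function,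
possibly infinite. -/
def sobolevNorm {n : ℕ} (r : ℝ) (f : Rn n → ℝ) : ℝ≥0∞ :=
  eLpNorm (fun ξ : Rn n => ((bracket ξ ^ r : ℝ) : ℂ) * fourierHat f ξ) 2 volume

open scoped Classical in
/-- The product `m u` of a function `m` and `u ∈ L²`, as an element of `L²`. It is used only for
bounded measurable `m`, where the product always lies in `L²`. -/
def mulL2 {n : ℕ} (m : Rn n → ℂ) (u : L2 n) : L2 n :=
  if h : MemLp (fun x => m x * u x) 2 (volume : Measure (Rn n)) then h.toLp _ else 0

/-- The free evolution `e^{-itH₀}`, where `H₀ = -½Δ`: the Fourier multiplier with symbol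
`e^{-it|ξ|²/2}`. The transform `𝓕` on `L²` is the one with kernel `e^{-2πi x·ξ}`, so the
frequency variable of the symbol is `2πξ`. -/
def freeEvolution {n : ℕ} (t : ℝ) (u : L2 n) : L2 n :=
  𝓕⁻ (mulL2 (fun ξ : Rn n =>
    Complex.exp (-(Complex.I * ((t * ‖(2 * Real.pi) • ξ‖ ^ 2 / 2 : ℝ) : ℂ)))) (𝓕 u : L2 n))

/-- The graph of the Hamiltonian `H = -½Δ + V` on `L²(ℝⁿ)`: `u, w ∈ L²` and `-½Δu + Vu = w` in
the sense of tempered distributions. For bounded `V` this is the self-adjoint operator with domain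
`H²(ℝⁿ)`. -/
def HamiltonianGraph {n : ℕ} (V : Rn n → ℝ) (u w : L2 n) : Prop :=
  (-(1 / 2) : ℂ) • Δ (u : 𝓢'(Rn n, ℂ)) + (mulL2 (fun x => (V x : ℂ)) u : 𝓢'(Rn n, ℂ))
    = (w : 𝓢'(Rn n, ℂ))

/-- `U` is the group `e^{-itH}` with `H = -½Δ + V`: a strongly continuous one-parameter group of
unitary operators on `L²(ℝⁿ)` whose infinitesimal generator is exactly `-iH` (same domain, same
values). By Stone's theorem there is exactly one when `H` is self-adjoint. -/
structure IsSchrodingerGroup {n : ℕ} (V : Rn n → ℝ) (U : ℝ → (L2 n ≃ₗᵢ[ℂ] L2 n)) : Prop where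
  map_add : ∀ (t t' : ℝ) (u : L2 n), U (t + t') u = U t (U t' u)
  continuous : ∀ u : L2 n, Continuous fun t => U t u
  generator : ∀ u w : L2 n,
    HamiltonianGraph V u w ↔ HasDerivAt (fun t => U t u) (-(Complex.I • w)) 0

open scoped Classical in
/-- The group `e^{-itH}` generated by `H = -½Δ + V`. -/
def schrodingerGroup {n : ℕ} (V : Rn n → ℝ) : ℝ → (L2 n ≃ₗᵢ[ℂ] L2 n) :=
  if h : ∃ U, IsSchrodingerGroup V U then h.choose else fun _ => LinearIsometryEquiv.refl ℂ (L2 n)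

/-- `W` is the strong limit of `e^{itH} e^{-itH₀}` as `t` tends along the filter `l`. The wave
operators `W₊`, `W₋` are the cases `l = atTop` and `l = atBot`. -/
def IsWaveOperator {n : ℕ} (V : Rn n → ℝ) (l : Filter ℝ) (W : L2 n →L[ℂ] L2 n) : Prop :=
  ∀ u : L2 n, Tendsto (fun t : ℝ => schrodingerGroup V (-t) (freeEvolution t u)) l (𝓝 (W u))

open scoped Classical in
/-- The wave operator, the strong limit of `e^{itH} e^{-itH₀}` as `t` tends along `l`. -/
def waveOperator {n : ℕ} (V : Rn n → ℝ) (l : Filter ℝ) : L2 n →L[ℂ] L2 n :=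
  if h : ∃ W, IsWaveOperator V l W then h.choose else 0

/-- The scattering operator `S_V = W₊* W₋`. -/
def scatteringOperator {n : ℕ} (V : Rn n → ℝ) : L2 n →L[ℂ] L2 n :=
  (ContinuousLinearMap.adjoint (waveOperator V atTop)).comp (waveOperator V atBot)

end QuantumScattering

end

noncomputable section

namespace QuantumScattering

variable {n : ℕ}

/-! The proof is the time-dependent high-velocity method, with two boosts of slightly different
momenta. Put q = V₁ - V₂ and let ε be the norm of the difference of the scattering operators.

Born approximation. The identity S - 1 = W₊*(W₋ - W₊) needs only that W₊ is isometric, and W₊ - W₋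
is the integral over time of the derivative of e^{itH}e^{-itH₀}. Hence ⟨Ψ, (S - 1)Φ⟩ equals
-i∫⟨e^{-itH₀}Ψ, V e^{-itH₀}Φ⟩dt up to the product of ∫‖V e^{-itH₀}Ψ‖dt and ∫‖V e^{-itH₀}Φ‖dt
(`norm_inner_scatteringOperator_sub_le`).

Decay without stationary phase. From ⟨x,ω⟩e^{-itH₀} = e^{-itH₀}(⟨x,ω⟩ - it∂_ω), every factor t in
front of ∂_ω can be traded for a factor ⟨x,ω⟩. So e^{-itH₀}∂_ω³g decays like t⁻² in the weight
⟨x⟩⁻², and interpolation gives t^{-δ} for V e^{-itH₀}∂_ω³g when δ ≤ 2. The vectors ∂_ω³g are dense,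
so Cook's method yields the wave operators. The state `boost`, namely (iv)⁻³∂_ω³(e^{ix·p}f) with v =
⟨p,ω⟩, is O(1/v) close to e^{ix·p}f and satisfies ‖V e^{-itH₀}·‖ ≤ N(1 + v|t|)^{-δ}
(`norm_potL2_boost_le`). The time integrals are therefore O(1/v) and the Born error is O(1/v²),
whereas the first-order term is of order 1/v.

Reading off the Fourier transform. Given k, choose a unit vector ω ⟂ k, possible since n ≥ 2, and
boost one bump f = bump(·/R) by p = vω + k/2 and by p' = vω - k/2. For |t| ≤ T/v the evolved states
are, up to a phase, e^{ix·p}f(x - tp) and e^{ix·p'}f(x - tp'); the phases agree because |p| = |p'|.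
The first-order term becomes the integral of q(x)e^{ix·k} against the time average of f(x - tp)f(x -
tp'). For large R this average hardly depends on x, with relative error ⟨x⟩^s R^{-s}, and it is at
least of order R/v (`mul_norm_integral_exp_le`). The result is |q̂(k)| ≤ C(1 + |k|)(R^{2n+4}(εv +
T^{-(δ-1)/2} + T²/v) + R^{-s}).

Optimisation. Taking T and v to be powers of R, and R a negative power of ε, gives |q̂(k)| ≤ C(1 +
|k|) times a positive power of ε. The H⁻¹ weight absorbs the factor 1 + |k| on low frequencies, and
the `L²` bound controls the high ones (`sobolevNorm_neg_one_le_of_split`). Injectivity is the case ε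
= 0. -/

/-! ### Schwartz functions in `L²` -/

/-- The inclusion of the Schwartz functions into `L²`. -/
def toL2 : 𝓢(Rn n, ℂ) →L[ℂ] L2 n := SchwartzMap.toLpCLM ℂ ℂ 2 volume

theorem toL2_eq (f : 𝓢(Rn n, ℂ)) : toL2 f = f.toLp 2 volume := rfl

theorem coeFn_toL2 (f : 𝓢(Rn n, ℂ)) : toL2 f =ᵐ[volume] f := f.coeFn_toLp 2 volume

theorem dense_schwartz : DenseRange (toL2 : 𝓢(Rn n, ℂ) → L2 n) :=
  SchwartzMap.denseRange_toLpCLM ENNReal.ofNat_ne_top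

theorem toL2_injective : Function.Injective (toL2 : 𝓢(Rn n, ℂ) → L2 n) :=
  SchwartzMap.injective_toLp 2 (volume : Measure (Rn n))

theorem fourier_toL2 (f : 𝓢(Rn n, ℂ)) : 𝓕 (toL2 f) = toL2 (𝓕 f) := SchwartzMap.toLp_fourier_eq f

theorem fourierInv_toL2 (f : 𝓢(Rn n, ℂ)) : 𝓕⁻ (toL2 f) = toL2 (𝓕⁻ f) :=
  SchwartzMap.toLp_fourierInv_eq f

/-! ### Bounded multiplication operators on `L²` -/

/-- `m` is an a.e. strongly measurable function bounded by `C`. -/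
def IsBoundedSymbol (m : Rn n → ℂ) (C : ℝ) : Prop :=
  AEStronglyMeasurable m volume ∧ ∀ x, ‖m x‖ ≤ C

theorem IsBoundedSymbol.memLp_mul {m : Rn n → ℂ} {C : ℝ} (hm : IsBoundedSymbol m C) (u : L2 n) :
    MemLp (fun x => m x * u x) 2 (volume : Measure (Rn n)) := by
  refine MemLp.of_le_mul (c := C) (Lp.memLp u) (hm.1.mul (Lp.aestronglyMeasurable u)) ?_
  filter_upwards with x
  rw [norm_mul]
  exact mul_le_mul_of_nonneg_right (hm.2 x) (norm_nonneg _)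

theorem IsBoundedSymbol.coeFn_mulL2 {m : Rn n → ℂ} {C : ℝ} (hm : IsBoundedSymbol m C) (u : L2 n) :
    mulL2 m u =ᵐ[volume] fun x => m x * u x := by
  rw [mulL2, dif_pos (hm.memLp_mul u)]
  exact MemLp.coeFn_toLp _

theorem IsBoundedSymbol.norm_mulL2_le {m : Rn n → ℂ} {C : ℝ} (hm : IsBoundedSymbol m C)
    (u : L2 n) : ‖mulL2 m u‖ ≤ C * ‖u‖ := by
  refine Lp.norm_le_mul_norm_of_ae_le_mul ?_
  filter_upwards [hm.coeFn_mulL2 u] with x hx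
  rw [hx, norm_mul]
  exact mul_le_mul_of_nonneg_right (hm.2 x) (norm_nonneg _)

/-- Multiplication by a bounded function as a bounded operator on `L²`. -/
def mulOp {m : Rn n → ℂ} {C : ℝ} (hm : IsBoundedSymbol m C) : L2 n →L[ℂ] L2 n :=
  LinearMap.mkContinuous
    { toFun := mulL2 m
      map_add' := fun u v => by
        ext1
        filter_upwards [hm.coeFn_mulL2 (u + v), hm.coeFn_mulL2 u, hm.coeFn_mulL2 v,
          Lp.coeFn_add u v, Lp.coeFn_add (mulL2 m u) (mulL2 m v)] with x h1 h2 h3 h4 h5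
        rw [h1, h5, Pi.add_apply, h2, h3, h4, Pi.add_apply, mul_add]
      map_smul' := fun c u => by
        ext1
        filter_upwards [hm.coeFn_mulL2 (c • u), hm.coeFn_mulL2 u, Lp.coeFn_smul c u,
          Lp.coeFn_smul c (mulL2 m u)] with x h1 h2 h3 h4
        simp only [RingHom.id_apply]
        rw [h1, h4, Pi.smul_apply, h2, h3, Pi.smul_apply, smul_eq_mul, smul_eq_mul]
        ring } C hm.norm_mulL2_le

@[simp]
theorem mulOp_apply {m : Rn n → ℂ} {C : ℝ} (hm : IsBoundedSymbol m C) (u : L2 n) :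
    mulOp hm u = mulL2 m u := rfl

theorem mulL2_mulL2 {m m' : Rn n → ℂ} {C C' : ℝ} (hm : IsBoundedSymbol m C)
    (hm' : IsBoundedSymbol m' C') (u : L2 n) :
    mulL2 m (mulL2 m' u) = mulL2 (fun x => m x * m' x) u := by
  have hmm : IsBoundedSymbol (fun x => m x * m' x) (C * C') := by
    refine ⟨hm.1.mul hm'.1, fun x => ?_⟩
    rw [norm_mul]
    exact mul_le_mul (hm.2 x) (hm'.2 x) (norm_nonneg _) ((norm_nonneg _).trans (hm.2 x))
  ext1
  filter_upwards [hm.coeFn_mulL2 (mulL2 m' u), hm'.coeFn_mulL2 u, hmm.coeFn_mulL2 u]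
    with x h1 h2 h3
  rw [h1, h2, h3, mul_assoc]

theorem mulL2_one (u : L2 n) : mulL2 (fun _ => 1) u = u := by
  have h1 : IsBoundedSymbol (fun _ : Rn n => (1 : ℂ)) 1 :=
    ⟨aestronglyMeasurable_const, fun x => by simp⟩
  ext1
  filter_upwards [h1.coeFn_mulL2 u] with x hx
  rw [hx, one_mul]

theorem mulL2_toL2 {m : Rn n → ℂ} {C : ℝ} (hm : IsBoundedSymbol m C)
    (hg : m.HasTemperateGrowth) (f : 𝓢(Rn n, ℂ)) :
    mulL2 m (toL2 f) = (toL2 (SchwartzMap.smulLeftCLM ℂ m f)) := by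
  ext1
  filter_upwards [hm.coeFn_mulL2 (toL2 f), coeFn_toL2 f,
    coeFn_toL2 (SchwartzMap.smulLeftCLM ℂ m f)] with x h1 h2 h3
  rw [h1, h2, h3, SchwartzMap.smulLeftCLM_apply_apply hg, smul_eq_mul]

theorem inner_mulL2_real {V : Rn n → ℝ} {C : ℝ} (hV : IsBoundedSymbol (fun x => (V x : ℂ)) C)
    (u v : L2 n) : inner ℂ (mulL2 (fun x => (V x : ℂ)) u) v
      = inner ℂ u (mulL2 (fun x => (V x : ℂ)) v) := by
  simp only [L2.inner_def]
  apply integral_congr_ae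
  filter_upwards [hV.coeFn_mulL2 u, hV.coeFn_mulL2 v] with x h1 h2
  rw [h1, h2]
  simp only [RCLike.inner_apply, map_mul, Complex.conj_ofReal]
  ring

/-! ### The free evolution -/

/-- The symbol of the free evolution. -/
def freeSymbol (t : ℝ) (ξ : Rn n) : ℂ :=
  Complex.exp (-(Complex.I * ((t * ‖(2 * Real.pi) • ξ‖ ^ 2 / 2 : ℝ) : ℂ)))

/-- The symbol of the free Hamiltonian `-½Δ`. -/
def kineticSymbol (ξ : Rn n) : ℝ := 2 * Real.pi ^ 2 * ‖ξ‖ ^ 2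

theorem freeSymbol_eq (t : ℝ) (ξ : Rn n) :
    freeSymbol t ξ = Complex.exp (((-(t * kineticSymbol ξ) : ℝ) : ℂ) * Complex.I) := by
  rw [freeSymbol, kineticSymbol, norm_smul]
  congr 1
  rw [mul_pow, Real.norm_eq_abs, sq_abs]
  push_cast
  ring

theorem hasTemperateGrowth_kineticSymbol :
    (kineticSymbol : Rn n → ℝ).HasTemperateGrowth := by
  unfold kineticSymbol
  have := Function.hasTemperateGrowth_norm_sq (H := Rn n)
  fun_prop

/-- The exponential `x ↦ e^{ix}` has bounded derivatives of all orders. -/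
theorem hasTemperateGrowth_exp_mul_I :
    (fun x : ℝ => Complex.exp ((x : ℂ) * Complex.I)).HasTemperateGrowth := by
  have hd : ∀ x : ℝ, HasDerivAt (fun x : ℝ => Complex.exp ((x : ℂ) * Complex.I))
      (Complex.exp ((x : ℂ) * Complex.I) * Complex.I) x := fun x => by
    have h := ((Complex.ofRealCLM.hasDerivAt (x := x)).mul_const Complex.I).cexp
    simpa using h
  have hi : ∀ k : ℕ, iteratedDeriv k (fun x : ℝ => Complex.exp ((x : ℂ) * Complex.I))
      = fun x : ℝ => Complex.exp ((x : ℂ) * Complex.I) * Complex.I ^ k := by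
    intro k
    induction k with
    | zero => simp
    | succ k ih =>
      rw [iteratedDeriv_succ, ih]
      funext x
      rw [((hd x).mul_const (Complex.I ^ k)).deriv]
      ring
  refine ⟨?_, fun k => ⟨0, 1, fun x => ?_⟩⟩
  · have h1 : ContDiff ℝ (⊤ : ℕ∞) (fun x : ℝ => (x : ℂ)) := Complex.ofRealCLM.contDiff
    exact ((h1.mul contDiff_const).cexp)
  · rw [norm_iteratedFDeriv_eq_norm_iteratedDeriv, hi k]
    simp [Complex.norm_exp_ofReal_mul_I]

theorem hasTemperateGrowth_exp_ofReal_mul_I {g : Rn n → ℝ} (hg : g.HasTemperateGrowth) :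
    (fun x => Complex.exp ((g x : ℂ) * Complex.I)).HasTemperateGrowth :=
  hasTemperateGrowth_exp_mul_I.comp hg

theorem hasTemperateGrowth_freeSymbol (t : ℝ) :
    (freeSymbol t : Rn n → ℂ).HasTemperateGrowth := by
  have h : (fun ξ : Rn n => -(t * kineticSymbol ξ)).HasTemperateGrowth := by
    have := hasTemperateGrowth_kineticSymbol (n := n)
    fun_prop
  have := hasTemperateGrowth_exp_ofReal_mul_I h
  rwa [show (freeSymbol t : Rn n → ℂ) = _ from funext (freeSymbol_eq t)]

theorem norm_freeSymbol (t : ℝ) (ξ : Rn n) : ‖freeSymbol t ξ‖ = 1 := by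
  rw [freeSymbol_eq, Complex.norm_exp_ofReal_mul_I]

theorem isBoundedSymbol_freeSymbol (t : ℝ) : IsBoundedSymbol (freeSymbol t : Rn n → ℂ) 1 :=
  ⟨(hasTemperateGrowth_freeSymbol t).1.continuous.aestronglyMeasurable,
    fun ξ => (norm_freeSymbol t ξ).le⟩

theorem freeSymbol_add (t t' : ℝ) (ξ : Rn n) :
    freeSymbol (t + t') ξ = freeSymbol t ξ * freeSymbol t' ξ := by
  simp only [freeSymbol_eq, ← Complex.exp_add]
  congr 1
  push_cast
  ring

theorem freeSymbol_zero : (freeSymbol 0 : Rn n → ℂ) = fun _ => 1 := by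
  funext ξ
  simp [freeSymbol_eq]

theorem freeEvolution_eq (t : ℝ) (u : L2 n) :
    freeEvolution t u = 𝓕⁻ (mulL2 (freeSymbol t) (𝓕 u : L2 n)) := rfl

theorem freeEvolution_add (t t' : ℝ) (u : L2 n) :
    freeEvolution (t + t') u = freeEvolution t (freeEvolution t' u) := by
  simp only [freeEvolution_eq, FourierTransform.fourier_fourierInv_eq]
  rw [mulL2_mulL2 (isBoundedSymbol_freeSymbol t) (isBoundedSymbol_freeSymbol t')]
  congr 2
  funext ξ
  exact freeSymbol_add t t' ξ

theorem freeEvolution_zero (u : L2 n) : freeEvolution 0 u = u := by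
  rw [freeEvolution_eq, freeSymbol_zero, mulL2_one, FourierTransform.fourierInv_fourier_eq]

theorem norm_fourierInv_eq (u : L2 n) : ‖(𝓕⁻ u : L2 n)‖ = ‖u‖ := by
  rw [← Lp.norm_fourier_eq, FourierTransform.fourier_fourierInv_eq]

theorem norm_freeEvolution (t : ℝ) (u : L2 n) : ‖freeEvolution t u‖ = ‖u‖ := by
  rw [freeEvolution_eq, norm_fourierInv_eq]
  have h1 : ‖mulL2 (freeSymbol t) (𝓕 u : L2 n)‖ ≤ ‖(𝓕 u : L2 n)‖ := by
    simpa using (isBoundedSymbol_freeSymbol t).norm_mulL2_le (𝓕 u : L2 n)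
  have h2 : ‖(𝓕 u : L2 n)‖ ≤ ‖mulL2 (freeSymbol t) (𝓕 u : L2 n)‖ := by
    have h := (isBoundedSymbol_freeSymbol (-t)).norm_mulL2_le
      (mulL2 (freeSymbol t) (𝓕 u : L2 n))
    rw [mulL2_mulL2 (isBoundedSymbol_freeSymbol (-t)) (isBoundedSymbol_freeSymbol t),
      show (fun x : Rn n => freeSymbol (-t) x * freeSymbol t x) = fun _ => 1 by
        funext x; rw [← freeSymbol_add, neg_add_cancel, freeSymbol_zero], mulL2_one] at h
    simpa using h
  rw [le_antisymm h1 h2, Lp.norm_fourier_eq]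

/-- The free evolution as a unitary operator. -/
def freeIso (t : ℝ) : L2 n ≃ₗᵢ[ℂ] L2 n where
  toFun := freeEvolution t
  map_add' u v := by
    have h := (mulOp (isBoundedSymbol_freeSymbol t)).map_add (𝓕 u : L2 n) (𝓕 v)
    simp only [mulOp_apply] at h
    rw [freeEvolution_eq, FourierTransform.fourier_add, h, FourierTransform.fourierInv_add]
    rfl
  map_smul' c u := by
    have h := (mulOp (isBoundedSymbol_freeSymbol t)).map_smul c (𝓕 u : L2 n)
    simp only [mulOp_apply] at h
    rw [freeEvolution_eq, FourierTransform.fourier_smul, h, FourierTransform.fourierInv_smul]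
    rfl
  invFun := freeEvolution (-t)
  left_inv u := by rw [← freeEvolution_add, neg_add_cancel, freeEvolution_zero]
  right_inv u := by rw [← freeEvolution_add, add_neg_cancel, freeEvolution_zero]
  norm_map' u := norm_freeEvolution t u

theorem freeIso_apply (t : ℝ) (u : L2 n) : freeIso t u = freeEvolution t u := rfl

theorem freeIso_add (t t' : ℝ) (u : L2 n) : freeIso (t + t') u = freeIso t (freeIso t' u) :=
  freeEvolution_add t t' u

theorem freeIso_zero (u : L2 n) : freeIso 0 u = u := freeEvolution_zero u

/-- The free evolution on Schwartz functions. -/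
def freeS (t : ℝ) : 𝓢(Rn n, ℂ) →L[ℂ] 𝓢(Rn n, ℂ) :=
  SchwartzMap.fourierMultiplierCLM ℂ (freeSymbol t)

/-- The operator `-½Δ` on Schwartz functions. -/
def kineticS : 𝓢(Rn n, ℂ) →L[ℂ] 𝓢(Rn n, ℂ) :=
  SchwartzMap.fourierMultiplierCLM ℂ (fun ξ => (kineticSymbol ξ : ℂ))

theorem freeIso_toL2 (t : ℝ) (f : 𝓢(Rn n, ℂ)) :
    freeIso t (toL2 f) = (toL2 (freeS t f)) := by
  rw [freeIso_apply, freeEvolution_eq, fourier_toL2,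
    mulL2_toL2 (isBoundedSymbol_freeSymbol t) (hasTemperateGrowth_freeSymbol t),
    fourierInv_toL2]
  rfl

theorem hasTemperateGrowth_kineticSymbol_complex :
    (fun ξ : Rn n => (kineticSymbol ξ : ℂ)).HasTemperateGrowth :=
  Function.HasTemperateGrowth.comp (g := Complex.ofReal) (by fun_prop)
    hasTemperateGrowth_kineticSymbol

theorem kineticS_eq (f : 𝓢(Rn n, ℂ)) : kineticS f = (-(1 / 2) : ℂ) • Δ f := by
  have hsq : (fun ξ : Rn n => ‖ξ‖ ^ 2).HasTemperateGrowth :=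
    Function.hasTemperateGrowth_norm_sq _
  have hk : (kineticSymbol : Rn n → ℝ) = (2 * Real.pi ^ 2) • (fun ξ : Rn n => ‖ξ‖ ^ 2) := rfl
  have h1 : kineticS f = (2 * Real.pi ^ 2) •
      SchwartzMap.fourierMultiplierCLM ℂ (fun ξ : Rn n => ‖ξ‖ ^ 2) f := by
    rw [kineticS]
    have := SchwartzMap.fourierMultiplierCLM_ofReal ℂ hasTemperateGrowth_kineticSymbol f
    refine this.trans ?_
    rw [hk, SchwartzMap.fourierMultiplierCLM_smul hsq]
    rfl
  have h2 : Δ f = -(2 * Real.pi) ^ 2 •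
      SchwartzMap.fourierMultiplierCLM ℂ (fun ξ : Rn n => ‖ξ‖ ^ 2) f :=
    SchwartzMap.laplacian_eq_fourierMultiplierCLM f
  rw [h1, h2]
  generalize SchwartzMap.fourierMultiplierCLM ℂ (fun ξ : Rn n => ‖ξ‖ ^ 2) f = g
  ext x
  simp only [smul_apply, smul_eq_mul, Complex.real_smul]
  push_cast
  ring

/-- By Plancherel, a pointwise comparison of symbols is a comparison of operators. Taylor estimates
for e^{-itH₀} thus reduce to those of the scalar exponential. -/
theorem norm_toL2_fourierMultiplier_le {m m' : Rn n → ℂ} {c : ℝ} (hm : m.HasTemperateGrowth)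
    (hm' : m'.HasTemperateGrowth) (h : ∀ ξ, ‖m ξ‖ ≤ c * ‖m' ξ‖) (f : 𝓢(Rn n, ℂ)) :
    ‖(toL2 (SchwartzMap.fourierMultiplierCLM ℂ m f))‖
      ≤ c * ‖(toL2 (SchwartzMap.fourierMultiplierCLM ℂ m' f))‖ := by
  simp only [SchwartzMap.fourierMultiplierCLM_apply, ← fourierInv_toL2,
    norm_fourierInv_eq]
  refine Lp.norm_le_mul_norm_of_ae_le_mul ?_
  filter_upwards [coeFn_toL2 (SchwartzMap.smulLeftCLM ℂ m (𝓕 f)),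
    coeFn_toL2 (SchwartzMap.smulLeftCLM ℂ m' (𝓕 f))] with x h1 h2
  rw [h1, h2, SchwartzMap.smulLeftCLM_apply_apply hm, SchwartzMap.smulLeftCLM_apply_apply hm',
    norm_smul, norm_smul, ← mul_assoc]
  exact mul_le_mul_of_nonneg_right (h x) (norm_nonneg _)

theorem fourierMultiplierCLM_add {m m' : Rn n → ℂ} (hm : m.HasTemperateGrowth)
    (hm' : m'.HasTemperateGrowth) (f : 𝓢(Rn n, ℂ)) :
    SchwartzMap.fourierMultiplierCLM ℂ (m + m') f =
      SchwartzMap.fourierMultiplierCLM ℂ m f + SchwartzMap.fourierMultiplierCLM ℂ m' f := by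
  simp only [SchwartzMap.fourierMultiplierCLM_apply, SchwartzMap.smulLeftCLM_add hm hm']
  rw [← FourierTransform.fourierInv_add]
  rfl

theorem norm_exp_mul_I_sub_one_le (θ : ℝ) : ‖Complex.exp ((θ : ℂ) * Complex.I) - 1‖ ≤ |θ| := by
  have := Real.norm_exp_I_mul_ofReal_sub_one_le (x := θ)
  rwa [mul_comm, Real.norm_eq_abs] at this

theorem norm_exp_mul_I_sub_one_sub_le (θ : ℝ) :
    ‖Complex.exp ((θ : ℂ) * Complex.I) - 1 - (θ : ℂ) * Complex.I‖ ≤ 3 * θ ^ 2 := by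
  rcases le_or_gt |θ| 1 with h | h
  · have := Complex.norm_exp_sub_one_sub_id_le (x := (θ : ℂ) * Complex.I) (by simpa using h)
    simp only [norm_mul, Complex.norm_real, Complex.norm_I, mul_one, Real.norm_eq_abs, sq_abs]
      at this
    nlinarith [sq_nonneg θ]
  · have h1 := norm_exp_mul_I_sub_one_le θ
    have h2 : ‖(θ : ℂ) * Complex.I‖ = |θ| := by simp
    have h3 := norm_sub_le (Complex.exp ((θ : ℂ) * Complex.I) - 1) ((θ : ℂ) * Complex.I)
    rw [← sq_abs]
    nlinarith

theorem hasTemperateGrowth_const (c : ℂ) : (fun _ : Rn n => c).HasTemperateGrowth :=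
  Function.HasTemperateGrowth.const c

/-- `‖(e^{-itH₀} - 1) f‖ ≤ |t| ‖H₀ f‖`. -/
theorem norm_freeIso_toL2_sub_le (t : ℝ) (f : 𝓢(Rn n, ℂ)) :
    ‖freeIso t (toL2 f) - (toL2 f)‖ ≤ |t| * ‖(toL2 (kineticS f))‖ := by
  have h1 : freeS t f - f = SchwartzMap.fourierMultiplierCLM ℂ
      (freeSymbol t + fun _ => (-1 : ℂ)) f := by
    rw [fourierMultiplierCLM_add (hasTemperateGrowth_freeSymbol t) (hasTemperateGrowth_const _),
      SchwartzMap.fourierMultiplierCLM_const]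
    simp [freeS, sub_eq_add_neg]
  have h2 : freeIso t (toL2 f) - (toL2 f) = (toL2 (freeS t f - f)) := by
    rw [freeIso_toL2]; rfl
  rw [h2, h1]
  refine norm_toL2_fourierMultiplier_le ((hasTemperateGrowth_freeSymbol t).add
    (hasTemperateGrowth_const _)) hasTemperateGrowth_kineticSymbol_complex (fun ξ => ?_) f
  rw [Pi.add_apply, freeSymbol_eq, ← sub_eq_add_neg]
  refine (norm_exp_mul_I_sub_one_le _).trans_eq ?_
  rw [abs_neg, abs_mul, Complex.norm_real, Real.norm_eq_abs]

/-- The second-order Taylor remainder of the exponential, read through Plancherel. Being O(t²), it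
gives differentiability at 0 in the `L²` norm. -/
theorem norm_freeIso_toL2_sub_add_le (t : ℝ) (f : 𝓢(Rn n, ℂ)) :
    ‖freeIso t (toL2 f) - (toL2 f) + (Complex.I * t) • (toL2 (kineticS f))‖
      ≤ 3 * t ^ 2 * ‖(toL2 (kineticS (kineticS f)))‖ := by
  have hk := hasTemperateGrowth_kineticSymbol_complex (n := n)
  have hk' : ((Complex.I * t) • fun ξ : Rn n => (kineticSymbol ξ : ℂ)).HasTemperateGrowth :=
    (hasTemperateGrowth_const (Complex.I * t)).mul hk
  have h0 := (hasTemperateGrowth_freeSymbol (n := n) t).add (hasTemperateGrowth_const (-1))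
  have h1 : freeS t f - f + (Complex.I * t) • kineticS f = SchwartzMap.fourierMultiplierCLM ℂ
      ((freeSymbol t + fun _ => (-1 : ℂ)) + (Complex.I * t) • fun ξ => (kineticSymbol ξ : ℂ)) f := by
    rw [fourierMultiplierCLM_add h0 hk', SchwartzMap.fourierMultiplierCLM_smul hk,
      fourierMultiplierCLM_add (hasTemperateGrowth_freeSymbol t) (hasTemperateGrowth_const _),
      SchwartzMap.fourierMultiplierCLM_const]
    simp [freeS, sub_eq_add_neg, kineticS]
  have h2 : freeIso t (toL2 f) - (toL2 f) + (Complex.I * t) • (toL2 (kineticS f))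
      = (toL2 (freeS t f - f + (Complex.I * t) • kineticS f)) := by
    rw [freeIso_toL2]; rfl
  have h3 : kineticS (kineticS f) = SchwartzMap.fourierMultiplierCLM ℂ
      ((fun ξ : Rn n => (kineticSymbol ξ : ℂ)) * fun ξ => (kineticSymbol ξ : ℂ)) f := by
    rw [kineticS, SchwartzMap.fourierMultiplierCLM_fourierMultiplierCLM_apply hk hk]
  rw [h2, h1, h3]
  refine norm_toL2_fourierMultiplier_le (h0.add hk') (hk.mul hk) (fun ξ => ?_) f
  have h4 := norm_exp_mul_I_sub_one_sub_le (-(t * kineticSymbol ξ))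
  rw [← freeSymbol_eq] at h4
  convert h4 using 1
  · congr 1
    simp only [Pi.add_apply, Pi.smul_apply, smul_eq_mul]
    push_cast
    ring
  · simp only [Pi.mul_apply, norm_mul, Complex.norm_real, Real.norm_eq_abs, abs_mul_abs_self]
    ring

theorem hasDerivAt_freeIso_toL2_zero (f : 𝓢(Rn n, ℂ)) :
    HasDerivAt (fun t => freeIso t (toL2 f)) (-(Complex.I • (toL2 (kineticS f)))) 0 := by
  rw [hasDerivAt_iff_isLittleO]
  refine Asymptotics.IsBigO.trans_isLittleO (g := fun t : ℝ => t ^ 2) ?_ ?_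
  · refine Asymptotics.IsBigO.of_bound
      (3 * ‖(toL2 (kineticS (kineticS f)))‖) (Eventually.of_forall ?_)
    intro t
    have h := norm_freeIso_toL2_sub_add_le t f
    rw [freeIso_zero, sub_zero]
    have h2 : freeIso t (toL2 f) - (toL2 f) - t • -(Complex.I • (toL2 (kineticS f)))
        = freeIso t (toL2 f) - (toL2 f)
          + (Complex.I * t) • (toL2 (kineticS f)) := by
      rw [smul_neg, sub_neg_eq_add, ← algebraMap_smul ℂ t, smul_smul, mul_comm]
      rfl
    rw [h2]
    refine h.trans_eq ?_
    rw [Real.norm_eq_abs, abs_of_nonneg (sq_nonneg t)]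
    ring
  · simp only [sub_zero]
    exact Asymptotics.isLittleO_pow_id one_lt_two

/-- The free evolution is differentiable in `L²` on Schwartz functions. -/
theorem hasDerivAt_freeIso_toL2 (f : 𝓢(Rn n, ℂ)) (t : ℝ) :
    HasDerivAt (fun t => freeIso t (toL2 f)) (-(Complex.I • (toL2 (kineticS (freeS t f))))) t := by
  have h := hasDerivAt_freeIso_toL2_zero (freeS t f)
  rw [← sub_self t] at h
  have h2 := h.comp_sub_const t t
  refine h2.congr_of_eventuallyEq (Eventually.of_forall fun τ => ?_)
  simp only
  rw [← freeIso_toL2, ← freeIso_add, sub_add_cancel]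

/-- A family of isometries that is strongly continuous on a dense set is strongly continuous. -/
theorem continuous_of_dense_isometry {E F ι : Type*} [NormedAddCommGroup E] [NormedAddCommGroup F]
    {U : ℝ → E → F} (hU : ∀ t u v, ‖U t u - U t v‖ ≤ ‖u - v‖) {d : ι → E} (hd : DenseRange d)
    (hc : ∀ i, Continuous fun t => U t (d i)) (u : E) : Continuous fun t => U t u := by
  refine continuous_iff_continuousAt.2 fun t₀ => Metric.continuousAt_iff.2 fun ε hε => ?_
  obtain ⟨i, hi⟩ := hd.exists_dist_lt u (ε := ε / 3) (by positivity)
  obtain ⟨r, hr, h⟩ := Metric.continuousAt_iff.1 (hc i).continuousAt (ε / 3) (by positivity)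
  refine ⟨r, hr, fun {t} ht => ?_⟩
  have h1 : dist (U t u) (U t (d i)) < ε / 3 := by
    rw [dist_eq_norm] at hi ⊢
    exact (hU t _ _).trans_lt hi
  have h2 : dist (U t₀ (d i)) (U t₀ u) < ε / 3 := by
    rw [dist_comm, dist_eq_norm]
    rw [dist_eq_norm] at hi
    exact (hU _ _ _).trans_lt hi
  have h3 := h ht
  have h4 := dist_triangle4 (U t u) (U t (d i)) (U t₀ (d i)) (U t₀ u)
  linarith

theorem continuous_freeIso (u : L2 n) : Continuous fun t => freeIso t u := by
  refine continuous_of_dense_isometry (U := fun t u => freeIso t u) (fun t u v => ?_)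
    dense_schwartz (fun f => ?_) u
  · rw [← map_sub, LinearIsometryEquiv.norm_map]
  · exact continuous_iff_continuousAt.2 fun t => (hasDerivAt_freeIso_toL2 f t).continuousAt

/-! ### The generator of the free evolution -/

/-- The bilinear pairing `∫ u v` on `L²`. -/
def pairL2 : L2 n →L[ℂ] L2 n →L[ℂ] ℂ :=
  (ContinuousLinearMap.mul ℂ ℂ).lpPairing volume 2 2

theorem pairL2_apply (u v : L2 n) : pairL2 u v = ∫ x, u x * v x := by
  rw [pairL2, ContinuousLinearMap.lpPairing_eq_integral]
  rfl

theorem toTemperedDistribution_eq_pairL2 (u : L2 n) (φ : 𝓢(Rn n, ℂ)) :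
    (u : 𝓢'(Rn n, ℂ)) φ = pairL2 u (toL2 φ) := by
  rw [Lp.toTemperedDistribution_apply, pairL2_apply]
  apply integral_congr_ae
  filter_upwards [coeFn_toL2 φ] with x hx
  rw [hx, smul_eq_mul, mul_comm]

theorem eq_of_forall_pairL2 {u v : L2 n}
    (h : ∀ φ : 𝓢(Rn n, ℂ), pairL2 u (toL2 φ) = pairL2 v (toL2 φ)) : u = v := by
  have hinj : Function.Injective (Lp.toTemperedDistributionCLM ℂ (volume : Measure (Rn n)) 2) :=
    LinearMap.ker_eq_bot.1 Lp.ker_toTemperedDistributionCLM_eq_bot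
  apply hinj
  ext φ
  simp only [Lp.toTemperedDistributionCLM_apply]
  rw [toTemperedDistribution_eq_pairL2, toTemperedDistribution_eq_pairL2, h]

theorem freeSymbol_neg_arg (t : ℝ) (ξ : Rn n) : freeSymbol t (-ξ) = freeSymbol t ξ := by
  simp [freeSymbol_eq, kineticSymbol]

/-- The free evolution is symmetric for the bilinear pairing. -/
theorem pairL2_freeIso (t : ℝ) (u v : L2 n) :
    pairL2 (freeIso t u) v = pairL2 u (freeIso t v) := by
  have key : ∀ f g : 𝓢(Rn n, ℂ), pairL2 (toL2 (freeS t f)) (toL2 g)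
      = pairL2 (toL2 f) (toL2 (freeS t g)) := by
    intro f g
    rw [← toTemperedDistribution_eq_pairL2, ← toTemperedDistribution_eq_pairL2,
      toL2_eq, toL2_eq, Lp.toTemperedDistribution_toLp_eq, Lp.toTemperedDistribution_toLp_eq]
    have h := TemperedDistribution.fourierMultiplierCLM_toTemperedDistributionCLM_eq (F := ℂ)
      (hasTemperateGrowth_freeSymbol (n := n) t) f
    rw [freeS, ← h, TemperedDistribution.fourierMultiplierCLM_apply_apply]
    congr 1
    ext x
    rw [SchwartzMap.fourierMultiplierCLM_apply, SchwartzMap.fourierInv_coe,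
      SchwartzMap.fourier_coe, Real.fourierInv_eq_fourier_comp_neg]
    -- 𝓕 and 𝓕⁻ differ by the reflection ξ ↦ -ξ, and the symbol is even; this is why the evolution
    -- equals its own transpose.
    refine congrFun (congrArg 𝓕 (funext fun y => ?_)) x
    rw [SchwartzMap.smulLeftCLM_apply_apply (hasTemperateGrowth_freeSymbol t),
      SchwartzMap.smulLeftCLM_apply_apply (hasTemperateGrowth_freeSymbol t), freeSymbol_neg_arg,
      SchwartzMap.fourierInv_coe, Real.fourierInv_eq_fourier_neg, SchwartzMap.fourier_coe]
  refine DenseRange.induction_on dense_schwartz u ?_ fun f => ?_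
  · exact isClosed_eq (by fun_prop) (by fun_prop)
  · refine DenseRange.induction_on dense_schwartz v ?_ fun g => ?_
    · exact isClosed_eq (by fun_prop) (by fun_prop)
    · rw [freeIso_toL2, freeIso_toL2, key]

/-- The Laplacian of a distribution is defined by moving it to the test function, where it is the
multiplier `kineticS`. -/
theorem hamiltonianGraph_zero_iff (u w : L2 n) :
    (-(1 / 2) : ℂ) • Δ (u : 𝓢'(Rn n, ℂ)) = (w : 𝓢'(Rn n, ℂ)) ↔
      ∀ φ : 𝓢(Rn n, ℂ), pairL2 u (toL2 (kineticS φ)) = pairL2 w (toL2 φ) := by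
  have h : ∀ φ : 𝓢(Rn n, ℂ), ((-(1 / 2) : ℂ) • Δ (u : 𝓢'(Rn n, ℂ))) φ
      = pairL2 u (toL2 (kineticS φ)) := fun φ => by
    rw [smul_apply, TemperedDistribution.laplacian_apply_apply, kineticS_eq,
      ← toTemperedDistribution_eq_pairL2, map_smul]
  constructor
  · intro hu φ
    rw [← h, hu, toTemperedDistribution_eq_pairL2]
  · intro hu
    ext φ
    rw [h, hu, toTemperedDistribution_eq_pairL2]

/-- The generator of the free evolution is `-iH₀`, with `H₀ = -½Δ` in the distributional sense. -/
theorem free_generator (u w : L2 n) :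
    (-(1 / 2) : ℂ) • Δ (u : 𝓢'(Rn n, ℂ)) = (w : 𝓢'(Rn n, ℂ)) ↔
      HasDerivAt (fun t => freeIso t u) (-(Complex.I • w)) 0 := by
  rw [hamiltonianGraph_zero_iff]
  have hd : ∀ (φ : 𝓢(Rn n, ℂ)) (t : ℝ), HasDerivAt (fun t => pairL2 (freeIso t u) (toL2 φ))
      (pairL2 u (-(Complex.I • (toL2 (kineticS (freeS t φ)))))) t := by
    intro φ t
    simp only [pairL2_freeIso]
    exact ((pairL2 u).restrictScalars ℝ).hasFDerivAt.comp_hasDerivAt t (hasDerivAt_freeIso_toL2 φ t)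
  constructor
  · intro h
    -- Passing from weak to strong differentiability: b is the integrated form of the equation and
    -- is differentiable in norm. Tested against Schwartz functions it has the same derivative and
    -- initial value as e^{-itH₀}u, so the two coincide.
    set b : ℝ → L2 n := fun t => u + ∫ s in (0 : ℝ)..t, -(Complex.I • freeIso s w)
    have hc : Continuous fun s => -(Complex.I • freeIso s w) :=
      ((continuous_freeIso w).const_smul Complex.I).neg
    have hb : ∀ t, HasDerivAt b (-(Complex.I • freeIso t w)) t := fun t =>
      (hc.integral_hasStrictDerivAt 0 t).hasDerivAt.const_add u
    have hub : (fun t => freeIso t u) = b := by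
      funext t
      refine eq_of_forall_pairL2 fun φ => ?_
      have hdiff : ∀ s, HasDerivAt
          (fun s => pairL2 (freeIso s u) (toL2 φ) - pairL2 (b s) (toL2 φ)) 0 s := by
        intro s
        have h1 := hd φ s
        have h2 : HasDerivAt (fun s => pairL2 (b s) (toL2 φ))
            (pairL2 (-(Complex.I • freeIso s w)) (toL2 φ)) s :=
          ((pairL2.flip (toL2 φ)).restrictScalars ℝ).hasFDerivAt.comp_hasDerivAt s (hb s)
        have h3 := h1.sub h2
        rwa [map_neg, map_smul, h, map_neg, map_smul, neg_apply, smul_apply, pairL2_freeIso,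
          freeIso_toL2, sub_self] at h3
      have hconst := is_const_of_deriv_eq_zero (fun s => (hdiff s).differentiableAt)
        (fun s => (hdiff s).deriv) t 0
      simp only [b, intervalIntegral.integral_same, add_zero, freeIso_zero, sub_self] at hconst
      exact sub_eq_zero.1 hconst
    rw [hub]
    simpa [freeIso_zero] using hb 0
  · intro h φ
    have h1 := hd φ 0
    have h2 : HasDerivAt (fun s => pairL2 (freeIso s u) (toL2 φ))
        (pairL2 (-(Complex.I • w)) (toL2 φ)) 0 :=
      ((pairL2.flip (toL2 φ)).restrictScalars ℝ).hasFDerivAt.comp_hasDerivAt 0 h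
    have h3 := h1.unique h2
    have h4 : freeS 0 φ = φ := by
      apply toL2_injective
      rw [← freeIso_toL2, freeIso_zero]
    rw [h4, map_neg, map_smul, map_neg, map_smul, neg_apply, smul_apply, neg_inj] at h3
    exact smul_right_injective ℂ Complex.I_ne_zero h3

/-! ### Linear evolution equations with bounded strongly continuous coefficients -/

section Flow

variable {H : Type*} [NormedAddCommGroup H]

theorem continuous_apply_of_strong [NormedSpace ℂ H] {A : ℝ → H →L[ℂ] H} {C : ℝ}
    (hA : ∀ t, ‖A t‖ ≤ C)
    (hc : ∀ u, Continuous fun t => A t u) {x : ℝ → H} (hx : Continuous x) :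
    Continuous fun t => A t (x t) := by
  refine continuous_iff_continuousAt.2 fun t₀ => ?_
  have h1 : Tendsto (fun t => A t (x t - x t₀)) (𝓝 t₀) (𝓝 0) := by
    refine squeeze_zero_norm (a := fun t => C * ‖x t - x t₀‖) (fun t => ?_) ?_
    · exact ((A t).le_opNorm _).trans (mul_le_mul_of_nonneg_right (hA t) (norm_nonneg _))
    · have : Continuous fun t => C * ‖x t - x t₀‖ := by fun_prop
      simpa using this.tendsto t₀
  have h2 := h1.add (hc (x t₀)).continuousAt.tendsto
  simpa [ContinuousAt] using h2

variable [NormedSpace ℂ H]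

/-- Picard iteration carried out on all of ℝ at once: for x = cosh(lt)·y with y bounded, the
integral operator becomes a contraction when l is large compared with C. The coefficients need only
be strongly continuous. -/
theorem exists_linear_flow [CompleteSpace H] {A : ℝ → H →L[ℂ] H} {C : ℝ} (hA : ∀ t, ‖A t‖ ≤ C)
    (hc : ∀ u, Continuous fun t => A t u) (u : H) :
    ∃ x : ℝ → H, x 0 = u ∧ ∀ t, HasDerivAt x (A t (x t)) t := by
  have hC : 0 ≤ C := (norm_nonneg _).trans (hA 0)
  -- The integral of cosh(ls) from 0 to t is sinh(lt)/l, so the Lipschitz constant is at most C/l ≤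
  -- 1/2. The summand 1 keeps l positive when C = 0.
  set l : ℝ := 2 * C + 1 with hl
  have hlpos : 0 < l := by positivity
  set w : ℝ → ℝ := fun t => Real.cosh (l * t) with hw
  have hwc : Continuous w := by fun_prop
  have hwpos : ∀ t, 0 < w t := fun t => Real.cosh_pos _
  have hcont : ∀ y : BoundedContinuousFunction ℝ H, Continuous fun s => A s (w s • y s) :=
    fun y => continuous_apply_of_strong hA hc (hwc.smul y.continuous)
  have hbound : ∀ (y : ℝ → H) (D : ℝ), 0 ≤ D → (∀ s, ‖y s‖ ≤ D) → ∀ t,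
      ‖(w t)⁻¹ • ∫ s in (0 : ℝ)..t, A s (w s • y s)‖ ≤ D / 2 := by
    intro y D hD hy t
    have h1 : ‖∫ s in (0 : ℝ)..t, A s (w s • y s)‖ ≤ |∫ s in (0 : ℝ)..t, C * D * w s| := by
      refine intervalIntegral.norm_integral_le_abs_of_norm_le ?_ ?_
      · refine Eventually.of_forall fun s => ?_
        refine ((A s).le_opNorm _).trans ?_
        rw [norm_smul, Real.norm_of_nonneg (hwpos s).le, mul_assoc, mul_comm D]
        exact mul_le_mul (hA s) (mul_le_mul_of_nonneg_left (hy s) (hwpos s).le)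
          (by positivity [hwpos s]) hC
      · exact (Continuous.intervalIntegrable (by fun_prop) _ _)
    have h2 : ∫ s in (0 : ℝ)..t, C * D * w s = C * D * (Real.sinh (l * t) / l) := by
      have hd : ∀ s ∈ Set.uIcc 0 t, HasDerivAt (fun s => Real.sinh (l * s) / l) (w s) s := by
        intro s _
        have h := ((Real.hasDerivAt_sinh (l * s)).comp s ((hasDerivAt_id s).const_mul l)).div_const l
        simpa [hlpos.ne', hw] using h
      rw [intervalIntegral.integral_const_mul, intervalIntegral.integral_eq_sub_of_hasDerivAt hd
        (hwc.intervalIntegrable _ _)]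
      simp
    have h3 : |Real.sinh (l * t)| ≤ w t := by
      rw [abs_le]
      have h4 := Real.cosh_add_sinh (l * t)
      have h5 := Real.cosh_sub_sinh (l * t)
      have h6 := Real.exp_pos (l * t)
      have h7 := Real.exp_pos (-(l * t))
      simp only [hw]
      constructor <;> linarith
    rw [norm_smul, norm_inv, Real.norm_of_nonneg (hwpos t).le, inv_mul_le_iff₀ (hwpos t)]
    refine h1.trans ?_
    rw [h2, abs_mul, abs_div, abs_of_pos hlpos, abs_of_nonneg (by positivity)]
    have h8 : C / l ≤ 1 / 2 := by
      rw [div_le_div_iff₀ hlpos two_pos]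
      linarith
    calc C * D * (|Real.sinh (l * t)| / l) = (C / l) * (D * |Real.sinh (l * t)|) := by ring
      _ ≤ (1 / 2) * (D * w t) := by
        refine mul_le_mul h8 (mul_le_mul_of_nonneg_left h3 hD) (by positivity) (by positivity)
      _ = w t * (D / 2) := by ring
  let T : BoundedContinuousFunction ℝ H → BoundedContinuousFunction ℝ H := fun y =>
    BoundedContinuousFunction.ofNormedAddCommGroup
      (fun t => (w t)⁻¹ • (u + ∫ s in (0 : ℝ)..t, A s (w s • y s)))
      ((hwc.inv₀ fun t => (hwpos t).ne').smul (continuous_const.add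
        (intervalIntegral.continuous_primitive (fun a b => (hcont y).intervalIntegrable a b) 0)))
      (‖u‖ + ‖y‖ / 2) (fun t => by
        rw [smul_add]
        refine (norm_add_le _ _).trans (add_le_add ?_ (hbound y _ (norm_nonneg _)
          y.norm_coe_le_norm t))
        rw [norm_smul, norm_inv, Real.norm_of_nonneg (hwpos t).le]
        exact mul_le_of_le_one_left (norm_nonneg _) (inv_le_one_of_one_le₀ (Real.one_le_cosh _)))
  have hT : ContractingWith (1 / 2) T := by
    refine ⟨by norm_num, LipschitzWith.of_dist_le_mul fun y z => ?_⟩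
    have h0 : (0 : ℝ) ≤ (1 / 2 : NNReal) * dist y z := by positivity
    refine (BoundedContinuousFunction.dist_le h0).2 fun t => ?_
    have h1 : T y t - T z t = (w t)⁻¹ • ∫ s in (0 : ℝ)..t, A s (w s • (y s - z s)) := by
      simp only [T, BoundedContinuousFunction.coe_ofNormedAddCommGroup]
      rw [← smul_sub, add_sub_add_left_eq_sub, ← intervalIntegral.integral_sub
        ((hcont y).intervalIntegrable _ _) ((hcont z).intervalIntegrable _ _)]
      simp only [smul_sub, map_sub]
    rw [dist_eq_norm, h1]
    refine (hbound (fun s => y s - z s) (dist y z) dist_nonneg (fun s => ?_) t).trans_eq ?_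
    · rw [← dist_eq_norm]
      exact BoundedContinuousFunction.dist_coe_le_dist s
    · simp only [NNReal.coe_div, NNReal.coe_one, NNReal.coe_ofNat]
      ring
  set y := hT.fixedPoint T with hy
  have hfix : T y = y := hT.fixedPoint_isFixedPt
  have hx : ∀ t, w t • y t = u + ∫ s in (0 : ℝ)..t, A s (w s • y s) := by
    intro t
    conv_lhs => rw [← hfix]
    simp only [T, BoundedContinuousFunction.coe_ofNormedAddCommGroup]
    rw [smul_smul, mul_inv_cancel₀ (hwpos t).ne', one_smul]
  refine ⟨fun t => w t • y t, (hx 0).trans (by rw [intervalIntegral.integral_same, add_zero]),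
    fun t => ?_⟩
  have h := ((hcont y).integral_hasStrictDerivAt 0 t).hasDerivAt.const_add u
  exact h.congr_of_eventuallyEq (Eventually.of_forall hx)

theorem linear_flow_unique {A : ℝ → H →L[ℂ] H} {C : ℝ} (hA : ∀ t, ‖A t‖ ≤ C) {x y : ℝ → H}
    (hx : ∀ t, HasDerivAt x (A t (x t)) t) (hy : ∀ t, HasDerivAt y (A t (y t)) t)
    (h0 : x 0 = y 0) : x = y := by
  have hC : 0 ≤ C := (norm_nonneg _).trans (hA 0)
  refine ODE_solution_unique_univ (v := fun t u => A t u) (s := fun _ => Set.univ)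
    (K := ⟨C, hC⟩) (t₀ := 0) (fun t => ?_) (fun t => ⟨hx t, trivial⟩) (fun t => ⟨hy t, trivial⟩) h0
  refine LipschitzWith.lipschitzOnWith ((A t).lipschitz.weaken ?_)
  exact hA t

end Flow

/-! ### Bounded symmetric perturbations of unitary groups -/

section Perturbation

variable {H : Type*} [NormedAddCommGroup H] [InnerProductSpace ℂ H]

/-- A product rule under strong continuity only. The isometry property carries the convergence of
the slopes of z through W s, and the derivative of W is needed on the single vector z t. -/
theorem hasDerivAt_apply_of_isometry {W : ℝ → H ≃ₗᵢ[ℂ] H} {z : ℝ → H} {z' w' : H} {t : ℝ}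
    (hc : ∀ u, Continuous fun s => W s u) (hz : HasDerivAt z z' t)
    (hw : HasDerivAt (fun s => W s (z t)) w' t) :
    HasDerivAt (fun s => W s (z s)) (W t z' + w') t := by
  have h1 : HasDerivAt (fun s => W s (z s - z t)) (W t z') t := by
    rw [hasDerivAt_iff_tendsto_slope] at hz ⊢
    have h2 : Tendsto (fun s => W s (slope z t s - z')) (𝓝[≠] t) (𝓝 0) := by
      rw [tendsto_zero_iff_norm_tendsto_zero]
      simp only [LinearIsometryEquiv.norm_map]
      rw [← tendsto_zero_iff_norm_tendsto_zero]
      simpa using hz.sub_const z'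
    have h3 := h2.add ((hc z').continuousAt.tendsto.mono_left (nhdsWithin_le_nhds (s := {t}ᶜ)))
    simp only [map_sub, sub_add_cancel, zero_add] at h3
    refine h3.congr fun s => ?_
    rw [slope_def_module, slope_def_module, sub_self, map_zero, sub_zero]
    exact ((W s).toContinuousLinearEquiv.toContinuousLinearMap.restrictScalars ℝ).map_smul _ _
  have h4 := h1.add hw
  refine h4.congr_of_eventuallyEq (Eventually.of_forall fun s => ?_)
  simp [map_sub]

/-- The interaction picture: U t = U₀(t)x(t), where x' = -iU₀(-t)V U₀(t)x is an equation with
bounded coefficients. Uniqueness of its solutions gives linearity and the group law; symmetry of V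
conserves the norm. The unbounded generator of U₀ is never manipulated directly. -/
theorem exists_perturbed_group [CompleteSpace H] {U₀ : ℝ → H ≃ₗᵢ[ℂ] H}
    (hadd : ∀ t t' u, U₀ (t + t') u = U₀ t (U₀ t' u)) (hcont : ∀ u, Continuous fun t => U₀ t u)
    {V : H →L[ℂ] H} (hV : ∀ u v, inner ℂ (V u) v = inner ℂ u (V v)) :
    ∃ U : ℝ → H ≃ₗᵢ[ℂ] H, (∀ t t' u, U (t + t') u = U t (U t' u)) ∧
      (∀ u, Continuous fun t => U t u) ∧
      ∀ u w, HasDerivAt (fun t => U₀ t u) (-(Complex.I • (w - V u))) 0 ↔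
        HasDerivAt (fun t => U t u) (-(Complex.I • w)) 0 := by
  have hzero : ∀ u, U₀ 0 u = u := fun u => (U₀ 0).injective (by rw [← hadd, add_zero])
  have hneg : ∀ t u, U₀ (-t) (U₀ t u) = u := fun t u => by rw [← hadd, neg_add_cancel, hzero]
  have hneg' : ∀ t u, U₀ t (U₀ (-t) u) = u := fun t u => by rw [← hadd, add_neg_cancel, hzero]
  let L : ℝ → H →L[ℂ] H := fun t => (U₀ t).toContinuousLinearEquiv.toContinuousLinearMap
  have hL : ∀ t u, L t u = U₀ t u := fun t u => rfl
  have hLn : ∀ t, ‖L t‖ ≤ 1 := fun t =>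
    ContinuousLinearMap.opNorm_le_bound _ zero_le_one fun u => by rw [hL]; simp
  let A : ℝ → H →L[ℂ] H := fun t => (-Complex.I) • (L (-t) ∘L V ∘L L t)
  have hA' : ∀ t u, A t u = -(Complex.I • U₀ (-t) (V (U₀ t u))) := fun t u => by
    simp [A, hL]
  have hA : ∀ t, ‖A t‖ ≤ ‖V‖ := fun t => by
    refine ContinuousLinearMap.opNorm_le_bound _ (norm_nonneg _) fun u => ?_
    rw [hA', norm_neg, norm_smul, Complex.norm_I, one_mul, LinearIsometryEquiv.norm_map]
    exact (V.le_opNorm _).trans_eq (by rw [LinearIsometryEquiv.norm_map])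
  have hAc : ∀ u, Continuous fun t => A t u := fun u => by
    have h1 : Continuous fun t => V (U₀ t u) := V.continuous.comp (hcont u)
    have h2 := continuous_apply_of_strong (A := fun t => L (-t)) (C := 1) (fun t => hLn _)
      (fun v => (hcont v).comp continuous_neg) h1
    simp only [hA']
    exact (h2.const_smul Complex.I).neg
  choose x hx0 hx using exists_linear_flow hA hAc
  have huniq : ∀ (u : H) (y : ℝ → H), y 0 = u → (∀ t, HasDerivAt y (A t (y t)) t) → y = x u :=
    fun u y h0 hy => linear_flow_unique hA hy (hx u) (by rw [h0, hx0])
  have hxadd : ∀ u v t, x (u + v) t = x u t + x v t := fun u v t =>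
    (congrFun (huniq (u + v) (fun t => x u t + x v t) (by simp only [hx0])
      fun t => by rw [map_add]; exact (hx u t).add (hx v t)) t).symm
  have hxsmul : ∀ (c : ℂ) u t, x (c • u) t = c • x u t := fun c u t =>
    (congrFun (huniq (c • u) (fun t => c • x u t) (by simp only [hx0])
      fun t => by rw [map_smul]; exact (hx u t).const_smul c) t).symm
  have hxnorm : ∀ u t, ‖x u t‖ = ‖u‖ := by
    intro u t
    have hd : ∀ t, HasDerivAt (fun t => ‖x u t‖ ^ 2) 0 t := by
      intro t
      have h := (hx u t).inner ℂ (hx u t)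
      have h2 := Complex.reCLM.hasFDerivAt.comp_hasDerivAt t h
      have h3 : Complex.reCLM (inner ℂ (x u t) (A t (x u t)) + inner ℂ (A t (x u t)) (x u t)) = 0 := by
        have h4 : ∀ v, inner ℂ v (U₀ (-t) (V (U₀ t v))) = inner ℂ (U₀ t v) (V (U₀ t v)) := by
          intro v
          rw [← (U₀ t).inner_map_map, hneg']
        have h5 : ∀ v, inner ℂ (U₀ (-t) (V (U₀ t v))) v = inner ℂ (V (U₀ t v)) (U₀ t v) := by
          intro v
          rw [← (U₀ t).inner_map_map, hneg']
        rw [hA', inner_neg_left, inner_neg_right, inner_smul_left, inner_smul_right, h4, h5, hV]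
        simp
      rw [h3] at h2
      refine h2.congr_of_eventuallyEq (Eventually.of_forall fun s => ?_)
      simp [Function.comp, inner_self_eq_norm_sq_to_K, ← Complex.ofReal_pow]
    have hconst := is_const_of_deriv_eq_zero (fun s => (hd s).differentiableAt)
      (fun s => (hd s).deriv) t 0
    simp only [hx0] at hconst
    exact (pow_left_inj₀ (norm_nonneg _) (norm_nonneg _) two_ne_zero).1 hconst
  have hgroup : ∀ t t' u, U₀ (t + t') (x u (t + t')) = U₀ t (x (U₀ t' (x u t')) t) := by
    intro t t' u
    have h := huniq (U₀ t' (x u t')) (fun s => U₀ t' (x u (s + t'))) (by simp) (fun s => by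
      have h1 := (hx u (s + t')).comp_add_const s t'
      have h2 := ((L t').restrictScalars ℝ).hasFDerivAt.comp_hasDerivAt s h1
      have h3 : L t' (A (s + t') (x u (s + t'))) = A s (U₀ t' (x u (s + t'))) := by
        rw [hL, hA', hA', map_neg, map_smul, hadd s t', show -(s + t') = -t' + -s by ring, hadd,
          hneg']
      exact h3 ▸ h2)
    rw [hadd, ← congrFun h t]
  have hU0 : ∀ u, U₀ 0 (x u 0) = u := fun u => by rw [hx0, hzero]
  let U : ℝ → H ≃ₗᵢ[ℂ] H := fun t =>
    { toFun := fun u => U₀ t (x u t)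
      map_add' := fun u v => by rw [hxadd, map_add]
      map_smul' := fun c u => by rw [hxsmul, map_smul]; rfl
      invFun := fun u => U₀ (-t) (x u (-t))
      left_inv := fun u => by
        have h := hgroup (-t) t u
        rw [neg_add_cancel, hU0] at h
        exact h.symm
      right_inv := fun u => by
        have h := hgroup t (-t) u
        rw [add_neg_cancel, hU0] at h
        exact h.symm
      norm_map' := fun u => by
        change ‖U₀ t (x u t)‖ = ‖u‖
        rw [LinearIsometryEquiv.norm_map, hxnorm] }
  have hU : ∀ t u, U t u = U₀ t (x u t) := fun t u => rfl
  refine ⟨U, fun t t' u => hgroup t t' u, fun u => ?_, fun u w => ?_⟩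
  · exact continuous_apply_of_strong (A := L) hLn hcont
      (continuous_iff_continuousAt.2 fun t => (hx u t).continuousAt)
  -- U t u - U₀ t u is differentiable at 0 for every u, with derivative -iVu. Hence the two groups
  -- are differentiable at 0 on the same vectors, and the domains of the generators agree.
  · have h1 : HasDerivAt (fun t => U₀ t (x u t - u)) (-(Complex.I • V u)) 0 := by
      have h2 := (hx u 0).sub_const u
      have h3 : HasDerivAt (fun s => U₀ s (x u 0 - u)) 0 0 := by
        simp only [hx0, sub_self, map_zero]
        exact hasDerivAt_const _ _
      have h4 := hasDerivAt_apply_of_isometry hcont h2 h3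
      simpa [hA', hx0, hzero] using h4
    constructor
    · intro h
      have h2 := h.add h1
      have h3 : -(Complex.I • (w - V u)) + -(Complex.I • V u) = -(Complex.I • w) := by
        rw [smul_sub]; abel
      rw [h3] at h2
      refine h2.congr_of_eventuallyEq (Eventually.of_forall fun s => ?_)
      simp [hU, map_sub]
    · intro h
      have h2 := h.sub h1
      have h3 : -(Complex.I • w) - -(Complex.I • V u) = -(Complex.I • (w - V u)) := by
        rw [smul_sub]; abel
      rw [h3] at h2
      refine h2.congr_of_eventuallyEq (Eventually.of_forall fun s => ?_)
      simp [hU, map_sub]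

end Perturbation

/-! ### The Schrödinger group -/

theorem hamiltonianGraph_iff {V : Rn n → ℝ} (u w : L2 n) :
    HamiltonianGraph V u w ↔
      HasDerivAt (fun t => freeIso t u) (-(Complex.I • (w - mulL2 (fun x => (V x : ℂ)) u))) 0 := by
  rw [← free_generator, HamiltonianGraph]
  have h : ((w - mulL2 (fun x => (V x : ℂ)) u : L2 n) : 𝓢'(Rn n, ℂ))
      = (w : 𝓢'(Rn n, ℂ)) - (mulL2 (fun x => (V x : ℂ)) u : 𝓢'(Rn n, ℂ)) :=
    (Lp.toTemperedDistributionCLM ℂ (volume : Measure (Rn n)) 2).map_sub _ _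
  rw [h, eq_sub_iff_add_eq]

/-- Shows that the default branch in the definition of `schrodingerGroup` is never taken for bounded
potentials. -/
theorem isSchrodingerGroup_schrodingerGroup {V : Rn n → ℝ} {C : ℝ}
    (hV : IsBoundedSymbol (fun x => (V x : ℂ)) C) :
    IsSchrodingerGroup V (schrodingerGroup V) := by
  have h : ∃ U, IsSchrodingerGroup V U := by
    obtain ⟨U, h1, h2, h3⟩ := exists_perturbed_group (U₀ := freeIso (n := n)) freeIso_add
      continuous_freeIso (V := mulOp hV) (inner_mulL2_real hV)
    exact ⟨U, h1, h2, fun u w => by rw [hamiltonianGraph_iff]; exact h3 u w⟩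
  rw [schrodingerGroup, dif_pos h]
  exact h.choose_spec

/-! ### Cook's method -/

/-- The set of vectors on which a family of isometries converges is closed. -/
theorem exists_tendsto_of_dense_isometry {E F ι : Type*} [NormedAddCommGroup E]
    [NormedAddCommGroup F] [CompleteSpace F] {U : ℝ → E → F} {l : Filter ℝ} [l.NeBot]
    (hU : ∀ t u v, ‖U t u - U t v‖ ≤ ‖u - v‖) {d : ι → E} (hd : DenseRange d)
    (hc : ∀ i, ∃ w, Tendsto (fun t => U t (d i)) l (𝓝 w)) (u : E) :
    ∃ w, Tendsto (fun t => U t u) l (𝓝 w) := by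
  refine CompleteSpace.complete (f := map (fun t => U t u) l) ?_
  refine Metric.cauchy_iff.2 ⟨inferInstance, fun ε hε => ?_⟩
  obtain ⟨i, hi⟩ := hd.exists_dist_lt u (ε := ε / 4) (by positivity)
  obtain ⟨w, hw⟩ := hc i
  refine ⟨(fun t => U t u) '' {t | dist (U t (d i)) w < ε / 4},
    image_mem_map (hw (Metric.ball_mem_nhds w (by positivity))), ?_⟩
  have key : ∀ t, dist (U t (d i)) w < ε / 4 → dist (U t u) w < ε / 2 := fun t ht => by
    have h1 : dist (U t u) (U t (d i)) < ε / 4 := by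
      rw [dist_eq_norm] at hi ⊢
      exact (hU t _ _).trans_lt hi
    linarith [dist_triangle (U t u) (U t (d i)) w]
  rintro _ ⟨t, ht, rfl⟩ _ ⟨t', ht', rfl⟩
  have h1 := key t ht
  have h2 := key t' ht'
  have h3 := dist_triangle_right (U t u) (U t' u) w
  simp only
  linarith

section Wave

variable {V : Rn n → ℝ} {U : ℝ → (L2 n ≃ₗᵢ[ℂ] L2 n)}

/-- Multiplication by the real potential `V` on `L²`. -/
abbrev potL2 (V : Rn n → ℝ) (u : L2 n) : L2 n := mulL2 (fun x => (V x : ℂ)) u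

theorem IsSchrodingerGroup.zero (hU : IsSchrodingerGroup V U) (u : L2 n) : U 0 u = u :=
  (U 0).injective (by rw [← hU.map_add, add_zero])

theorem IsSchrodingerGroup.apply_neg (hU : IsSchrodingerGroup V U) (t : ℝ) (u : L2 n) :
    U t (U (-t) u) = u := by
  rw [← hU.map_add, add_neg_cancel, hU.zero]

theorem IsSchrodingerGroup.inner_neg_right (hU : IsSchrodingerGroup V U) (t : ℝ) (u v : L2 n) :
    inner ℂ u (U (-t) v) = inner ℂ (U t u) v := by
  rw [← (U t).inner_map_map, hU.apply_neg]

/-- The derivative of `e^{itH} e^{-itH₀} f` for a Schwartz function `f`. -/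
theorem IsSchrodingerGroup.hasDerivAt_interaction (hU : IsSchrodingerGroup V U)
    (f : 𝓢(Rn n, ℂ)) (t : ℝ) :
    HasDerivAt (fun t => U (-t) (freeIso t (toL2 f)))
      (U (-t) (Complex.I • potL2 V (freeIso t (toL2 f)))) t := by
  set z : L2 n := freeIso t (toL2 f) with hz
  have hzS : z = toL2 (freeS t f) := freeIso_toL2 t f
  set k : L2 n := toL2 (kineticS (freeS t f)) with hk
  -- The free evolution keeps Schwartz vectors Schwartz, hence in the domain of H, with Hz = k + Vz.
  -- In the product rule below the kinetic part k cancels and only the potential remains.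
  have h1 : HasDerivAt (fun s => U s z) (-(Complex.I • (k + potL2 V z))) 0 := by
    rw [← hU.generator, hamiltonianGraph_iff, add_sub_cancel_right, hzS]
    exact hasDerivAt_freeIso_toL2_zero _
  have h2 : HasDerivAt (fun s => U (-s) z) (U (-t) (Complex.I • (k + potL2 V z))) t := by
    have h3 : HasDerivAt (fun s => U (t - s) z) (Complex.I • (k + potL2 V z)) t := by
      rw [← sub_self t] at h1
      have := h1.comp_const_sub t t
      simpa using this
    have h4 := ((U (-t)).toContinuousLinearEquiv.toContinuousLinearMap.restrictScalars
      ℝ).hasFDerivAt.comp_hasDerivAt t h3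
    refine h4.congr_of_eventuallyEq (Eventually.of_forall fun s => ?_)
    change U (-s) z = U (-t) (U (t - s) z)
    rw [← hU.map_add]
    congr 2
    ring
  have h5 := hasDerivAt_apply_of_isometry (W := fun s => U (-s))
    (fun u => (hU.continuous u).comp continuous_neg) (hasDerivAt_freeIso_toL2 f t) h2
  have e : U (-t) (-(Complex.I • k)) + U (-t) (Complex.I • (k + potL2 V z))
      = U (-t) (Complex.I • potL2 V z) := by
    rw [← _root_.map_add, smul_add, neg_add_cancel_left]
  rw [← e]
  exact h5

theorem continuous_potL2_freeIso {C : ℝ} (hV : IsBoundedSymbol (fun x => (V x : ℂ)) C) (u : L2 n) :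
    Continuous fun t => potL2 V (freeIso t u) :=
  (mulOp hV).continuous.comp (continuous_freeIso u)

theorem IsSchrodingerGroup.continuous_apply (hU : IsSchrodingerGroup V U) {x : ℝ → L2 n}
    (hx : Continuous x) : Continuous fun t => U (-t) (x t) :=
  continuous_apply_of_strong
    (A := fun t => (U (-t)).toContinuousLinearEquiv.toContinuousLinearMap) (C := 1)
    (fun t => ContinuousLinearMap.opNorm_le_bound _ zero_le_one fun u => by
      rw [one_mul]; exact ((U (-t)).norm_map u).le)
    (fun u => (hU.continuous u).comp continuous_neg) hx

theorem IsSchrodingerGroup.integrable_interaction {C : ℝ}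
    (hV : IsBoundedSymbol (fun x => (V x : ℂ)) C) (hU : IsSchrodingerGroup V U) {f : 𝓢(Rn n, ℂ)}
    (hf : Integrable fun t => ‖potL2 V (freeIso t (toL2 f))‖) :
    Integrable fun t => U (-t) (Complex.I • potL2 V (freeIso t (toL2 f))) := by
  refine hf.mono' (Continuous.aestronglyMeasurable ?_) (Eventually.of_forall fun t => ?_)
  · exact hU.continuous_apply ((continuous_potL2_freeIso hV _).const_smul Complex.I)
  · rw [LinearIsometryEquiv.norm_map, norm_smul, Complex.norm_I, one_mul]

/-- Cook's criterion: an integrable derivative forces convergence on a dense set, and uniform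
isometry extends the limit to all of `L²`. -/
theorem exists_isWaveOperator {C : ℝ} (hV : IsBoundedSymbol (fun x => (V x : ℂ)) C) {ι : Type*}
    {d : ι → 𝓢(Rn n, ℂ)} (hd : DenseRange fun i => toL2 (d i))
    (hf : ∀ i, Integrable fun t => ‖potL2 V (freeIso t (toL2 (d i)))‖) {l : Filter ℝ}
    (hl : l = atTop ∨ l = atBot) : ∃ W, IsWaveOperator V l W := by
  have hU := isSchrodingerGroup_schrodingerGroup hV
  have : l.NeBot := by rcases hl with rfl | rfl <;> infer_instance
  have hlim := exists_tendsto_of_dense_isometry (l := l)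
    (U := fun t u => schrodingerGroup V (-t) (freeIso t u)) (fun t u v => by
      rw [← map_sub, ← map_sub, LinearIsometryEquiv.norm_map, LinearIsometryEquiv.norm_map]) hd
    (fun i => by
      have hint := hU.integrable_interaction hV (hf i)
      rcases hl with rfl | rfl
      · exact ⟨_, tendsto_limUnder_of_hasDerivAt_of_integrableOn_Ioi (a := 0)
          (fun t _ => hU.hasDerivAt_interaction (d i) t) hint.integrableOn⟩
      · exact ⟨_, tendsto_limUnder_of_hasDerivAt_of_integrableOn_Iic (a := 0)
          (fun t _ => hU.hasDerivAt_interaction (d i) t) hint.integrableOn⟩)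
  choose W hW using hlim
  refine ⟨LinearMap.mkContinuous
    { toFun := W
      map_add' := fun u v => tendsto_nhds_unique (hW (u + v)) (by
        simpa only [map_add] using (hW u).add (hW v))
      map_smul' := fun c u => tendsto_nhds_unique (hW (c • u)) (by
        simpa only [map_smul, RingHom.id_apply] using (hW u).const_smul c) } 1 (fun u => ?_), hW⟩
  rw [one_mul]
  refine le_of_tendsto (hW u).norm (Eventually.of_forall fun t => ?_)
  rw [LinearIsometryEquiv.norm_map, LinearIsometryEquiv.norm_map]

theorem isWaveOperator_waveOperator {l : Filter ℝ} (h : ∃ W, IsWaveOperator V l W) :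
    IsWaveOperator V l (waveOperator V l) := by
  rw [waveOperator, dif_pos h]
  exact h.choose_spec

theorem IsWaveOperator.inner_map_map {l : Filter ℝ} [l.NeBot] {W : L2 n →L[ℂ] L2 n}
    (hW : IsWaveOperator V l W) (u v : L2 n) : inner ℂ (W u) (W v) = inner ℂ u v := by
  refine tendsto_nhds_unique ((hW u).inner (hW v)) (tendsto_const_nhds.congr fun t => ?_)
  rw [LinearIsometryEquiv.inner_map_map, ← freeIso_apply, ← freeIso_apply,
    LinearIsometryEquiv.inner_map_map]

theorem IsWaveOperator.norm_map {l : Filter ℝ} [l.NeBot] {W : L2 n →L[ℂ] L2 n}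
    (hW : IsWaveOperator V l W) (u : L2 n) : ‖W u‖ = ‖u‖ := by
  refine tendsto_nhds_unique (hW u).norm (tendsto_const_nhds.congr fun t => ?_)
  rw [LinearIsometryEquiv.norm_map, ← freeIso_apply, LinearIsometryEquiv.norm_map]

/-- The intertwining property `W₊ e^{-itH₀} = e^{-itH} W₊`. -/
theorem IsWaveOperator.intertwining (hU : IsSchrodingerGroup V (schrodingerGroup V))
    {W : L2 n →L[ℂ] L2 n} (hW : IsWaveOperator V atTop W) (t : ℝ) (u : L2 n) :
    W (freeIso t u) = schrodingerGroup V t (W u) := by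
  refine tendsto_nhds_unique (hW (freeIso t u)) ?_
  have h1 := ((schrodingerGroup V t).continuous.tendsto _).comp
    ((hW u).comp (tendsto_atTop_add_const_right atTop t tendsto_id))
  refine h1.congr fun s => ?_
  simp only [Function.comp, id]
  rw [← hU.map_add, ← freeIso_apply, ← freeIso_apply, freeIso_add]
  congr 2
  ring

/-- `‖(W₊ - 1) e^{-itH₀} f‖ ≤ ∫ ‖V e^{-iτH₀} f‖ dτ`. -/
theorem IsWaveOperator.norm_map_sub_le {C : ℝ} (hV : IsBoundedSymbol (fun x => (V x : ℂ)) C)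
    {W : L2 n →L[ℂ] L2 n} (hW : IsWaveOperator V atTop W) {f : 𝓢(Rn n, ℂ)}
    (hf : Integrable fun t => ‖potL2 V (freeIso t (toL2 f))‖) (t : ℝ) :
    ‖W (freeIso t (toL2 f)) - freeIso t (toL2 f)‖ ≤
      ∫ τ, ‖potL2 V (freeIso τ (toL2 f))‖ := by
  have hU := isSchrodingerGroup_schrodingerGroup hV
  have hft : ∀ τ, freeIso τ (toL2 (freeS t f)) = freeIso (τ + t) (toL2 f) := fun τ => by
    rw [← freeIso_toL2, freeIso_add]
  have hf' : Integrable fun τ => ‖potL2 V (freeIso τ (toL2 (freeS t f)))‖ := by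
    simp only [hft]
    exact hf.comp_add_right t
  have h1 := integral_Ioi_of_hasDerivAt_of_tendsto' (a := 0)
    (fun τ _ => hU.hasDerivAt_interaction (freeS t f) τ)
    (hU.integrable_interaction hV hf').integrableOn (hW (toL2 (freeS t f)))
  rw [freeIso_toL2]
  rw [neg_zero, hU.zero, freeIso_zero] at h1
  rw [← h1]
  refine (norm_integral_le_integral_norm _).trans ?_
  simp only [LinearIsometryEquiv.norm_map, norm_smul, Complex.norm_I, one_mul]
  -- Enlarging the half-line to ℝ makes the bound invariant under translation in time, hence
  -- independent of t.
  refine (setIntegral_le_integral hf' (Eventually.of_forall fun τ => norm_nonneg _)).trans_eq ?_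
  simp only [hft]
  exact integral_add_right_eq_self (fun τ => ‖potL2 V (freeIso τ (toL2 f))‖) t

/-- The Born approximation of the scattering operator. -/
theorem norm_inner_scatteringOperator_sub_le {C : ℝ}
    (hV : IsBoundedSymbol (fun x => (V x : ℂ)) C)
    (hp : IsWaveOperator V atTop (waveOperator V atTop))
    (hm : IsWaveOperator V atBot (waveOperator V atBot)) {f g : 𝓢(Rn n, ℂ)}
    (hf : Integrable fun t => ‖potL2 V (freeIso t (toL2 f))‖)
    (hg : Integrable fun t => ‖potL2 V (freeIso t (toL2 g))‖) :
    ‖inner ℂ (toL2 g) (scatteringOperator V (toL2 f)) - inner ℂ (toL2 g) (toL2 f)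
      + Complex.I * ∫ t, inner ℂ (freeIso t (toL2 g)) (potL2 V (freeIso t (toL2 f)))‖ ≤
    (∫ t, ‖potL2 V (freeIso t (toL2 g))‖) * ∫ t, ‖potL2 V (freeIso t (toL2 f))‖ := by
  have hU := isSchrodingerGroup_schrodingerGroup hV
  set P := waveOperator V atTop with hP
  have h1 := integral_of_hasDerivAt_of_tendsto (fun τ => hU.hasDerivAt_interaction f τ)
    (hU.integrable_interaction hV hf) (hm (toL2 f)) (hp (toL2 f))
  -- S - 1 = W₊*(W₋ - W₊) because W₊*W₊ = 1; asymptotic completeness plays no role.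
  have h2 : inner ℂ (toL2 g) (scatteringOperator V (toL2 f)) - inner ℂ (toL2 g) (toL2 f)
      = -inner ℂ (P (toL2 g)) (P (toL2 f) - waveOperator V atBot (toL2 f)) := by
    rw [scatteringOperator, ContinuousLinearMap.comp_apply,
      ContinuousLinearMap.adjoint_inner_right, inner_sub_right, hp.inner_map_map]
    ring
  -- Intertwining moves the interacting group onto g as a free evolution. Replacing W₊e^{-itH₀}g by
  -- e^{-itH₀}g then costs ∫‖V e^{-iτH₀}g‖dτ uniformly in t, which makes the error a product of two
  -- integrals.
  have h3 : ∀ t, inner ℂ (P (toL2 g)) (schrodingerGroup V (-t)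
      (Complex.I • potL2 V (freeIso t (toL2 f))))
      = Complex.I * inner ℂ (P (freeIso t (toL2 g))) (potL2 V (freeIso t (toL2 f))) := fun t => by
    rw [hU.inner_neg_right, ← hp.intertwining hU, inner_smul_right]
  have hint : ∀ x : ℝ → L2 n, Continuous x → (∃ B, ∀ t, ‖x t‖ ≤ B) →
      Integrable fun t => inner ℂ (x t) (potL2 V (freeIso t (toL2 f))) := by
    rintro x hx ⟨B, hB⟩
    refine (hf.const_mul B).mono' (Continuous.aestronglyMeasurable
      (hx.inner (continuous_potL2_freeIso hV _))) (Eventually.of_forall fun t => ?_)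
    exact (norm_inner_le_norm _ _).trans (mul_le_mul_of_nonneg_right (hB t) (norm_nonneg _))
  have hc := continuous_freeIso (toL2 g)
  have hi1 := hint (fun t => P (freeIso t (toL2 g))) (P.continuous.comp hc)
    ⟨‖toL2 g‖, fun t => by rw [hp.norm_map, LinearIsometryEquiv.norm_map]⟩
  have hi2 := hint _ hc ⟨‖toL2 g‖, fun t => by rw [LinearIsometryEquiv.norm_map]⟩
  rw [h2, ← h1, ← integral_inner (hU.integrable_interaction hV hf)]
  simp only [h3]
  rw [integral_const_mul, ← mul_neg, ← mul_add, neg_add_eq_sub, ← integral_sub hi2 hi1, norm_mul,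
    Complex.norm_I, one_mul]
  rw [← integral_const_mul]
  refine norm_integral_le_of_norm_le (hf.const_mul _) (Eventually.of_forall fun t => ?_)
  rw [← inner_sub_left]
  refine (norm_inner_le_norm _ _).trans (mul_le_mul_of_nonneg_right ?_ (norm_nonneg _))
  rw [norm_sub_rev]
  exact hp.norm_map_sub_le hV hg t

end Wave

open scoped LineDeriv

/-! ### Position and derivative operators on Schwartz functions -/

/-- Multiplication by `⟨x, ω⟩` on Schwartz functions. -/
def posS (ω : Rn n) : 𝓢(Rn n, ℂ) →L[ℂ] 𝓢(Rn n, ℂ) :=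
  SchwartzMap.smulLeftCLM ℂ (fun x => ((inner ℝ x ω : ℝ) : ℂ))

/-- The derivative in direction `ω` on Schwartz functions. -/
def derS (ω : Rn n) : 𝓢(Rn n, ℂ) →L[ℂ] 𝓢(Rn n, ℂ) :=
  LineDeriv.lineDerivOpCLM ℂ 𝓢(Rn n, ℂ) ω

theorem hasTemperateGrowth_inner (ω : Rn n) : (fun x : Rn n => inner ℝ x ω).HasTemperateGrowth :=
  ((innerSL ℝ).flip ω).hasTemperateGrowth

theorem hasTemperateGrowth_inner_complex (ω : Rn n) :
    (fun x : Rn n => ((inner ℝ x ω : ℝ) : ℂ)).HasTemperateGrowth :=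
  Function.HasTemperateGrowth.comp (g := Complex.ofReal) (by fun_prop) (hasTemperateGrowth_inner ω)

theorem posS_apply (ω : Rn n) (f : 𝓢(Rn n, ℂ)) (x : Rn n) :
    posS ω f x = (inner ℝ x ω : ℝ) * f x := by
  rw [posS, SchwartzMap.smulLeftCLM_apply_apply (hasTemperateGrowth_inner_complex ω), smul_eq_mul]

theorem hasLineDerivAt_derS (ω : Rn n) (f : 𝓢(Rn n, ℂ)) (x : Rn n) :
    HasLineDerivAt ℝ f (derS ω f x) x ω := by
  have h : derS ω f x = lineDeriv ℝ f x ω := SchwartzMap.lineDerivOp_apply ω f x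
  rw [h]
  exact (f.differentiableAt.lineDifferentiableAt).hasLineDerivAt

theorem derS_apply_eq {ω : Rn n} {f : 𝓢(Rn n, ℂ)} {x : Rn n} {c : ℂ}
    (h : HasLineDerivAt ℝ f c x ω) : derS ω f x = c :=
  (hasLineDerivAt_derS ω f x).unique h

theorem hasDerivAt_inner_add_smul (x ω ω' : Rn n) :
    HasDerivAt (fun s : ℝ => inner ℝ (x + s • ω) ω') (inner ℝ ω ω') 0 := by
  simp only [inner_add_left, inner_smul_left]
  simpa using ((hasDerivAt_id (0 : ℝ)).mul_const (inner ℝ ω ω')).const_add (inner ℝ x ω')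

theorem derS_posS {ω : Rn n} (hω : ‖ω‖ = 1) (f : 𝓢(Rn n, ℂ)) :
    derS ω (posS ω f) = f + posS ω (derS ω f) := by
  ext x
  apply derS_apply_eq
  have h1 := (hasDerivAt_inner_add_smul x ω ω).ofReal_comp
  have h2 := h1.mul (hasLineDerivAt_derS ω f x)
  rw [real_inner_self_eq_norm_sq, hω] at h2
  rw [add_apply, posS_apply]
  simp only [HasLineDerivAt, posS_apply]
  convert! h2 using 1
  simp

theorem fourier_freeS (t : ℝ) (f : 𝓢(Rn n, ℂ)) (ξ : Rn n) :
    (𝓕 (freeS t f)) ξ = freeSymbol t ξ * (𝓕 f) ξ := by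
  rw [freeS, SchwartzMap.fourierMultiplierCLM_apply, FourierTransform.fourier_fourierInv_eq,
    SchwartzMap.smulLeftCLM_apply_apply (hasTemperateGrowth_freeSymbol t), smul_eq_mul]

theorem fourier_derS (ω : Rn n) (f : 𝓢(Rn n, ℂ)) (ξ : Rn n) :
    (𝓕 (derS ω f)) ξ = 2 * Real.pi * Complex.I * (inner ℝ ξ ω : ℝ) * (𝓕 f) ξ := by
  have h := SchwartzMap.fourier_lineDerivOp_eq f ω
  change (𝓕 (∂_{ω} f)) ξ = _
  rw [h, smul_apply, SchwartzMap.smulLeftCLM_apply_apply (hasTemperateGrowth_inner ω),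
    Complex.real_smul, smul_eq_mul]
  ring

theorem fourier_posS (ω : Rn n) (f : 𝓢(Rn n, ℂ)) (ξ : Rn n) :
    derS ω (𝓕 f) ξ = -(2 * Real.pi * Complex.I) * (𝓕 (posS ω f)) ξ := by
  have h := SchwartzMap.lineDerivOp_fourier_eq f ω
  change (∂_{ω} (𝓕 f)) ξ = _
  have h2 : posS ω f = SchwartzMap.smulLeftCLM ℂ (fun x => inner ℝ x ω) f :=
    SchwartzMap.smulLeftCLM_ofReal ℂ (hasTemperateGrowth_inner ω) f
  rw [h, FourierTransform.fourier_smul, smul_apply, h2, smul_eq_mul]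

theorem hasLineDerivAt_freeSymbol (t : ℝ) (ξ ω : Rn n) :
    HasLineDerivAt ℝ (freeSymbol t)
      (-(4 * Real.pi ^ 2 * t * (inner ℝ ξ ω : ℝ)) * Complex.I * freeSymbol t ξ) ξ ω := by
  have h1 : HasDerivAt (fun s : ℝ => -(t * kineticSymbol (ξ + s • ω)))
      (-(t * (2 * Real.pi ^ 2 * (2 * inner ℝ ξ ω)))) 0 := by
    have h2 : HasDerivAt (fun s : ℝ => ‖ξ + s • ω‖ ^ 2) (2 * inner ℝ ξ ω) 0 := by
      have h3 : HasDerivAt (fun s : ℝ => ξ + s • ω) ω 0 := by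
        simpa using ((hasDerivAt_id (0 : ℝ)).smul_const ω).const_add ξ
      simpa using h3.norm_sq
    exact ((h2.const_mul _).const_mul t).neg
  have h2 := (h1.ofReal_comp.mul_const Complex.I).cexp
  have h3 : (fun s : ℝ => freeSymbol t (ξ + s • ω)) = fun s : ℝ =>
      Complex.exp (((-(t * kineticSymbol (ξ + s • ω)) : ℝ) : ℂ) * Complex.I) :=
    funext fun s => freeSymbol_eq _ _
  change HasDerivAt (fun s : ℝ => freeSymbol t (ξ + s • ω)) _ 0
  rw [h3]
  convert h2 using 1
  simp only [zero_smul, add_zero, freeSymbol_eq]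
  push_cast
  ring

/-- The Heisenberg evolution of the position operator:
`⟨x, ω⟩ e^{-itH₀} = e^{-itH₀} (⟨x, ω⟩ - it ∂_ω)`. -/
theorem posS_freeS (ω : Rn n) (t : ℝ) (f : 𝓢(Rn n, ℂ)) :
    posS ω (freeS t f) = freeS t (posS ω f - (Complex.I * t) • derS ω f) := by
  apply (FourierTransform.fourierEquiv ℂ 𝓢(Rn n, ℂ)).injective
  change 𝓕 (posS ω (freeS t f)) = 𝓕 (freeS t (posS ω f - (Complex.I * t) • derS ω f))
  ext ξ
  have hpi : (2 * Real.pi * Complex.I : ℂ) ≠ 0 := by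
    simp [Real.pi_ne_zero]
  have h1 := fourier_posS ω (freeS t f) ξ
  -- On the Fourier side the position operator is (i/2π) times the derivative along ω;
  -- differentiating the symbol produces the term with t∂_ω.
  have h2 : derS ω (𝓕 (freeS t f)) ξ =
      (-(4 * Real.pi ^ 2 * t * (inner ℝ ξ ω : ℝ)) * Complex.I * freeSymbol t ξ) * (𝓕 f) ξ
        + freeSymbol t ξ * (-(2 * Real.pi * Complex.I) * (𝓕 (posS ω f)) ξ) := by
    apply derS_apply_eq
    have h3 := HasDerivAt.mul (hasLineDerivAt_freeSymbol t ξ ω) (hasLineDerivAt_derS ω (𝓕 f) ξ)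
    rw [fourier_posS] at h3
    simp only [HasLineDerivAt, fourier_freeS]
    convert! h3 using 1
    simp
  rw [h2] at h1
  rw [fourier_freeS, sub_eq_add_neg, ← neg_smul, FourierTransform.fourier_add,
    FourierTransform.fourier_smul, add_apply, smul_apply, fourier_derS, smul_eq_mul]
  refine mul_left_cancel₀ (neg_ne_zero.2 hpi) ?_
  rw [← h1]
  linear_combination (-(4 * Real.pi ^ 2 * t * (inner ℝ ξ ω : ℝ)) * Complex.I * freeSymbol t ξ *
    (𝓕 f) ξ) * Complex.I_sq

/-- The Heisenberg relation solved for t∂_ω. The right-hand side contains at most one position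
factor outside the evolution, which a decaying weight absorbs, so one derivative buys one power of
1/t. -/
theorem smul_freeS_derS (ω : Rn n) (t : ℝ) (f : 𝓢(Rn n, ℂ)) :
    (t : ℂ) • freeS t (derS ω f) =
      Complex.I • (posS ω (freeS t f) - freeS t (posS ω f)) := by
  rw [posS_freeS, map_sub, map_smul, sub_sub_cancel_left, smul_neg, smul_smul, ← neg_smul,
    ← mul_assoc, Complex.I_mul_I]
  congr 1
  ring

/-- Two applications of the relation. Since ∂_ω and ⟨x,ω⟩ have commutator 1, a term it·e^{-itH₀}f
survives; a third derivative, hidden in f, is what later removes its growth. -/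
theorem smul_freeS_derS_derS {ω : Rn n} (hω : ‖ω‖ = 1) (t : ℝ) (f : 𝓢(Rn n, ℂ)) :
    ((t : ℂ) ^ 2) • freeS t (derS ω (derS ω f)) =
      (2 : ℂ) • posS ω (freeS t (posS ω f)) - posS ω (posS ω (freeS t f))
        - freeS t (posS ω (posS ω f)) + (Complex.I * t) • freeS t f := by
  have h1 : posS ω (derS ω f) = derS ω (posS ω f) - f := by
    rw [derS_posS hω, add_sub_cancel_left]
  have h2 := smul_freeS_derS ω t (derS ω f)
  have h3 := smul_freeS_derS ω t f
  have h4 := smul_freeS_derS ω t (posS ω f)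
  calc ((t : ℂ) ^ 2) • freeS t (derS ω (derS ω f))
      = (t : ℂ) • ((t : ℂ) • freeS t (derS ω (derS ω f))) := by rw [smul_smul, sq]
    _ = Complex.I • (posS ω ((t : ℂ) • freeS t (derS ω f))
          - (t : ℂ) • freeS t (derS ω (posS ω f)) + (t : ℂ) • freeS t f) := by
        rw [h2, h1, map_sub, map_smul, smul_comm]
        congr 1
        rw [smul_sub, smul_sub]
        abel
    _ = _ := by
        rw [h3, h4, map_smul, map_sub, ← smul_sub, smul_add, smul_smul, smul_smul,
          Complex.I_mul_I, two_smul]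
        module

/-! ### Weights and short-range potentials -/

theorem bracket_sq (x : Rn n) : bracket x ^ 2 = 1 + ‖x‖ ^ 2 :=
  Real.sq_sqrt (by positivity)

theorem one_le_bracket (x : Rn n) : 1 ≤ bracket x :=
  Real.one_le_sqrt.2 (by nlinarith [sq_nonneg ‖x‖])

theorem bracket_pos (x : Rn n) : 0 < bracket x := zero_lt_one.trans_le (one_le_bracket x)

theorem norm_le_bracket (x : Rn n) : ‖x‖ ≤ bracket x :=
  Real.le_sqrt_of_sq_le (by linarith)

theorem continuous_bracket : Continuous (bracket : Rn n → ℝ) := by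
  unfold bracket
  fun_prop

theorem shortRangeWith_mono {δ δ' K K' : ℝ} (hδ : δ' ≤ δ) (hK : 0 ≤ K) (hKK : K ≤ K') :
    shortRangeWith n δ K ⊆ shortRangeWith n δ' K' := by
  rintro V ⟨hV, h⟩
  refine ⟨hV, fun x => (h x).trans ?_⟩
  exact mul_le_mul hKK (Real.rpow_le_rpow_of_exponent_le (one_le_bracket x) (neg_le_neg hδ))
    (Real.rpow_nonneg (bracket_pos x).le _) (hK.trans hKK)

theorem nonneg_of_mem_shortRangeWith {δ K : ℝ} {V : Rn n → ℝ} (hV : V ∈ shortRangeWith n δ K) :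
    0 ≤ K := by
  have h := (abs_nonneg _).trans (hV.2 0)
  exact nonneg_of_mul_nonneg_left h (Real.rpow_pos_of_pos (bracket_pos 0) _)

theorem isBoundedSymbol_of_mem {δ K : ℝ} (hδ : 0 ≤ δ) {V : Rn n → ℝ}
    (hV : V ∈ shortRangeWith n δ K) : IsBoundedSymbol (fun x => (V x : ℂ)) K := by
  refine ⟨(Complex.continuous_ofReal.comp hV.1.continuous).aestronglyMeasurable, fun x => ?_⟩
  rw [Complex.norm_real, Real.norm_eq_abs]
  refine (hV.2 x).trans (mul_le_of_le_one_right (nonneg_of_mem_shortRangeWith hV) ?_)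
  exact Real.rpow_le_one_of_one_le_of_nonpos (one_le_bracket x) (neg_nonpos.2 hδ)

/-- The weight `⟨x⟩⁻²`. -/
def weightTwo (x : Rn n) : ℝ := (1 + ‖x‖ ^ 2)⁻¹

theorem weightTwo_nonneg (x : Rn n) : 0 ≤ weightTwo x := by
  unfold weightTwo
  positivity

theorem isBoundedSymbol_weightTwo : IsBoundedSymbol (fun x : Rn n => (weightTwo x : ℂ)) 1 := by
  refine ⟨?_, fun x => ?_⟩
  · refine Continuous.aestronglyMeasurable (Complex.continuous_ofReal.comp ?_)
    unfold weightTwo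
    exact Continuous.inv₀ (by fun_prop) fun x => by positivity
  · rw [Complex.norm_real, Real.norm_of_nonneg (weightTwo_nonneg x)]
    exact inv_le_one_of_one_le₀ (by nlinarith [sq_nonneg ‖x‖])

/-- The first term covers ⟨x⟩ ≥ l, the second ⟨x⟩ ≤ l. Here δ ≤ 2 is essential. -/
theorem bracket_rpow_neg_le {δ l : ℝ} (hδ0 : 0 ≤ δ) (hδ2 : δ ≤ 2) (hl : 0 < l) (x : Rn n) :
    bracket x ^ (-δ) ≤ l ^ (-δ) + l ^ (2 - δ) * weightTwo x := by
  have hw : weightTwo x = bracket x ^ (-2 : ℝ) := by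
    rw [weightTwo, ← bracket_sq, Real.rpow_neg (bracket_pos x).le, Real.rpow_two]
  rcases le_total l (bracket x) with h | h
  · refine le_add_of_le_of_nonneg (Real.rpow_le_rpow_of_nonpos hl h (neg_nonpos.2 hδ0)) ?_
    exact mul_nonneg (Real.rpow_nonneg hl.le _) (weightTwo_nonneg x)
  · refine le_add_of_nonneg_of_le (Real.rpow_nonneg hl.le _) ?_
    rw [hw]
    calc bracket x ^ (-δ) = bracket x ^ (2 - δ) * bracket x ^ (-2 : ℝ) := by
          rw [← Real.rpow_add (bracket_pos x)]
          ring_nf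
      _ ≤ _ := mul_le_mul_of_nonneg_right (Real.rpow_le_rpow (bracket_pos x).le h (by linarith))
          (Real.rpow_nonneg (bracket_pos x).le _)

theorem norm_potL2_le_interpolate {δ K l : ℝ} (hδ0 : 0 ≤ δ) (hδ2 : δ ≤ 2) (hl : 0 < l)
    {V : Rn n → ℝ} (hV : V ∈ shortRangeWith n δ K) (u : L2 n) :
    ‖potL2 V u‖ ≤ K * (l ^ (-δ) * ‖u‖ + l ^ (2 - δ) * ‖potL2 weightTwo u‖) := by
  have hK := nonneg_of_mem_shortRangeWith hV
  have ha : 0 ≤ l ^ (-δ) := Real.rpow_nonneg hl.le _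
  have hb : 0 ≤ l ^ (2 - δ) := Real.rpow_nonneg hl.le _
  have h1 : ‖potL2 V u‖ ≤ K * ‖((l ^ (-δ) : ℝ) : ℂ) • u + ((l ^ (2 - δ) : ℝ) : ℂ) •
      potL2 weightTwo u‖ := by
    refine Lp.norm_le_mul_norm_of_ae_le_mul ?_
    filter_upwards [(isBoundedSymbol_of_mem hδ0 hV).coeFn_mulL2 u,
      isBoundedSymbol_weightTwo.coeFn_mulL2 u,
      Lp.coeFn_add (((l ^ (-δ) : ℝ) : ℂ) • u) (((l ^ (2 - δ) : ℝ) : ℂ) • potL2 weightTwo u),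
      Lp.coeFn_smul ((l ^ (-δ) : ℝ) : ℂ) u,
      Lp.coeFn_smul ((l ^ (2 - δ) : ℝ) : ℂ) (potL2 weightTwo u)] with x h1 h2 h3 h4 h5
    rw [h1, h3, Pi.add_apply, h4, h5, Pi.smul_apply, Pi.smul_apply, h2, smul_eq_mul, smul_eq_mul,
      ← mul_assoc, ← add_mul, norm_mul, norm_mul, ← mul_assoc]
    refine mul_le_mul_of_nonneg_right ?_ (norm_nonneg _)
    rw [← Complex.ofReal_mul, ← Complex.ofReal_add, Complex.norm_real, Complex.norm_real,
      Real.norm_eq_abs, Real.norm_of_nonneg (add_nonneg ha (mul_nonneg hb (weightTwo_nonneg x)))]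
    exact (hV.2 x).trans (mul_le_mul_of_nonneg_left (bracket_rpow_neg_le hδ0 hδ2 hl x) hK)
  refine h1.trans (mul_le_mul_of_nonneg_left ((norm_add_le _ _).trans_eq ?_) hK)
  rw [norm_smul, norm_smul, Complex.norm_real, Complex.norm_real, Real.norm_of_nonneg ha,
    Real.norm_of_nonneg hb]

/-- Turns l⁻² decay in the weight ⟨x⟩⁻² into l^{-δ} decay for V, by cutting the potential at ⟨x⟩ =
l; for l ≤ 1 boundedness of V is enough. The parameter l will be |t| or v|t|. The 8 combines two
terms with a^δ ≤ 4 for 1 ≤ a ≤ 2. -/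
theorem norm_potL2_le_of_decay {δ K A l : ℝ} (hδ0 : 0 ≤ δ) (hδ2 : δ ≤ 2) (hl : 0 ≤ l)
    {V : Rn n → ℝ} (hV : V ∈ shortRangeWith n δ K) {u : L2 n} (h1 : ‖u‖ ≤ A)
    (h2 : l ^ 2 * ‖potL2 weightTwo u‖ ≤ A) :
    ‖potL2 V u‖ ≤ 8 * K * A * (1 + l) ^ (-δ) := by
  have hK := nonneg_of_mem_shortRangeWith hV
  have hA : 0 ≤ A := (norm_nonneg _).trans h1
  have h4 : ∀ a : ℝ, 1 ≤ a → a ≤ 2 → a ^ δ ≤ 4 := fun a ha ha2 => by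
    calc a ^ δ ≤ a ^ (2 : ℝ) := Real.rpow_le_rpow_of_exponent_le ha hδ2
      _ ≤ 4 := by rw [Real.rpow_two]; nlinarith
  rcases le_or_gt l 1 with h | h
  · have h5 : 1 ≤ 4 * (1 + l) ^ (-δ) := by
      rw [Real.rpow_neg (by positivity), ← div_eq_mul_inv, le_div_iff₀ (by positivity), one_mul]
      exact h4 _ (by linarith) (by linarith)
    calc ‖potL2 V u‖ ≤ K * ‖u‖ := (isBoundedSymbol_of_mem hδ0 hV).norm_mulL2_le u
      _ ≤ K * A := mul_le_mul_of_nonneg_left h1 hK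
      _ ≤ K * A * (2 * (4 * (1 + l) ^ (-δ))) :=
        le_mul_of_one_le_right (mul_nonneg hK hA) (by linarith)
      _ = _ := by ring
  · have hl0 : 0 < l := by linarith
    have h5 : l ^ (-δ) ≤ 4 * (1 + l) ^ (-δ) := by
      rw [Real.rpow_neg hl0.le, Real.rpow_neg (by positivity), ← div_eq_mul_inv,
        le_div_iff₀ (by positivity), inv_mul_le_iff₀ (by positivity), mul_comm]
      have h6 : (1 + l) ^ δ = ((1 + l) / l) ^ δ * l ^ δ := by
        rw [← Real.mul_rpow (by positivity) hl0.le, div_mul_cancel₀ _ hl0.ne']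
      rw [h6]
      refine mul_le_mul_of_nonneg_right (h4 _ ?_ ?_) (by positivity)
      · rw [le_div_iff₀ hl0]; linarith
      · rw [div_le_iff₀ hl0]; linarith
    have h7 : l ^ (2 - δ) * ‖potL2 weightTwo u‖ ≤ l ^ (-δ) * A := by
      have : l ^ (2 - δ) = l ^ (-δ) * l ^ 2 := by
        rw [← Real.rpow_two, ← Real.rpow_add hl0]
        ring_nf
      rw [this, mul_assoc]
      exact mul_le_mul_of_nonneg_left h2 (by positivity)
    calc ‖potL2 V u‖ ≤ K * (l ^ (-δ) * ‖u‖ + l ^ (2 - δ) * ‖potL2 weightTwo u‖) :=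
          norm_potL2_le_interpolate hδ0 hδ2 hl0 hV u
      _ ≤ K * (l ^ (-δ) * A + l ^ (-δ) * A) := by
          refine mul_le_mul_of_nonneg_left (add_le_add ?_ h7) hK
          exact mul_le_mul_of_nonneg_left h1 (by positivity)
      _ = 2 * K * A * l ^ (-δ) := by ring
      _ ≤ 2 * K * A * (4 * (1 + l) ^ (-δ)) :=
          mul_le_mul_of_nonneg_left h5 (by positivity)
      _ = _ := by ring

/-! ### Decay of the free evolution in the weighted space -/

theorem norm_potL2_weightTwo_le {f g : 𝓢(Rn n, ℂ)}
    (h : ∀ x, weightTwo x * ‖f x‖ ≤ ‖g x‖) : ‖potL2 weightTwo (toL2 f)‖ ≤ ‖toL2 g‖ := by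
  rw [← one_mul ‖toL2 g‖]
  refine Lp.norm_le_mul_norm_of_ae_le_mul ?_
  filter_upwards [isBoundedSymbol_weightTwo.coeFn_mulL2 (toL2 f), coeFn_toL2 f, coeFn_toL2 g]
    with x h1 h2 h3
  rw [h1, h2, h3, one_mul, norm_mul, Complex.norm_real, Real.norm_of_nonneg (weightTwo_nonneg x)]
  exact h x

theorem weightTwo_mul_le (x : Rn n) {a : ℝ} (ha : a ≤ 1 + ‖x‖ ^ 2) {b : ℝ} (hb : 0 ≤ b) :
    weightTwo x * (a * b) ≤ b := by
  rw [weightTwo, inv_mul_le_iff₀ (by positivity)]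
  exact mul_le_mul_of_nonneg_right ha hb

theorem abs_inner_le {ω : Rn n} (hω : ‖ω‖ = 1) (x : Rn n) : |inner ℝ x ω| ≤ ‖x‖ := by
  simpa [hω] using abs_real_inner_le_norm x ω

theorem norm_potL2_weightTwo_self_le (f : 𝓢(Rn n, ℂ)) :
    ‖potL2 weightTwo (toL2 f)‖ ≤ ‖toL2 f‖ :=
  norm_potL2_weightTwo_le fun x => by
    simpa using weightTwo_mul_le x (a := 1) (by nlinarith [sq_nonneg ‖x‖]) (norm_nonneg (f x))

theorem norm_potL2_weightTwo_posS_le {ω : Rn n} (hω : ‖ω‖ = 1) (f : 𝓢(Rn n, ℂ)) :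
    ‖potL2 weightTwo (toL2 (posS ω f))‖ ≤ ‖toL2 f‖ :=
  norm_potL2_weightTwo_le fun x => by
    rw [posS_apply, norm_mul, Complex.norm_real, Real.norm_eq_abs]
    refine weightTwo_mul_le x ((abs_inner_le hω x).trans ?_) (norm_nonneg (f x))
    nlinarith [sq_nonneg (‖x‖ - 1)]

theorem norm_potL2_weightTwo_posS_posS_le {ω : Rn n} (hω : ‖ω‖ = 1) (f : 𝓢(Rn n, ℂ)) :
    ‖potL2 weightTwo (toL2 (posS ω (posS ω f)))‖ ≤ ‖toL2 f‖ :=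
  norm_potL2_weightTwo_le fun x => by
    rw [posS_apply, posS_apply, ← mul_assoc, norm_mul, ← Complex.ofReal_mul, Complex.norm_real,
      Real.norm_eq_abs, abs_mul, ← sq]
    refine weightTwo_mul_le x ?_ (norm_nonneg (f x))
    have := pow_le_pow_left₀ (abs_nonneg _) (abs_inner_le hω x) 2
    linarith

theorem norm_toL2_freeS (t : ℝ) (f : 𝓢(Rn n, ℂ)) : ‖toL2 (freeS t f)‖ = ‖toL2 f‖ := by
  rw [← freeIso_toL2, LinearIsometryEquiv.norm_map]

/-- `potL2 weightTwo ∘ toL2` as a linear map. -/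
def wtS : 𝓢(Rn n, ℂ) →ₗ[ℂ] L2 n := (mulOp isBoundedSymbol_weightTwo).toLinearMap ∘ₗ toL2.toLinearMap

theorem wtS_apply (f : 𝓢(Rn n, ℂ)) : wtS f = potL2 weightTwo (toL2 f) := rfl

theorem abs_mul_norm_wtS_freeS_derS_le {ω : Rn n} (hω : ‖ω‖ = 1) (t : ℝ) (f : 𝓢(Rn n, ℂ)) :
    |t| * ‖wtS (freeS t (derS ω f))‖ ≤ ‖toL2 f‖ + ‖toL2 (posS ω f)‖ := by
  have h := congrArg (fun g => ‖wtS g‖) (smul_freeS_derS ω t f)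
  simp only [map_smul, norm_smul, Complex.norm_real, Real.norm_eq_abs, Complex.norm_I, one_mul,
    map_sub] at h
  rw [h]
  refine (norm_sub_le _ _).trans (add_le_add ?_ ?_)
  · exact (norm_potL2_weightTwo_posS_le hω _).trans_eq (norm_toL2_freeS t f)
  · exact (norm_potL2_weightTwo_self_le _).trans_eq (norm_toL2_freeS t _)

/-- The norm controlling the weighted decay of `e^{-itH₀} ∂_ω³ g`. -/
def decayNorm (ω : Rn n) (g : 𝓢(Rn n, ℂ)) : ℝ :=
  ‖toL2 (derS ω g)‖ + 2 * ‖toL2 (posS ω (derS ω g))‖ + ‖toL2 (posS ω (posS ω (derS ω g)))‖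
    + (‖toL2 g‖ + ‖toL2 (posS ω g)‖)

/-- Two derivatives pay for t², and the third pays for the leftover commutator term, to which the
first-order estimate applies. -/
theorem sq_mul_norm_wtS_freeS_le {ω : Rn n} (hω : ‖ω‖ = 1) (t : ℝ) (g : 𝓢(Rn n, ℂ)) :
    t ^ 2 * ‖wtS (freeS t (derS ω (derS ω (derS ω g))))‖ ≤ decayNorm ω g := by
  set f := derS ω g with hf
  have h := congrArg (fun g => ‖wtS g‖) (smul_freeS_derS_derS hω t f)
  simp only [map_smul, norm_smul, norm_pow, Complex.norm_real, Real.norm_eq_abs, sq_abs,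
    map_sub, map_add] at h
  rw [h, decayNorm]
  have h1 : ‖(2 : ℂ) • wtS (posS ω (freeS t (posS ω f)))‖ ≤ 2 * ‖toL2 (posS ω f)‖ := by
    rw [norm_smul, Complex.norm_ofNat]
    exact mul_le_mul_of_nonneg_left ((norm_potL2_weightTwo_posS_le hω _).trans_eq
      (norm_toL2_freeS t _)) zero_le_two
  have h2 : ‖wtS (posS ω (posS ω (freeS t f)))‖ ≤ ‖toL2 f‖ :=
    (norm_potL2_weightTwo_posS_posS_le hω _).trans_eq (norm_toL2_freeS t f)
  have h3 : ‖wtS (freeS t (posS ω (posS ω f)))‖ ≤ ‖toL2 (posS ω (posS ω f))‖ :=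
    (norm_potL2_weightTwo_self_le _).trans_eq (norm_toL2_freeS t _)
  have h4 : ‖(Complex.I * (t : ℂ)) • wtS (freeS t f)‖ ≤ ‖toL2 g‖ + ‖toL2 (posS ω g)‖ := by
    rw [norm_smul, norm_mul, Complex.norm_I, one_mul, Complex.norm_real, Real.norm_eq_abs]
    exact abs_mul_norm_wtS_freeS_derS_le hω t g
  refine (norm_add_le _ _).trans (add_le_add ?_ h4)
  refine (norm_sub_le _ _).trans (add_le_add ?_ h3)
  refine (norm_sub_le _ _).trans ?_
  linarith

theorem integrable_one_add_mul_abs_rpow {δ v : ℝ} (hδ : 1 < δ) (hv : 0 < v) :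
    Integrable fun t : ℝ => (1 + v * |t|) ^ (-δ) := by
  have h : Integrable fun t : ℝ => (1 + ‖t‖) ^ (-δ) := integrable_one_add_norm (by simpa using hδ)
  refine (h.comp_mul_left' hv.ne').congr (Eventually.of_forall fun t => ?_)
  simp [abs_of_pos hv]

theorem integrable_potL2_derS {δ K : ℝ} (hδ1 : 1 < δ) (hδ2 : δ ≤ 2) {V : Rn n → ℝ}
    (hV : V ∈ shortRangeWith n δ K) {ω : Rn n} (hω : ‖ω‖ = 1) (g : 𝓢(Rn n, ℂ)) :
    Integrable fun t => ‖potL2 V (freeIso t (toL2 (derS ω (derS ω (derS ω g)))))‖ := by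
  set f := derS ω (derS ω (derS ω g)) with hf
  set A := ‖toL2 f‖ + decayNorm ω g with hA
  have hd : 0 ≤ decayNorm ω g := by unfold decayNorm; positivity
  refine ((integrable_one_add_mul_abs_rpow hδ1 one_pos).const_mul (8 * K * A)).mono'
    ?_ (Eventually.of_forall fun t => ?_)
  · exact (continuous_potL2_freeIso
      (isBoundedSymbol_of_mem (by linarith) hV) _).norm.aestronglyMeasurable
  · rw [norm_norm]
    refine norm_potL2_le_of_decay (by linarith) hδ2 (by positivity) hV ?_ ?_
    · rw [LinearIsometryEquiv.norm_map]
      exact le_add_of_nonneg_right hd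
    · rw [one_mul, sq_abs, freeIso_toL2]
      exact (sq_mul_norm_wtS_freeS_le hω t g).trans (le_add_of_nonneg_left (norm_nonneg _))

/-! ### Existence of the wave operators -/

theorem ae_inner_ne_zero {ω : Rn n} (hω : ‖ω‖ = 1) :
    ∀ᵐ ξ : Rn n, inner ℝ ξ ω ≠ 0 := by
  have h := Measure.addHaar_submodule (volume : Measure (Rn n)) (LinearMap.ker (innerₗ (Rn n) ω))
    (fun htop => by
      have : ω ∈ LinearMap.ker (innerₗ (Rn n) ω) := by rw [htop]; trivial
      rw [LinearMap.mem_ker, innerₗ_apply_apply, real_inner_self_eq_norm_sq, hω] at this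
      norm_num at this)
  rw [ae_iff]
  refine measure_mono_null (fun ξ hξ => ?_) h
  rw [SetLike.mem_coe, LinearMap.mem_ker, innerₗ_apply_apply, real_inner_comm]
  exact not_not.1 hξ

/-- A vector u orthogonal to the range satisfies ⟨ξ,ω⟩³û(ξ) = 0 almost everywhere, and the
hyperplane ⟨ξ,ω⟩ = 0 is a null set. -/
theorem dense_derS {ω : Rn n} (hω : ‖ω‖ = 1) :
    DenseRange fun g : 𝓢(Rn n, ℂ) => toL2 (derS ω (derS ω (derS ω g))) := by
  let T : 𝓢(Rn n, ℂ) →ₗ[ℂ] L2 n :=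
    (toL2 ∘L derS ω ∘L derS ω ∘L derS ω : 𝓢(Rn n, ℂ) →L[ℂ] L2 n).toLinearMap
  have hT : ∀ g, T g = toL2 (derS ω (derS ω (derS ω g))) := fun g => rfl
  suffices h : (LinearMap.range T)ᗮ = ⊥ by
    rw [← Submodule.topologicalClosure_eq_top_iff, ← Submodule.dense_iff_topologicalClosure_eq_top]
      at h
    exact h
  rw [Submodule.eq_bot_iff]
  intro u hu
  set w : L2 n := 𝓕 u with hw
  have hloc : LocallyIntegrable (fun ξ : Rn n => ((inner ℝ ξ ω : ℝ) : ℂ) ^ 3 * w ξ) := by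
    have h1 : LocallyIntegrable (w : Rn n → ℂ) := (Lp.memLp w).locallyIntegrable (by norm_num)
    rw [← locallyIntegrableOn_univ] at h1 ⊢
    exact h1.continuousOn_mul (by fun_prop) isOpen_univ.isLocallyClosed
  have hzero : ∀ᵐ ξ : Rn n, ((inner ℝ ξ ω : ℝ) : ℂ) ^ 3 * w ξ = 0 := by
    refine ae_eq_zero_of_integral_contDiff_smul_eq_zero hloc fun φ hφ hφc => ?_
    have hg₁ : HasCompactSupport (Complex.ofRealCLM ∘ φ) := hφc.comp_left rfl
    have hg₂ : ContDiff ℝ (⊤ : ℕ∞) (Complex.ofRealCLM ∘ φ) := Complex.ofRealCLM.contDiff.comp hφ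
    set F : 𝓢(Rn n, ℂ) := hg₁.toSchwartzMap hg₂ with hF
    have hFx : ∀ x, F x = φ x := fun x => rfl
    have h1 := (Submodule.mem_orthogonal _ u).1 hu (T (𝓕⁻ F)) ⟨_, rfl⟩
    rw [← Lp.inner_fourier_eq, hT, fourier_toL2, L2.inner_def] at h1
    have h2 : ∀ᵐ ξ : Rn n, inner ℂ ((toL2 (𝓕 (derS ω (derS ω (derS ω (𝓕⁻ F)))))) ξ)
        ((𝓕 u : L2 n) ξ) = (starRingEnd ℂ) ((2 * Real.pi * Complex.I) ^ 3) *
          (φ ξ • (((inner ℝ ξ ω : ℝ) : ℂ) ^ 3 * w ξ)) := by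
      filter_upwards [coeFn_toL2 (𝓕 (derS ω (derS ω (derS ω (𝓕⁻ F)))))] with ξ hξ
      rw [hξ, fourier_derS, fourier_derS, fourier_derS, FourierTransform.fourier_fourierInv_eq,
        hFx, RCLike.inner_apply, Complex.real_smul]
      simp only [map_mul, map_pow, Complex.conj_ofReal, map_ofNat]
      ring
    rw [integral_congr_ae h2, integral_const_mul] at h1
    refine (mul_eq_zero.1 h1).resolve_left ?_
    simp [Real.pi_ne_zero]
  have hw0 : w = 0 := by
    ext1
    filter_upwards [hzero, ae_inner_ne_zero hω, Lp.coeFn_zero ℂ 2 (volume : Measure (Rn n))]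
      with ξ h1 h2 h3
    rw [h3]
    refine (mul_eq_zero.1 h1).resolve_left ?_
    exact pow_ne_zero _ (Complex.ofReal_ne_zero.2 h2)
  rw [← norm_eq_zero, ← Lp.norm_fourier_eq, ← hw, hw0, norm_zero]

theorem isWaveOperator_of_mem (hn : 0 < n) {δ K : ℝ} (hδ1 : 1 < δ) (hδ2 : δ ≤ 2) {V : Rn n → ℝ}
    (hV : V ∈ shortRangeWith n δ K) {l : Filter ℝ} (hl : l = atTop ∨ l = atBot) :
    IsWaveOperator V l (waveOperator V l) := by
  have : Nontrivial (Rn n) := by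
    have : Nonempty (Fin n) := ⟨⟨0, hn⟩⟩
    infer_instance
  obtain ⟨ω, hω⟩ := exists_norm_eq (Rn n) zero_le_one
  exact isWaveOperator_waveOperator (exists_isWaveOperator
    (isBoundedSymbol_of_mem (by linarith) hV) (dense_derS hω)
    (fun g => integrable_potL2_derS hδ1 hδ2 hV hω g) hl)

/-! ### Modulations, translations and dilations of Schwartz functions -/

/-- Multiplication by `e^{i⟨x, p⟩}` on Schwartz functions. -/
def modS (p : Rn n) : 𝓢(Rn n, ℂ) →L[ℂ] 𝓢(Rn n, ℂ) :=
  SchwartzMap.smulLeftCLM ℂ (fun x => Complex.exp (((inner ℝ x p : ℝ) : ℂ) * Complex.I))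

/-- Translation `f ↦ f(· - y)` on Schwartz functions. -/
def transS (y : Rn n) : 𝓢(Rn n, ℂ) →L[ℂ] 𝓢(Rn n, ℂ) := SchwartzMap.compSubConstCLM ℂ y

theorem modS_apply (p : Rn n) (f : 𝓢(Rn n, ℂ)) (x : Rn n) :
    modS p f x = Complex.exp (((inner ℝ x p : ℝ) : ℂ) * Complex.I) * f x := by
  rw [modS, SchwartzMap.smulLeftCLM_apply_apply
    (hasTemperateGrowth_exp_ofReal_mul_I (hasTemperateGrowth_inner p)), smul_eq_mul]

theorem transS_apply (y : Rn n) (f : 𝓢(Rn n, ℂ)) (x : Rn n) : transS y f x = f (x - y) :=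
  SchwartzMap.compSubConstCLM_apply f y x

theorem norm_toL2_eq_of_norm_eq {f g : 𝓢(Rn n, ℂ)} (h : ∀ x, ‖f x‖ = ‖g x‖) :
    ‖toL2 f‖ = ‖toL2 g‖ := by
  rw [Lp.norm_def, Lp.norm_def, eLpNorm_congr_ae (coeFn_toL2 f), eLpNorm_congr_ae (coeFn_toL2 g),
    eLpNorm_congr_norm_ae (Eventually.of_forall h)]

theorem norm_toL2_modS (p : Rn n) (f : 𝓢(Rn n, ℂ)) : ‖toL2 (modS p f)‖ = ‖toL2 f‖ :=
  norm_toL2_eq_of_norm_eq fun x => by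
    rw [modS_apply, norm_mul, Complex.norm_exp_ofReal_mul_I, one_mul]

theorem norm_toL2_transS (y : Rn n) (f : 𝓢(Rn n, ℂ)) : ‖toL2 (transS y f)‖ = ‖toL2 f‖ := by
  rw [Lp.norm_def, Lp.norm_def, eLpNorm_congr_ae (coeFn_toL2 f),
    eLpNorm_congr_ae (coeFn_toL2 (transS y f))]
  congr 1
  have h : (transS y f : Rn n → ℂ) = f ∘ fun x => x - y := funext fun x => transS_apply y f x
  rw [h]
  exact eLpNorm_comp_measurePreserving f.continuous.aestronglyMeasurable
    (measurePreserving_sub_right volume y)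

theorem posS_modS (ω p : Rn n) (f : 𝓢(Rn n, ℂ)) : posS ω (modS p f) = modS p (posS ω f) := by
  ext x
  simp only [posS_apply, modS_apply]
  ring

theorem derS_modS (ω p : Rn n) (f : 𝓢(Rn n, ℂ)) :
    derS ω (modS p f) = modS p (derS ω f + (Complex.I * (inner ℝ p ω : ℝ)) • f) := by
  ext x
  apply derS_apply_eq
  have h1 := ((hasDerivAt_inner_add_smul x ω p).ofReal_comp.mul_const Complex.I).cexp
  have h2 := h1.mul (hasLineDerivAt_derS ω f x)
  rw [HasLineDerivAt]
  simp only [modS_apply, add_apply, smul_apply, smul_eq_mul]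
  convert! h2 using 1
  simp only [zero_smul, add_zero, real_inner_comm]
  ring

theorem fourier_modS (p : Rn n) (f : 𝓢(Rn n, ℂ)) (ξ : Rn n) :
    (𝓕 (modS p f)) ξ = (𝓕 f) (ξ - (2 * Real.pi)⁻¹ • p) := by
  rw [SchwartzMap.fourier_coe, SchwartzMap.fourier_coe, Real.fourier_eq', Real.fourier_eq']
  refine integral_congr_ae (Eventually.of_forall fun x => ?_)
  simp only [modS_apply, smul_eq_mul]
  rw [← mul_assoc, ← Complex.exp_add, inner_sub_right, inner_smul_right]
  congr 2
  push_cast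
  field_simp
  ring

theorem fourier_transS (y : Rn n) (f : 𝓢(Rn n, ℂ)) (ξ : Rn n) :
    (𝓕 (transS y f)) ξ = Complex.exp (((-2 * Real.pi * inner ℝ y ξ : ℝ) : ℂ) * Complex.I)
      * (𝓕 f) ξ := by
  rw [SchwartzMap.fourier_coe, SchwartzMap.fourier_coe, Real.fourier_eq', Real.fourier_eq',
    ← integral_const_mul, ← integral_add_right_eq_self _ y]
  refine integral_congr_ae (Eventually.of_forall fun x => ?_)
  simp only [transS_apply, add_sub_cancel_right, smul_eq_mul]
  rw [← mul_assoc, ← Complex.exp_add, inner_add_left]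
  congr 2
  push_cast
  ring

/-- Expanding the square of the shifted frequency: the cross term is the symbol of a translation by
tp, and the constant term is a phase depending only on t and ‖p‖. -/
theorem freeSymbol_shift (t : ℝ) (p ζ : Rn n) :
    freeSymbol t (ζ + (2 * Real.pi)⁻¹ • p) =
      Complex.exp (((-(t * ‖p‖ ^ 2 / 2) : ℝ) : ℂ) * Complex.I) *
        (Complex.exp (((-2 * Real.pi * inner ℝ (t • p) ζ : ℝ) : ℂ) * Complex.I) *
          freeSymbol t ζ) := by
  rw [freeSymbol_eq, freeSymbol_eq, ← Complex.exp_add, ← Complex.exp_add, ← add_mul, ← add_mul,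
    ← Complex.ofReal_add, ← Complex.ofReal_add]
  congr 3
  have hpi := Real.pi_ne_zero
  rw [kineticSymbol, kineticSymbol, norm_add_sq_real, inner_smul_right, inner_smul_left, norm_smul,
    real_inner_comm p ζ, Real.norm_eq_abs, mul_pow, sq_abs]
  simp only [conj_trivial]
  field_simp
  ring

/-- Galilean covariance of the free evolution. -/
theorem freeS_modS (t : ℝ) (p : Rn n) (f : 𝓢(Rn n, ℂ)) :
    freeS t (modS p f) = Complex.exp (((-(t * ‖p‖ ^ 2 / 2) : ℝ) : ℂ) * Complex.I) •
      modS p (transS (t • p) (freeS t f)) := by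
  apply (FourierTransform.fourierEquiv ℂ 𝓢(Rn n, ℂ)).injective
  change 𝓕 (freeS t (modS p f)) = 𝓕 (Complex.exp (((-(t * ‖p‖ ^ 2 / 2) : ℝ) : ℂ) * Complex.I) •
      modS p (transS (t • p) (freeS t f)))
  ext ξ
  obtain ⟨ζ, rfl⟩ : ∃ ζ, ξ = ζ + (2 * Real.pi)⁻¹ • p := ⟨ξ - (2 * Real.pi)⁻¹ • p, by simp⟩
  rw [FourierTransform.fourier_smul, smul_apply, fourier_freeS, fourier_modS, fourier_modS,
    add_sub_cancel_right, fourier_transS, fourier_freeS, freeSymbol_shift, smul_eq_mul]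
  ring

/-! ### Boosted states -/

/-- A bound for the weighted derivatives of `f` in direction `ω` that control boosted states. -/
def boostNorm (ω : Rn n) (f : 𝓢(Rn n, ℂ)) : ℝ :=
  ‖toL2 f‖ + ‖toL2 (derS ω f)‖ + ‖toL2 (derS ω (derS ω f))‖
    + ‖toL2 (derS ω (derS ω (derS ω f)))‖ + ‖toL2 (posS ω f)‖ + ‖toL2 (posS ω (posS ω f))‖
    + ‖toL2 (posS ω (derS ω f))‖ + ‖toL2 (posS ω (posS ω (derS ω f)))‖

theorem boostNorm_nonneg (ω : Rn n) (f : 𝓢(Rn n, ℂ)) : 0 ≤ boostNorm ω f := by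
  unfold boostNorm
  positivity

/-- The state `(iv)⁻³ ∂_ω³ (e^{i⟨x, p⟩} f)`, where `v = ⟨p, ω⟩`. -/
def boost (ω p : Rn n) (f : 𝓢(Rn n, ℂ)) : 𝓢(Rn n, ℂ) :=
  ((Complex.I * (inner ℝ p ω : ℝ))⁻¹ ^ 3) • derS ω (derS ω (derS ω (modS p f)))

section Boost

variable {ω p : Rn n} {v : ℝ}

theorem derS_modS_of_inner_eq (hp : inner ℝ p ω = v) (f : 𝓢(Rn n, ℂ)) :
    derS ω (modS p f) = modS p (derS ω f + (Complex.I * v) • f) := by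
  rw [derS_modS, hp]

/-- Conjugation by the modulation turns ∂_ω into ∂_ω + iv, so with a = (iv)⁻¹ the boosted state is
e^{ix·p}(1 + a∂_ω)³f. Every term except the first carries a factor a. -/
theorem norm_toL2_boost_sub_le (hv : 1 ≤ v) (hp : inner ℝ p ω = v) (f : 𝓢(Rn n, ℂ)) :
    ‖toL2 (boost ω p f) - toL2 (modS p f)‖ ≤ 3 * boostNorm ω f / v := by
  have hv0 : 0 < v := by linarith
  set a : ℂ := (Complex.I * v)⁻¹ with ha
  have hIv : (Complex.I * v : ℂ) ≠ 0 := by simp [hv0.ne']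
  have hIva : a * (Complex.I * v) = 1 := inv_mul_cancel₀ hIv
  have hna : ‖a‖ = v⁻¹ := by
    rw [ha, norm_inv, norm_mul, Complex.norm_I, one_mul, Complex.norm_real,
      Real.norm_of_nonneg hv0.le]
  have hv1 : v⁻¹ ≤ 1 := inv_le_one_of_one_le₀ hv
  have hvi : 0 < v⁻¹ := inv_pos.2 hv0
  set D := derS ω with hD
  have h1 : boost ω p f = modS p (f + ((3 * a) • D f + (3 * a ^ 2) • D (D f) + a ^ 3 • D (D (D f)))) := by
    rw [boost, hp, ← ha, derS_modS_of_inner_eq hp, derS_modS_of_inner_eq hp,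
      derS_modS_of_inner_eq hp, ← map_smul]
    congr 1
    simp only [map_add, map_smul]
    ext x
    simp only [add_apply, smul_apply, smul_eq_mul]
    linear_combination ((a ^ 2 * 3 * D (D f) x) + 3 * a * (a * (Complex.I * v) + 1) * D f x
      + ((a * (Complex.I * v)) ^ 2 + a * (Complex.I * v) + 1) * f x) * hIva
  rw [h1, ← map_sub, ← map_sub, add_sub_cancel_left, norm_toL2_modS]
  have hb : 3 * boostNorm ω f / v = 3 * boostNorm ω f * v⁻¹ := by rw [div_eq_mul_inv]
  have e1 : ‖toL2 ((3 * a) • D f)‖ ≤ 3 * v⁻¹ * ‖toL2 (D f)‖ := by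
    rw [map_smul, norm_smul, norm_mul, hna, Complex.norm_ofNat]
  have e2 : ‖toL2 ((3 * a ^ 2) • D (D f))‖ ≤ 3 * v⁻¹ * ‖toL2 (D (D f))‖ := by
    rw [map_smul, norm_smul, norm_mul, norm_pow, hna, Complex.norm_ofNat]
    refine mul_le_mul_of_nonneg_right ?_ (norm_nonneg _)
    nlinarith
  have e3 : ‖toL2 (a ^ 3 • D (D (D f)))‖ ≤ 3 * v⁻¹ * ‖toL2 (D (D (D f)))‖ := by
    rw [map_smul, norm_smul, norm_pow, hna]
    refine mul_le_mul_of_nonneg_right ?_ (norm_nonneg _)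
    have : v⁻¹ ^ 2 ≤ 1 := pow_le_one₀ hvi.le hv1
    nlinarith
  rw [map_add, map_add, hb]
  refine (norm_add₃_le).trans ((add_le_add (add_le_add e1 e2) e3).trans ?_)
  rw [← mul_add, ← mul_add, mul_assoc 3, mul_comm v⁻¹, ← mul_assoc]
  refine mul_le_mul_of_nonneg_right (mul_le_mul_of_nonneg_left ?_ (by norm_num)) hvi.le
  unfold boostNorm
  linarith [norm_nonneg (toL2 f), norm_nonneg (toL2 (posS ω f)),
    norm_nonneg (toL2 (posS ω (posS ω f))), norm_nonneg (toL2 (posS ω (derS ω f))),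
    norm_nonneg (toL2 (posS ω (posS ω (derS ω f))))]

theorem norm_toL2_boost_le (hv : 1 ≤ v) (hp : inner ℝ p ω = v) (f : 𝓢(Rn n, ℂ)) :
    ‖toL2 (boost ω p f)‖ ≤ 4 * boostNorm ω f := by
  have h1 := norm_toL2_boost_sub_le hv hp f
  have h2 : ‖toL2 (modS p f)‖ ≤ boostNorm ω f := by
    rw [norm_toL2_modS]
    unfold boostNorm
    linarith [norm_nonneg (toL2 (posS ω f)), norm_nonneg (toL2 (derS ω f)),
      norm_nonneg (toL2 (derS ω (derS ω f))), norm_nonneg (toL2 (derS ω (derS ω (derS ω f)))),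
      norm_nonneg (toL2 (posS ω (posS ω f))), norm_nonneg (toL2 (posS ω (derS ω f))),
      norm_nonneg (toL2 (posS ω (posS ω (derS ω f))))]
  have h3 : 3 * boostNorm ω f / v ≤ 3 * boostNorm ω f :=
    div_le_self (by linarith [boostNorm_nonneg ω f]) hv
  have h4 := norm_le_norm_add_norm_sub' (toL2 (boost ω p f)) (toL2 (modS p f))
  linarith

/-- Each term of `decayNorm` contains at most one derivative, and positions commute with
modulations, so the boost costs a single power of v. -/
theorem decayNorm_modS_le (hv : 1 ≤ v) (hp : inner ℝ p ω = v) (f : 𝓢(Rn n, ℂ)) :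
    decayNorm ω (modS p f) ≤ v * (4 * boostNorm ω f) := by
  have hv0 : 0 < v := by linarith
  have key : ∀ g h : 𝓢(Rn n, ℂ), ‖toL2 (g + (Complex.I * v) • h)‖ ≤ ‖toL2 g‖ + v * ‖toL2 h‖ := by
    intro g h
    rw [map_add, map_smul]
    refine (norm_add_le _ _).trans_eq ?_
    rw [norm_smul, norm_mul, Complex.norm_I, one_mul, Complex.norm_real, Real.norm_of_nonneg hv0.le]
  rw [decayNorm]
  simp only [derS_modS_of_inner_eq hp, posS_modS, norm_toL2_modS]
  simp only [map_add, map_smul]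
  have k1 := key (derS ω f) f
  have k2 := key (posS ω (derS ω f)) (posS ω f)
  have k3 := key (posS ω (posS ω (derS ω f))) (posS ω (posS ω f))
  simp only [map_add, map_smul] at k1 k2 k3
  unfold boostNorm
  have m : ∀ a : ℝ, 0 ≤ a → a ≤ v * a := fun a ha => le_mul_of_one_le_left ha hv
  have m1 := m _ (norm_nonneg (toL2 f))
  have m2 := m _ (norm_nonneg (toL2 (posS ω f)))
  have m3 := m _ (norm_nonneg (toL2 (derS ω f)))
  have m4 := m _ (norm_nonneg (toL2 (posS ω (derS ω f))))
  have m5 := m _ (norm_nonneg (toL2 (posS ω (posS ω (derS ω f)))))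
  have m6 := m _ (norm_nonneg (toL2 (derS ω (derS ω f))))
  have m7 := m _ (norm_nonneg (toL2 (derS ω (derS ω (derS ω f)))))
  have m8 := m _ (norm_nonneg (toL2 (posS ω (posS ω f))))
  have z1 := norm_nonneg (toL2 f)
  have z2 := norm_nonneg (toL2 (posS ω f))
  have z3 := norm_nonneg (toL2 (derS ω f))
  have z4 := norm_nonneg (toL2 (posS ω (derS ω f)))
  have z5 := norm_nonneg (toL2 (posS ω (posS ω (derS ω f))))
  have z6 := norm_nonneg (toL2 (derS ω (derS ω f)))
  have z7 := norm_nonneg (toL2 (derS ω (derS ω (derS ω f))))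
  have z8 := norm_nonneg (toL2 (posS ω (posS ω f)))
  simp only [mul_add, mul_left_comm v 4]
  linarith

/-- The integrable decay of the potential along a boosted state. -/
theorem norm_potL2_boost_le (hv : 1 ≤ v) (hp : inner ℝ p ω = v) (hω : ‖ω‖ = 1) {δ K : ℝ}
    (hδ0 : 0 ≤ δ) (hδ2 : δ ≤ 2)
    {V : Rn n → ℝ} (hV : V ∈ shortRangeWith n δ K) (f : 𝓢(Rn n, ℂ)) (t : ℝ) :
    ‖potL2 V (freeIso t (toL2 (boost ω p f)))‖ ≤
      32 * K * boostNorm ω f * (1 + v * |t|) ^ (-δ) := by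
  have hv0 : 0 < v := by linarith
  have h := norm_potL2_le_of_decay (l := v * |t|) (A := 4 * boostNorm ω f) hδ0 hδ2 (by positivity) hV
    (u := freeIso t (toL2 (boost ω p f))) ?_ ?_
  · exact h.trans_eq (by ring)
  · rw [LinearIsometryEquiv.norm_map]
    exact norm_toL2_boost_le hv hp f
  · rw [freeIso_toL2, ← wtS_apply, boost, map_smul, map_smul, norm_smul, hp, norm_pow, norm_inv,
      norm_mul, Complex.norm_I, one_mul, Complex.norm_real, Real.norm_of_nonneg hv0.le]
    have h1 := (sq_mul_norm_wtS_freeS_le hω t (modS p f)).trans (decayNorm_modS_le hv hp f)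
    -- Of the normalisation v⁻³, two powers convert t² into (vt)², and the third cancels the factor
    -- v from `decayNorm_modS_le`.
    calc (v * |t|) ^ 2 * (v⁻¹ ^ 3 * ‖wtS (freeS t (derS ω (derS ω (derS ω (modS p f)))))‖)
        = v⁻¹ * (t ^ 2 * ‖wtS (freeS t (derS ω (derS ω (derS ω (modS p f)))))‖) := by
          rw [mul_pow, sq_abs]
          field_simp
      _ ≤ v⁻¹ * (v * (4 * boostNorm ω f)) := mul_le_mul_of_nonneg_left h1 (by positivity)
      _ = _ := by rw [inv_mul_cancel_left₀ hv0.ne']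

/-- A boosted state moves like a classical free particle, up to dispersion. -/
theorem norm_freeIso_boost_sub_le (hv : 1 ≤ v) (hp : inner ℝ p ω = v) (f : 𝓢(Rn n, ℂ)) (t : ℝ) :
    ‖freeIso t (toL2 (boost ω p f)) -
      Complex.exp (((-(t * ‖p‖ ^ 2 / 2) : ℝ) : ℂ) * Complex.I) • toL2 (modS p (transS (t • p) f))‖ ≤
      3 * boostNorm ω f / v + |t| * ‖toL2 (kineticS f)‖ := by
  have h1 : ‖freeIso t (toL2 (boost ω p f)) - freeIso t (toL2 (modS p f))‖ ≤
      3 * boostNorm ω f / v := by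
    rw [← map_sub, LinearIsometryEquiv.norm_map]
    exact norm_toL2_boost_sub_le hv hp f
  have h2 : ‖freeIso t (toL2 (modS p f)) - Complex.exp (((-(t * ‖p‖ ^ 2 / 2) : ℝ) : ℂ) *
      Complex.I) • toL2 (modS p (transS (t • p) f))‖ ≤ |t| * ‖toL2 (kineticS f)‖ := by
    rw [freeIso_toL2, freeS_modS, map_smul, ← smul_sub, ← map_sub, ← map_sub, ← map_sub, norm_smul,
      Complex.norm_exp_ofReal_mul_I, one_mul, norm_toL2_modS, norm_toL2_transS, map_sub,
      ← freeIso_toL2]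
    exact norm_freeIso_toL2_sub_le t f
  exact (norm_sub_le_norm_sub_add_norm_sub _ _ _).trans (add_le_add h1 h2)

end Boost

/-! ### Dilated radial bump functions -/

theorem derS_comp (ω : Rn n) (g : Rn n ≃L[ℝ] Rn n) (f : 𝓢(Rn n, ℂ)) :
    derS ω (SchwartzMap.compCLMOfContinuousLinearEquiv ℂ g f) =
      SchwartzMap.compCLMOfContinuousLinearEquiv ℂ g (derS (g ω) f) :=
  SchwartzMap.lineDerivOp_compCLMOfContinuousLinearEquiv ℂ ω g f

theorem derS_smul_left (c : ℝ) (ω : Rn n) (f : 𝓢(Rn n, ℂ)) :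
    derS (c • ω) f = (c : ℂ) • derS ω f := by
  have h := LineDeriv.lineDerivOp_left_smul c ω f
  change ∂_{c • ω} f = _
  rw [h]
  ext x
  simp [derS]

/-- The dilation `f ↦ f(·/R)` on Schwartz functions, for `R ≠ 0`. -/
def dilS {R : ℝ} (hR : R ≠ 0) : 𝓢(Rn n, ℂ) →L[ℂ] 𝓢(Rn n, ℂ) :=
  SchwartzMap.compCLMOfContinuousLinearEquiv ℂ
    (ContinuousLinearEquiv.smulLeft (Units.mk0 R⁻¹ (inv_ne_zero hR)) : Rn n ≃L[ℝ] Rn n)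

section Dilation

variable {R : ℝ}

theorem dilS_apply (hR : R ≠ 0) (f : 𝓢(Rn n, ℂ)) (x : Rn n) : dilS hR f x = f (R⁻¹ • x) := rfl

theorem derS_dilS (hR : R ≠ 0) (ω : Rn n) (f : 𝓢(Rn n, ℂ)) :
    derS ω (dilS hR f) = ((R⁻¹ : ℝ) : ℂ) • dilS hR (derS ω f) := by
  rw [dilS, derS_comp, ← map_smul, ← derS_smul_left]
  rfl

theorem posS_dilS (hR : R ≠ 0) (ω : Rn n) (f : 𝓢(Rn n, ℂ)) :
    posS ω (dilS hR f) = (R : ℂ) • dilS hR (posS ω f) := by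
  ext x
  have : (R : ℂ) ≠ 0 := Complex.ofReal_ne_zero.2 hR
  simp only [posS_apply, dilS_apply, smul_apply, smul_eq_mul, inner_smul_left]
  simp only [conj_trivial]
  push_cast
  field_simp

/-- The exact factor is R^{n/2}. The cruder integer power suffices, because the loss only affects
the final Hölder exponent. -/
theorem norm_toL2_dilS_le (hR0 : R ≠ 0) (hR : 1 ≤ R) (f : 𝓢(Rn n, ℂ)) :
    ‖toL2 (dilS hR0 f)‖ ≤ R ^ n * ‖toL2 f‖ := by
  have hR' : 0 < R := by linarith
  have hRn : 1 ≤ R ^ n := one_le_pow₀ hR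
  have h1 : (dilS hR0 f : Rn n → ℂ) = f ∘ fun x => R⁻¹ • x := rfl
  have h2 := Measure.map_addHaar_smul (volume : Measure (Rn n)) (inv_ne_zero hR0)
  rw [Lp.norm_def, Lp.norm_def, eLpNorm_congr_ae (coeFn_toL2 f),
    eLpNorm_congr_ae (coeFn_toL2 (dilS hR0 f)), h1,
    ← eLpNorm_map_measure (by exact f.continuous.aestronglyMeasurable) (by fun_prop), h2,
    eLpNorm_smul_measure_of_ne_top (by norm_num)]
  rw [smul_eq_mul, ENNReal.toReal_mul]
  refine mul_le_mul_of_nonneg_right ?_ ENNReal.toReal_nonneg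
  rw [← ENNReal.toReal_rpow, ENNReal.toReal_ofReal (abs_nonneg _), finrank_euclideanSpace,
    Fintype.card_fin, inv_pow, inv_inv, abs_of_pos (by positivity)]
  calc (R ^ n) ^ (1 / (2 : ℝ≥0∞)).toReal ≤ (R ^ n) ^ (1 : ℝ) :=
        Real.rpow_le_rpow_of_exponent_le hRn (by norm_num)
    _ = R ^ n := Real.rpow_one _

theorem boostNorm_dilS_le (hR0 : R ≠ 0) (hR : 1 ≤ R) (ω : Rn n) (f : 𝓢(Rn n, ℂ)) :
    boostNorm ω (dilS hR0 f) ≤ R ^ (n + 2) * boostNorm ω f := by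
  have hR' : 0 < R := by linarith
  have hi : R⁻¹ ≤ 1 := inv_le_one_of_one_le₀ hR
  have key : ∀ (c : ℝ) (g : 𝓢(Rn n, ℂ)), 0 ≤ c → c ≤ R ^ 2 →
      c * ‖toL2 (dilS hR0 g)‖ ≤ R ^ (n + 2) * ‖toL2 g‖ := by
    intro c g hc hc2
    calc c * ‖toL2 (dilS hR0 g)‖ ≤ R ^ 2 * (R ^ n * ‖toL2 g‖) :=
          mul_le_mul hc2 (norm_toL2_dilS_le hR0 hR g) (norm_nonneg _) (by positivity)
      _ = _ := by ring
  have hR2 : 1 ≤ R ^ 2 := one_le_pow₀ hR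
  have hR3 : R ≤ R ^ 2 := le_self_pow₀ hR two_ne_zero
  have hi2 : R⁻¹ * R⁻¹ ≤ 1 := mul_le_one₀ hi (by positivity) hi
  have hi3 : R⁻¹ * (R⁻¹ * R⁻¹) ≤ 1 := mul_le_one₀ hi (by positivity) hi2
  simp only [boostNorm, derS_dilS, posS_dilS, map_smul, norm_smul, Complex.norm_real,
    Real.norm_of_nonneg hR'.le, Real.norm_of_nonneg (inv_nonneg.2 hR'.le), ← mul_assoc]
  have k1 := key 1 f zero_le_one hR2
  have k2 := key R⁻¹ (derS ω f) (by positivity) (by linarith)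
  have k3 := key (R⁻¹ * R⁻¹) (derS ω (derS ω f)) (by positivity) (by linarith)
  have k4 := key (R⁻¹ * R⁻¹ * R⁻¹) (derS ω (derS ω (derS ω f))) (by positivity) (by linarith)
  have k5 := key R (posS ω f) hR'.le hR3
  have k6 := key (R * R) (posS ω (posS ω f)) (by positivity) (by rw [sq])
  have k7 := key (R⁻¹ * R) (posS ω (derS ω f)) (by positivity) (by rw [inv_mul_cancel₀ hR0]; exact hR2)
  have k8 := key (R⁻¹ * R * R) (posS ω (posS ω (derS ω f))) (by positivity)
    (by rw [inv_mul_cancel₀ hR0, one_mul]; exact hR3)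
  rw [one_mul] at k1
  simp only [mul_add]
  linarith

theorem norm_toL2_kineticS_dilS_le (hR0 : R ≠ 0) (hR : 1 ≤ R) (f : 𝓢(Rn n, ℂ)) :
    ‖toL2 (kineticS (dilS hR0 f))‖ ≤ R ^ (n + 2) * ‖toL2 (kineticS f)‖ := by
  have hR' : 0 < R := by linarith
  have hi : R⁻¹ ≤ 1 := inv_le_one_of_one_le₀ hR
  have h : kineticS (dilS hR0 f) = ((R⁻¹ * R⁻¹ : ℝ) : ℂ) • dilS hR0 (kineticS f) := by
    have hlap : ∀ g : 𝓢(Rn n, ℂ), Δ g = ∑ i, derS (EuclideanSpace.basisFun (Fin n) ℝ i)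
        (derS (EuclideanSpace.basisFun (Fin n) ℝ i) g) := fun g =>
      SchwartzMap.laplacian_eq_sum (EuclideanSpace.basisFun (Fin n) ℝ) g
    have hsum : Δ (dilS hR0 f) = ((R⁻¹ * R⁻¹ : ℝ) : ℂ) • dilS hR0 (Δ f) := by
      rw [hlap, hlap, map_sum, Finset.smul_sum]
      refine Finset.sum_congr rfl fun i _ => ?_
      rw [derS_dilS, map_smul, derS_dilS, smul_smul, Complex.ofReal_mul]
    rw [kineticS_eq, kineticS_eq, hsum, map_smul, smul_comm]
  rw [h, map_smul, norm_smul, Complex.norm_real, Real.norm_of_nonneg (by positivity)]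
  calc R⁻¹ * R⁻¹ * ‖toL2 (dilS hR0 (kineticS f))‖ ≤ R ^ 2 * (R ^ n * ‖toL2 (kineticS f)‖) := by
        refine mul_le_mul ?_ (norm_toL2_dilS_le hR0 hR _) (norm_nonneg _) (by positivity)
        exact (mul_le_one₀ hi (by positivity) hi).trans (one_le_pow₀ hR)
    _ = _ := by ring

end Dilation

theorem boostNorm_comp_isometry (L : Rn n ≃ₗᵢ[ℝ] Rn n) (ω : Rn n) (f : 𝓢(Rn n, ℂ)) :
    boostNorm ω (SchwartzMap.compCLMOfContinuousLinearEquiv ℂ L.toContinuousLinearEquiv f : 𝓢(Rn n, ℂ)) =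
      boostNorm (L ω) f := by
  set T : 𝓢(Rn n, ℂ) →L[ℂ] 𝓢(Rn n, ℂ) :=
    SchwartzMap.compCLMOfContinuousLinearEquiv ℂ L.toContinuousLinearEquiv with hT
  have hd : ∀ g, derS ω (T g) = T (derS (L ω) g) := fun g =>
    derS_comp ω L.toContinuousLinearEquiv g
  have hp : ∀ g, posS ω (T g) = T (posS (L ω) g) := fun g => by
    ext x
    change posS ω (T g) x = posS (L ω) g (L x)
    rw [posS_apply, posS_apply, L.inner_map_map]
    rfl
  have hn : ∀ g, ‖toL2 (T g)‖ = ‖toL2 g‖ := fun g => by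
    have h : (T g : Rn n → ℂ) = g ∘ L := rfl
    rw [Lp.norm_def, Lp.norm_def, eLpNorm_congr_ae (coeFn_toL2 g),
      eLpNorm_congr_ae (coeFn_toL2 (T g)), h,
      eLpNorm_comp_measurePreserving g.continuous.aestronglyMeasurable L.measurePreserving]
  simp only [boostNorm, hd, hp, hn]

/-- A smooth radial function, equal to `1` on the ball of radius `1/2` and supported in the unit
ball. -/
def bump (x : Rn n) : ℝ := Real.smoothTransition (2 - 2 * ‖x‖ ^ 2)

theorem contDiff_bump : ContDiff ℝ (⊤ : ℕ∞) (bump : Rn n → ℝ) :=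
  Real.smoothTransition.contDiff.comp (contDiff_const.sub (contDiff_const.mul (contDiff_norm_sq ℝ)))

theorem continuous_bump : Continuous (bump : Rn n → ℝ) := contDiff_bump.continuous

theorem bump_nonneg (x : Rn n) : 0 ≤ bump x := Real.smoothTransition.nonneg _

theorem bump_le_one (x : Rn n) : bump x ≤ 1 := Real.smoothTransition.le_one _

theorem bump_eq_one {x : Rn n} (hx : ‖x‖ ≤ 1 / 2) : bump x = 1 :=
  Real.smoothTransition.one_of_one_le (by nlinarith [norm_nonneg x])

theorem bump_eq_zero {x : Rn n} (hx : 1 ≤ ‖x‖) : bump x = 0 :=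
  Real.smoothTransition.zero_of_nonpos (by nlinarith)

theorem hasCompactSupport_bump : HasCompactSupport (bump : Rn n → ℝ) :=
  HasCompactSupport.of_support_subset_isCompact (isCompact_closedBall (0 : Rn n) 1) fun x hx => by
    rw [mem_closedBall_zero_iff]
    by_contra h
    exact hx (bump_eq_zero (not_le.1 h).le)

theorem exists_lipschitz_bump : ∃ L : ℝ, 0 ≤ L ∧ ∀ x y : Rn n, |bump x - bump y| ≤ L * ‖x - y‖ := by
  obtain ⟨C, hC⟩ := ContDiff.lipschitzWith_of_hasCompactSupport hasCompactSupport_bump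
    (contDiff_bump (n := n)) (by simp)
  exact ⟨C, C.2, fun x y => by simpa [dist_eq_norm] using hC.dist_le_mul x y⟩

/-- `bump` as a Schwartz function. -/
def bumpS (n : ℕ) : 𝓢(Rn n, ℂ) :=
  HasCompactSupport.toSchwartzMap (f := Complex.ofRealCLM ∘ (bump : Rn n → ℝ))
    (hasCompactSupport_bump.comp_left rfl) (Complex.ofRealCLM.contDiff.comp contDiff_bump)

theorem bumpS_apply (x : Rn n) : bumpS n x = (bump x : ℂ) := rfl

/-- The bump is radial, hence invariant under the reflection exchanging ω and ω'. This makes all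
constants uniform in the direction, which will vary with the frequency. -/
theorem boostNorm_bumpS_eq {ω ω' : Rn n} (h : ‖ω‖ = ‖ω'‖) :
    boostNorm ω (bumpS n) = boostNorm ω' (bumpS n) := by
  set L := Submodule.reflection (Submodule.span ℝ {ω - ω'})ᗮ with hL
  have h1 : L ω = ω' := Submodule.reflection_sub h
  rw [← h1, ← boostNorm_comp_isometry]
  congr 1
  ext x
  change (bump x : ℂ) = bump (L x)
  rw [bump, bump, L.norm_map]

/-- The functions `bump(·/R)` and their boosted norms, uniformly in the direction. -/
theorem exists_boostNorm_bumpS_le (n : ℕ) : ∃ C : ℝ, 1 ≤ C ∧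
    ∀ (R : ℝ) (hR0 : R ≠ 0) (ω : Rn n), 1 ≤ R → ‖ω‖ = 1 →
      boostNorm ω (dilS hR0 (bumpS n)) ≤ C * R ^ (n + 2) ∧
      ‖toL2 (kineticS (dilS hR0 (bumpS n)))‖ ≤ C * R ^ (n + 2) := by
  by_cases hex : ∃ ω₀ : Rn n, ‖ω₀‖ = 1
  · obtain ⟨ω₀, hω₀⟩ := hex
    have hb := boostNorm_nonneg ω₀ (bumpS n)
    have hk := norm_nonneg (toL2 (kineticS (bumpS n)))
    refine ⟨1 + boostNorm ω₀ (bumpS n) + ‖toL2 (kineticS (bumpS n))‖, by linarith,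
      fun R hR0 ω hR hω => ⟨?_, ?_⟩⟩
    · refine (boostNorm_dilS_le hR0 hR ω _).trans ?_
      rw [boostNorm_bumpS_eq (hω.trans hω₀.symm), mul_comm]
      exact mul_le_mul_of_nonneg_right (by linarith) (by positivity)
    · refine (norm_toL2_kineticS_dilS_le hR0 hR _).trans ?_
      rw [mul_comm]
      exact mul_le_mul_of_nonneg_right (by linarith) (by positivity)
  · exact ⟨1, le_rfl, fun R hR0 ω hR hω => absurd ⟨ω, hω⟩ hex⟩

/-! ### The Born approximation at high velocity -/

theorem sub_mem_shortRangeWith {δ K : ℝ} {V₁ V₂ : Rn n → ℝ} (h₁ : V₁ ∈ shortRangeWith n δ K)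
    (h₂ : V₂ ∈ shortRangeWith n δ K) : V₁ - V₂ ∈ shortRangeWith n δ (2 * K) := by
  refine ⟨h₁.1.sub h₂.1, fun x => ?_⟩
  rw [two_mul, add_mul]
  exact (abs_sub _ _).trans (add_le_add (h₁.2 x) (h₂.2 x))

theorem potL2_sub {V₁ V₂ : Rn n → ℝ} {C₁ C₂ C : ℝ} (h₁ : IsBoundedSymbol (fun x => (V₁ x : ℂ)) C₁)
    (h₂ : IsBoundedSymbol (fun x => (V₂ x : ℂ)) C₂)
    (h : IsBoundedSymbol (fun x => ((V₁ - V₂) x : ℂ)) C) (u : L2 n) :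
    potL2 (V₁ - V₂) u = potL2 V₁ u - potL2 V₂ u := by
  ext1
  filter_upwards [h₁.coeFn_mulL2 u, h₂.coeFn_mulL2 u, h.coeFn_mulL2 u,
    Lp.coeFn_sub (potL2 V₁ u) (potL2 V₂ u)] with x e₁ e₂ e₃ e₄
  rw [e₃, e₄]
  simp only [Pi.sub_apply]
  rw [e₁, e₂, Complex.ofReal_sub, sub_mul]

theorem integral_one_add_mul_abs_rpow {δ v : ℝ} (hv : 0 < v) :
    ∫ t : ℝ, (1 + v * |t|) ^ (-δ) = v⁻¹ * ∫ t : ℝ, (1 + |t|) ^ (-δ) := by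
  have h := Measure.integral_comp_mul_left (fun t : ℝ => (1 + |t|) ^ (-δ)) v
  rw [abs_of_pos (inv_pos.2 hv), smul_eq_mul] at h
  rw [← h]
  simp only [abs_mul, abs_of_pos hv]

/-- The difference of two Born approximations: the identity part cancels, the operator norm bounds
the scattering part, and each of the two remainders is a product of time integrals of order N/v. -/
theorem norm_inner_scatteringOperator_sub_sub_le {V₁ V₂ : Rn n → ℝ} {C δ N v : ℝ}
    (hδ : 1 < δ) (hv : 0 < v)
    (hV₁ : IsBoundedSymbol (fun x => (V₁ x : ℂ)) C) (hV₂ : IsBoundedSymbol (fun x => (V₂ x : ℂ)) C)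
    (hp₁ : IsWaveOperator V₁ atTop (waveOperator V₁ atTop))
    (hm₁ : IsWaveOperator V₁ atBot (waveOperator V₁ atBot))
    (hp₂ : IsWaveOperator V₂ atTop (waveOperator V₂ atTop))
    (hm₂ : IsWaveOperator V₂ atBot (waveOperator V₂ atBot)) {f g : 𝓢(Rn n, ℂ)}
    (hf₁ : ∀ t, ‖potL2 V₁ (freeIso t (toL2 f))‖ ≤ N * (1 + v * |t|) ^ (-δ))
    (hf₂ : ∀ t, ‖potL2 V₂ (freeIso t (toL2 f))‖ ≤ N * (1 + v * |t|) ^ (-δ))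
    (hg₁ : ∀ t, ‖potL2 V₁ (freeIso t (toL2 g))‖ ≤ N * (1 + v * |t|) ^ (-δ))
    (hg₂ : ∀ t, ‖potL2 V₂ (freeIso t (toL2 g))‖ ≤ N * (1 + v * |t|) ^ (-δ)) :
    ‖∫ t, inner ℂ (freeIso t (toL2 g))
        (potL2 V₁ (freeIso t (toL2 f)) - potL2 V₂ (freeIso t (toL2 f)))‖ ≤
      ‖scatteringOperator V₁ - scatteringOperator V₂‖ * ‖toL2 f‖ * ‖toL2 g‖
        + 2 * (N * (v⁻¹ * ∫ t : ℝ, (1 + |t|) ^ (-δ))) ^ 2 := by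
  set I := N * (v⁻¹ * ∫ t : ℝ, (1 + |t|) ^ (-δ)) with hI
  have hint := (integrable_one_add_mul_abs_rpow hδ hv).const_mul N
  have hIeq : ∫ t : ℝ, N * (1 + v * |t|) ^ (-δ) = I := by
    rw [integral_const_mul, integral_one_add_mul_abs_rpow hv]
  have hi : ∀ {V : Rn n → ℝ} {h : 𝓢(Rn n, ℂ)}, IsBoundedSymbol (fun x => (V x : ℂ)) C →
      (∀ t, ‖potL2 V (freeIso t (toL2 h))‖ ≤ N * (1 + v * |t|) ^ (-δ)) →
      Integrable (fun t => ‖potL2 V (freeIso t (toL2 h))‖) := fun hV hb =>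
    hint.mono' (continuous_potL2_freeIso hV _).norm.aestronglyMeasurable
      (Eventually.of_forall fun t => by rw [norm_norm]; exact hb t)
  have hle : ∀ {V : Rn n → ℝ} {h : 𝓢(Rn n, ℂ)}, IsBoundedSymbol (fun x => (V x : ℂ)) C →
      (∀ t, ‖potL2 V (freeIso t (toL2 h))‖ ≤ N * (1 + v * |t|) ^ (-δ)) →
      ∫ t, ‖potL2 V (freeIso t (toL2 h))‖ ≤ I := fun hV hb => by
    rw [← hIeq]
    exact integral_mono (hi hV hb) hint hb
  have hI0 : 0 ≤ I := (integral_nonneg fun t => norm_nonneg _).trans (hle hV₁ hf₁)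
  have hG : ∀ {V : Rn n → ℝ}, IsBoundedSymbol (fun x => (V x : ℂ)) C →
      (∀ t, ‖potL2 V (freeIso t (toL2 f))‖ ≤ N * (1 + v * |t|) ^ (-δ)) →
      Integrable (fun t => inner ℂ (freeIso t (toL2 g)) (potL2 V (freeIso t (toL2 f)))) :=
    fun hV hb => ((hi hV hb).const_mul ‖toL2 g‖).mono'
      ((continuous_freeIso _).inner (continuous_potL2_freeIso hV _)).aestronglyMeasurable
      (Eventually.of_forall fun t => (norm_inner_le_norm _ _).trans_eq
        (by rw [LinearIsometryEquiv.norm_map]))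
  have b₁ := norm_inner_scatteringOperator_sub_le hV₁ hp₁ hm₁ (hi hV₁ hf₁) (hi hV₁ hg₁)
  have b₂ := norm_inner_scatteringOperator_sub_le hV₂ hp₂ hm₂ (hi hV₂ hf₂) (hi hV₂ hg₂)
  have c₁ := b₁.trans (mul_le_mul (hle hV₁ hg₁) (hle hV₁ hf₁)
    (integral_nonneg fun t => norm_nonneg _) hI0)
  have c₂ := b₂.trans (mul_le_mul (hle hV₂ hg₂) (hle hV₂ hf₂)
    (integral_nonneg fun t => norm_nonneg _) hI0)
  simp only [inner_sub_right]
  rw [integral_sub (hG hV₁ hf₁) (hG hV₂ hf₂)]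
  set G₁ := ∫ t, inner ℂ (freeIso t (toL2 g)) (potL2 V₁ (freeIso t (toL2 f)))
  set G₂ := ∫ t, inner ℂ (freeIso t (toL2 g)) (potL2 V₂ (freeIso t (toL2 f)))
  have hS : ‖inner ℂ (toL2 g) ((scatteringOperator V₁ - scatteringOperator V₂) (toL2 f))‖ ≤
      ‖scatteringOperator V₁ - scatteringOperator V₂‖ * ‖toL2 f‖ * ‖toL2 g‖ := by
    refine (norm_inner_le_norm _ _).trans ?_
    rw [mul_comm]
    exact mul_le_mul_of_nonneg_right (ContinuousLinearMap.le_opNorm _ _) (norm_nonneg _)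
  rw [sub_apply, inner_sub_right] at hS
  set s₁ := inner ℂ (toL2 g) (scatteringOperator V₁ (toL2 f))
  set s₂ := inner ℂ (toL2 g) (scatteringOperator V₂ (toL2 f))
  set s₀ := inner ℂ (toL2 g) (toL2 f)
  have hid : Complex.I * (G₁ - G₂) = (s₁ - s₀ + Complex.I * G₁) - (s₂ - s₀ + Complex.I * G₂)
      - (s₁ - s₂) := by ring
  have : ‖G₁ - G₂‖ = ‖Complex.I * (G₁ - G₂)‖ := by rw [norm_mul, Complex.norm_I, one_mul]
  rw [this, hid]
  refine (norm_sub_le _ _).trans ((add_le_add (norm_sub_le _ _) le_rfl).trans ?_)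
  rw [sq]
  linarith

/-- The tail of an integrable power. -/
theorem norm_setIntegral_le_of_decay {F : ℝ → ℂ} {δ N v T : ℝ} (hδ : 1 < δ) (hv : 0 < v)
    (hT : 0 < T) (hF : Continuous F) (hN : 0 ≤ N) (h : ∀ t, ‖F t‖ ≤ N * (1 + v * |t|) ^ (-δ)) :
    ‖∫ t in Set.Icc (-(T / v)) (T / v), F t‖ ≤ ‖∫ t, F t‖ +
      N * (T ^ (-((δ - 1) / 2)) * (v⁻¹ * ∫ t : ℝ, (1 + |t|) ^ (-((δ + 1) / 2)))) := by
  have hint := (integrable_one_add_mul_abs_rpow hδ hv).const_mul N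
  have hFi : Integrable F := hint.mono' hF.aestronglyMeasurable (Eventually.of_forall h)
  have hδ' : 1 < (δ + 1) / 2 := by linarith
  have hint' := ((integrable_one_add_mul_abs_rpow hδ' hv).const_mul (T ^ (-((δ - 1) / 2)))).const_mul N
  rw [← integral_add_compl (measurableSet_Icc (a := -(T / v)) (b := T / v)) hFi]
  have htail : ‖∫ t in (Set.Icc (-(T / v)) (T / v))ᶜ, F t‖ ≤
      N * (T ^ (-((δ - 1) / 2)) * (v⁻¹ * ∫ t : ℝ, (1 + |t|) ^ (-((δ + 1) / 2)))) := by
    rw [← integral_one_add_mul_abs_rpow hv, ← integral_const_mul, ← integral_const_mul]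
    refine (norm_integral_le_of_norm_le hint'.integrableOn ?_).trans
      (setIntegral_le_integral hint' (Eventually.of_forall fun t => ?_))
    · filter_upwards [ae_restrict_mem measurableSet_Icc.compl] with t ht
      refine (h t).trans (mul_le_mul_of_nonneg_left ?_ hN)
      have h1 : T ≤ 1 + v * |t| := by
        by_contra hcon
        refine ht (abs_le.1 ?_)
        rw [le_div_iff₀ hv]
        linarith
      have h0 : 0 < 1 + v * |t| := by positivity
      -- δ is split as (δ-1)/2 + (δ+1)/2: the second exponent still exceeds 1 and is integrable, the
      -- first gives decay in T, since T ≤ 1 + v|t| off the interval.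
      calc (1 + v * |t|) ^ (-δ) = (1 + v * |t|) ^ (-((δ - 1) / 2)) *
            (1 + v * |t|) ^ (-((δ + 1) / 2)) := by
            rw [← Real.rpow_add h0]
            ring_nf
        _ ≤ _ := mul_le_mul_of_nonneg_right
            (Real.rpow_le_rpow_of_nonpos hT h1 (by linarith)) (by positivity)
    · positivity
  have := norm_sub_norm_le (∫ t in Set.Icc (-(T / v)) (T / v), F t)
    (-∫ t in (Set.Icc (-(T / v)) (T / v))ᶜ, F t)
  rw [sub_neg_eq_add, norm_neg] at this
  linarith

/-! ### Overlap integrals of two moving wave packets -/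

theorem inner_potL2_modS {q : Rn n → ℝ} {C : ℝ} (hq : IsBoundedSymbol (fun x => (q x : ℂ)) C)
    (p p' : Rn n) (f g : 𝓢(Rn n, ℂ)) :
    inner ℂ (toL2 (modS p' g)) (potL2 q (toL2 (modS p f))) =
      ∫ x, (q x : ℂ) * Complex.exp (((inner ℝ x (p - p') : ℝ) : ℂ) * Complex.I) *
        (f x * starRingEnd ℂ (g x)) := by
  rw [L2.inner_def]
  refine integral_congr_ae ?_
  filter_upwards [coeFn_toL2 (modS p' g), coeFn_toL2 (modS p f), hq.coeFn_mulL2 (toL2 (modS p f))]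
    with x h1 h2 h3
  rw [h1, h3, h2, RCLike.inner_apply, modS_apply, modS_apply, inner_sub_right, map_mul,
    ← Complex.exp_conj, map_mul, Complex.conj_ofReal, Complex.conj_I, Complex.ofReal_sub, sub_mul,
    sub_eq_add_neg, Complex.exp_add, mul_neg]
  ring

theorem norm_inner_potL2_sub_le {q : Rn n → ℝ} {C : ℝ}
    (hq : IsBoundedSymbol (fun x => (q x : ℂ)) C) {x x' y y' : L2 n} {a b d : ℝ}
    (hC : 0 ≤ C) (hx : ‖x - x'‖ ≤ d) (hy : ‖y - y'‖ ≤ d) (hya : ‖y‖ ≤ a) (hxb : ‖x'‖ ≤ b) :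
    ‖inner ℂ x (potL2 q y) - inner ℂ x' (potL2 q y')‖ ≤ C * d * (a + b) := by
  have hid : inner ℂ x (potL2 q y) - inner ℂ x' (potL2 q y') =
      inner ℂ (x - x') (mulOp hq y) + inner ℂ x' (mulOp hq (y - y')) := by
    rw [map_sub, inner_sub_left, inner_sub_right]
    change _ = inner ℂ x (potL2 q y) - inner ℂ x' (potL2 q y) +
      (inner ℂ x' (potL2 q y) - inner ℂ x' (potL2 q y'))
    ring
  have hd : 0 ≤ d := (norm_nonneg _).trans hx
  have hb : 0 ≤ b := (norm_nonneg _).trans hxb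
  rw [hid]
  refine (norm_add_le _ _).trans ?_
  have h1 : ‖inner ℂ (x - x') (mulOp hq y)‖ ≤ d * (C * a) :=
    (norm_inner_le_norm _ _).trans (mul_le_mul hx ((hq.norm_mulL2_le y).trans
      (mul_le_mul_of_nonneg_left hya hC)) (norm_nonneg _) hd)
  have h2 : ‖inner ℂ x' (mulOp hq (y - y'))‖ ≤ b * (C * d) :=
    (norm_inner_le_norm _ _).trans (mul_le_mul hxb ((hq.norm_mulL2_le _).trans
      (mul_le_mul_of_nonneg_left hy hC)) (norm_nonneg _) hb)
  linarith

/-- The oscillatory integral of `q` against the product of two bumps moving with velocities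
`p` and `p'`. -/
def movingIntegral (q : Rn n → ℝ) (R : ℝ) (p p' : Rn n) (t : ℝ) : ℂ :=
  ∫ x, (q x : ℂ) * Complex.exp (((inner ℝ x (p - p') : ℝ) : ℂ) * Complex.I) *
    ((bump (R⁻¹ • (x - t • p)) * bump (R⁻¹ • (x - t • p')) : ℝ) : ℂ)

theorem inner_potL2_modS_transS {q : Rn n → ℝ} {C : ℝ}
    (hq : IsBoundedSymbol (fun x => (q x : ℂ)) C) {R : ℝ} (hR : R ≠ 0) (p p' : Rn n) (t : ℝ) :
    inner ℂ (toL2 (modS p' (transS (t • p') (dilS hR (bumpS n)))))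
      (potL2 q (toL2 (modS p (transS (t • p) (dilS hR (bumpS n)))))) = movingIntegral q R p p' t := by
  rw [inner_potL2_modS hq, movingIntegral]
  refine integral_congr_ae (Eventually.of_forall fun x => ?_)
  simp only [transS_apply, dilS_apply, bumpS_apply, Complex.conj_ofReal, Complex.ofReal_mul]

theorem integrable_movingIntegrand {q : Rn n → ℝ} (hq : Integrable q) (hqc : Continuous q)
    (R : ℝ) (p p' : Rn n) (a b : ℝ) :
    Integrable (fun z : ℝ × Rn n => (q z.2 : ℂ) *
      Complex.exp (((inner ℝ z.2 (p - p') : ℝ) : ℂ) * Complex.I) *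
      ((bump (R⁻¹ • (z.2 - z.1 • p)) * bump (R⁻¹ • (z.2 - z.1 • p')) : ℝ) : ℂ))
      ((volume.restrict (Set.Icc a b)).prod volume) := by
  refine (hq.norm.comp_snd (volume.restrict (Set.Icc a b))).mono' ?_ (Eventually.of_forall fun z => ?_)
  · refine Continuous.aestronglyMeasurable ?_
    have := continuous_bump (n := n)
    fun_prop
  · rw [norm_mul, norm_mul, Complex.norm_exp_ofReal_mul_I, mul_one, Complex.norm_real,
      Complex.norm_real]
    refine mul_le_of_le_one_right (norm_nonneg _) ?_
    rw [Real.norm_of_nonneg (mul_nonneg (bump_nonneg _) (bump_nonneg _))]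
    exact mul_le_one₀ (bump_le_one _) (bump_nonneg _) (bump_le_one _)

theorem integrableOn_movingIntegral {q : Rn n → ℝ} (hq : Integrable q) (hqc : Continuous q)
    (R : ℝ) (p p' : Rn n) (a b : ℝ) : IntegrableOn (movingIntegral q R p p') (Set.Icc a b) :=
  (integrable_movingIntegrand hq hqc R p p' a b).integral_prod_left

theorem setIntegral_movingIntegral {q : Rn n → ℝ} (hq : Integrable q) (hqc : Continuous q)
    (R : ℝ) (p p' : Rn n) (a b : ℝ) :
    ∫ t in Set.Icc a b, movingIntegral q R p p' t =
      ∫ x, (q x : ℂ) * Complex.exp (((inner ℝ x (p - p') : ℝ) : ℂ) * Complex.I) *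
        ((∫ t in Set.Icc a b, bump (R⁻¹ • (x - t • p)) * bump (R⁻¹ • (x - t • p')) : ℝ) : ℂ) := by
  have h := integral_integral_swap (f := fun (t : ℝ) (x : Rn n) => (q x : ℂ) *
    Complex.exp (((inner ℝ x (p - p') : ℝ) : ℂ) * Complex.I) *
      ((bump (R⁻¹ • (x - t • p)) * bump (R⁻¹ • (x - t • p')) : ℝ) : ℂ)) (integrable_movingIntegrand hq hqc R p p' a b)
  simp only [movingIntegral]
  rw [h]
  refine integral_congr_ae (Eventually.of_forall fun x => ?_)
  simp only
  rw [integral_const_mul]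
  exact congrArg _ integral_ofReal

/-- Combination of the Born approximation and of the classical approximation of the boosted
states. -/
theorem norm_setIntegral_movingIntegral_le (hn : 0 < n) {V₁ V₂ : Rn n → ℝ} {δ K : ℝ} (hδ1 : 1 < δ)
    (hδ2 : δ ≤ 2) (hV₁ : V₁ ∈ shortRangeWith n δ K) (hV₂ : V₂ ∈ shortRangeWith n δ K)
    (hq : Integrable (V₁ - V₂)) {ω p p' : Rn n} {v R T A : ℝ} (hR : R ≠ 0) (hω : ‖ω‖ = 1)
    (hv : 1 ≤ v) (hp : inner ℝ p ω = v) (hp' : inner ℝ p' ω = v) (hpp : ‖p‖ = ‖p'‖) (hT : 0 < T)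
    (hA : boostNorm ω (dilS hR (bumpS n)) ≤ A)
    (hA' : ‖toL2 (kineticS (dilS hR (bumpS n)))‖ ≤ A) :
    ‖∫ t in Set.Icc (-(T / v)) (T / v), movingIntegral (V₁ - V₂) R p p' t‖ ≤
      16 * A ^ 2 * ‖scatteringOperator V₁ - scatteringOperator V₂‖
      + 2 * (32 * K * A * (v⁻¹ * ∫ t : ℝ, (1 + |t|) ^ (-δ))) ^ 2
      + 256 * K * A ^ 2 * (T ^ (-((δ - 1) / 2)) * (v⁻¹ * ∫ t : ℝ, (1 + |t|) ^ (-((δ + 1) / 2))))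
      + 20 * K * A ^ 2 * (T / v) * (3 / v + T / v) := by
  have hv0 : 0 < v := by linarith
  have hK := nonneg_of_mem_shortRangeWith hV₁
  set f := dilS hR (bumpS n) with hf
  have hA0 : 0 ≤ A := (boostNorm_nonneg ω f).trans hA
  have hV := sub_mem_shortRangeWith hV₁ hV₂
  have hδ0 : 0 ≤ δ := by linarith
  have b₁ := isBoundedSymbol_of_mem hδ0 hV₁
  have b₂ := isBoundedSymbol_of_mem hδ0 hV₂
  have b := isBoundedSymbol_of_mem hδ0 hV
  have hdec : ∀ {V : Rn n → ℝ} {L : ℝ} {r : Rn n}, 0 ≤ L → V ∈ shortRangeWith n δ L →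
      inner ℝ r ω = v → ∀ t,
      ‖potL2 V (freeIso t (toL2 (boost ω r f)))‖ ≤ 32 * L * A * (1 + v * |t|) ^ (-δ) :=
    fun hL hV hr t => (norm_potL2_boost_le hv hr hω hδ0 hδ2 hV f t).trans
      (mul_le_mul_of_nonneg_right (mul_le_mul_of_nonneg_left hA (by positivity)) (by positivity))
  have hnorm : ∀ {r : Rn n}, inner ℝ r ω = v → ‖toL2 (boost ω r f)‖ ≤ 4 * A := fun hr =>
    (norm_toL2_boost_le hv hr f).trans (by linarith)
  set Φ := boost ω p f
  set Ψ := boost ω p' f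
  set G : ℝ → ℂ := fun t => inner ℂ (freeIso t (toL2 Ψ)) (potL2 (V₁ - V₂) (freeIso t (toL2 Φ)))
    with hG
  have hGc : Continuous G := (continuous_freeIso _).inner (continuous_potL2_freeIso b _)
  have hGint : ‖∫ t, G t‖ ≤ 16 * A ^ 2 * ‖scatteringOperator V₁ - scatteringOperator V₂‖
      + 2 * (32 * K * A * (v⁻¹ * ∫ t : ℝ, (1 + |t|) ^ (-δ))) ^ 2 := by
    have h := norm_inner_scatteringOperator_sub_sub_le hδ1 hv0 b₁ b₂
      (isWaveOperator_of_mem hn hδ1 hδ2 hV₁ (Or.inl rfl))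
      (isWaveOperator_of_mem hn hδ1 hδ2 hV₁ (Or.inr rfl))
      (isWaveOperator_of_mem hn hδ1 hδ2 hV₂ (Or.inl rfl))
      (isWaveOperator_of_mem hn hδ1 hδ2 hV₂ (Or.inr rfl))
      (hdec hK hV₁ hp) (hdec hK hV₂ hp) (hdec hK hV₁ hp') (hdec hK hV₂ hp')
    simp only [← potL2_sub b₁ b₂ b] at h
    refine h.trans (add_le_add ?_ le_rfl)
    calc _ ≤ ‖scatteringOperator V₁ - scatteringOperator V₂‖ * (4 * A) * (4 * A) :=
          mul_le_mul (mul_le_mul_of_nonneg_left (hnorm hp) (norm_nonneg _)) (hnorm hp')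
            (norm_nonneg _) (by positivity)
      _ = _ := by ring
  -- The difference of the potentials lies in the class with constant 2K, and 256 = 4 · 32 · 2.
  have hGb : ∀ t, ‖G t‖ ≤ 256 * K * A ^ 2 * (1 + v * |t|) ^ (-δ) := fun t => by
    refine (norm_inner_le_norm _ _).trans ?_
    rw [LinearIsometryEquiv.norm_map]
    calc _ ≤ 4 * A * (32 * (2 * K) * A * (1 + v * |t|) ^ (-δ)) :=
          mul_le_mul (hnorm hp') (hdec (by positivity) hV hp t) (norm_nonneg _) (by positivity)
      _ = _ := by ring
  have htrunc := norm_setIntegral_le_of_decay hδ1 hv0 hT hGc (by positivity) hGb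
  have hJi := integrableOn_movingIntegral hq hV.1.continuous R p p' (-(T / v)) (T / v)
  have hTv : 0 ≤ T / v := by positivity
  have hclose : ∀ t ∈ Set.Icc (-(T / v)) (T / v), ‖G t - movingIntegral (V₁ - V₂) R p p' t‖ ≤
      10 * K * A ^ 2 * (3 / v + T / v) := by
    intro t ht
    have htT : |t| ≤ T / v := abs_le.2 ht
    -- One phase serves both momenta because ‖p‖ = ‖p'‖, so it drops out of the inner product.
    set ph : ℂ := Complex.exp (((-(t * ‖p‖ ^ 2 / 2) : ℝ) : ℂ) * Complex.I) with hph
    have hphn : ‖ph‖ = 1 := Complex.norm_exp_ofReal_mul_I _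
    have happ : ∀ {r : Rn n}, inner ℝ r ω = v → ‖r‖ = ‖p‖ →
        ‖freeIso t (toL2 (boost ω r f)) - ph • toL2 (modS r (transS (t • r) f))‖ ≤
          A * (3 / v + T / v) := fun {r} hr hrp => by
      have h := norm_freeIso_boost_sub_le hv hr f t
      rw [hrp] at h
      refine h.trans ?_
      calc 3 * boostNorm ω f / v + |t| * ‖toL2 (kineticS f)‖ ≤ 3 * A / v + T / v * A := by gcongr
        _ = _ := by ring
    have hfA : ‖toL2 f‖ ≤ A := by
      refine le_trans ?_ hA
      unfold boostNorm
      linarith [norm_nonneg (toL2 (posS ω f)), norm_nonneg (toL2 (derS ω f)),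
        norm_nonneg (toL2 (derS ω (derS ω f))), norm_nonneg (toL2 (derS ω (derS ω (derS ω f)))),
        norm_nonneg (toL2 (posS ω (posS ω f))), norm_nonneg (toL2 (posS ω (derS ω f))),
        norm_nonneg (toL2 (posS ω (posS ω (derS ω f))))]
    have hJ : movingIntegral (V₁ - V₂) R p p' t =
        inner ℂ (ph • toL2 (modS p' (transS (t • p') f)))
          (potL2 (V₁ - V₂) (ph • toL2 (modS p (transS (t • p) f)))) := by
      have hsm : ∀ u, potL2 (V₁ - V₂) (ph • u) = ph • potL2 (V₁ - V₂) u := fun u =>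
        (mulOp b).map_smul ph u
      rw [hsm, inner_smul_left, inner_smul_right, ← mul_assoc, Complex.conj_mul', hphn, hf,
        inner_potL2_modS_transS b hR]
      simp
    rw [hJ]
    have h := norm_inner_potL2_sub_le b (a := 4 * A) (b := A) (by positivity) (happ hp' hpp.symm)
      (happ hp rfl) (by rw [LinearIsometryEquiv.norm_map]; exact hnorm hp)
      (by rw [norm_smul, hphn, one_mul, norm_toL2_modS, norm_toL2_transS]; exact hfA)
    exact h.trans_eq (by ring)
  have hdiff : ‖∫ t in Set.Icc (-(T / v)) (T / v), (G t - movingIntegral (V₁ - V₂) R p p' t)‖ ≤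
      20 * K * A ^ 2 * (T / v) * (3 / v + T / v) := by
    refine (norm_setIntegral_le_of_norm_le_const measure_Icc_lt_top hclose).trans_eq ?_
    rw [Real.volume_real_Icc_of_le (by linarith)]
    ring
  rw [integral_sub hGc.continuousOn.integrableOn_Icc hJi] at hdiff
  have htri := norm_le_norm_add_norm_sub (∫ t in Set.Icc (-(T / v)) (T / v), G t)
    (∫ t in Set.Icc (-(T / v)) (T / v), movingIntegral (V₁ - V₂) R p p' t)
  linarith

/-! ### Averages of moving bumps -/

section MovingBump

variable {L : ℝ}

theorem bump_eq_zero_of_lt_abs_inner {R : ℝ} (hR : 0 < R) {ω y : Rn n} (hω : ‖ω‖ = 1)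
    (h : R < |inner ℝ y ω|) : bump (R⁻¹ • y) = 0 := by
  refine bump_eq_zero ?_
  rw [norm_smul, Real.norm_of_nonneg (inv_nonneg.2 hR.le), le_inv_mul_iff₀ hR, mul_one]
  exact h.le.trans (abs_inner_le hω y)

/-- Translating a slowly varying moving bump by `x` changes it little, and only during the time
when one of the two bumps meets the support. -/
theorem abs_bump_sub_bump_le (hL : ∀ x y : Rn n, |bump x - bump y| ≤ L * ‖x - y‖)
    (hL0 : 0 ≤ L) {s R v t : ℝ} (hs0 : 0 < s) (hs1 : s < 1) (hR : 0 < R) (hv : 0 < v) {ω : Rn n} (hω : ‖ω‖ = 1) (x : Rn n) :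
    |bump (R⁻¹ • (x - t • v • ω)) - bump (R⁻¹ • (0 - t • v • ω))| ≤
      (1 + L) * (R ^ (-s) * bracket x ^ s) *
        ((Set.Icc (-(R / v)) (R / v)).indicator 1 t +
          (Set.Icc ((inner ℝ x ω - R) / v) ((inner ℝ x ω + R) / v)).indicator 1 t) := by
  have hi : ∀ y : Rn n, inner ℝ (y - t • v • ω) ω = inner ℝ y ω - t * v := fun y => by
    rw [inner_sub_left, inner_smul_left, inner_smul_left, real_inner_self_eq_norm_sq, hω]
    simp
  have hn1 : (0 : ℝ) ≤ (Set.Icc (-(R / v)) (R / v)).indicator 1 t :=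
    Set.indicator_nonneg (fun _ _ => zero_le_one) _
  have hn2 : (0 : ℝ) ≤ (Set.Icc ((inner ℝ x ω - R) / v) ((inner ℝ x ω + R) / v)).indicator 1 t :=
    Set.indicator_nonneg (fun _ _ => zero_le_one) _
  have hb := bracket_pos x
  have hfac : 0 ≤ (1 + L) * (R ^ (-s) * bracket x ^ s) := by positivity
  by_cases h1 : t ∈ Set.Icc (-(R / v)) (R / v) ∨
      t ∈ Set.Icc ((inner ℝ x ω - R) / v) ((inner ℝ x ω + R) / v)
  · have hone : (1 : ℝ) ≤ (Set.Icc (-(R / v)) (R / v)).indicator 1 t +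
        (Set.Icc ((inner ℝ x ω - R) / v) ((inner ℝ x ω + R) / v)).indicator 1 t := by
      rcases h1 with h | h
      · rw [Set.indicator_of_mem h, Pi.one_apply]
        linarith
      · rw [Set.indicator_of_mem (s := Set.Icc ((inner ℝ x ω - R) / v) _) h, Pi.one_apply]
        linarith
    refine le_trans ?_ (le_mul_of_one_le_right hfac hone)
    have hz : R ^ (-s) * bracket x ^ s = (bracket x / R) ^ s := by
      rw [Real.div_rpow hb.le hR.le, Real.rpow_neg hR.le]
      ring
    rw [hz]
    have hlip : |bump (R⁻¹ • (x - t • v • ω)) - bump (R⁻¹ • (0 - t • v • ω))| ≤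
        L * (bracket x / R) := by
      refine (hL _ _).trans (mul_le_mul_of_nonneg_left ?_ hL0)
      rw [← smul_sub, sub_sub_sub_cancel_right, sub_zero, norm_smul,
        Real.norm_of_nonneg (inv_nonneg.2 hR.le), inv_mul_eq_div]
      gcongr
      exact norm_le_bracket x
    have hle1 : |bump (R⁻¹ • (x - t • v • ω)) - bump (R⁻¹ • (0 - t • v • ω))| ≤ 1 := by
      rw [abs_le]
      constructor <;> linarith [bump_nonneg (R⁻¹ • (x - t • v • ω)), bump_le_one
        (R⁻¹ • (x - t • v • ω)), bump_nonneg (R⁻¹ • (0 - t • v • ω)), bump_le_one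
        (R⁻¹ • (0 - t • v • ω))]
    -- With z = ⟨x⟩/R the difference is at most min(1, Lz), hence at most (1 + L)z^s for 0 < s < 1.
    -- This is how the weight ⟨x⟩^s enters.
    rcases le_total 1 (bracket x / R) with h | h
    · exact hle1.trans ((Real.one_le_rpow h hs0.le).trans
        (le_mul_of_one_le_left (by positivity) (by linarith)))
    · refine hlip.trans ?_
      have : bracket x / R ≤ (bracket x / R) ^ s := by
        simpa using Real.rpow_le_rpow_of_exponent_ge (by positivity) h hs1.le
      exact mul_le_mul (by linarith) this (by positivity) (by linarith)
  -- Outside both time windows the component along ω of either argument exceeds R, and both bumps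
  -- vanish.
  · have h2 := not_or.1 h1
    have e1 : bump (R⁻¹ • (x - t • v • ω)) = 0 := by
      refine bump_eq_zero_of_lt_abs_inner hR hω ?_
      rw [hi]
      by_contra hcon
      rw [not_lt, abs_le] at hcon
      refine h2.2 ⟨?_, ?_⟩
      · rw [div_le_iff₀ hv]; linarith
      · rw [le_div_iff₀ hv]; linarith
    have e2 : bump (R⁻¹ • ((0 : Rn n) - t • v • ω)) = 0 := by
      refine bump_eq_zero_of_lt_abs_inner hR hω ?_
      rw [hi, inner_zero_left]
      by_contra hcon
      rw [not_lt, abs_le] at hcon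
      refine h2.1 ⟨?_, ?_⟩
      · rw [← neg_div, div_le_iff₀ hv]; linarith
      · rw [le_div_iff₀ hv]; linarith
    rw [e1, e2, sub_zero, abs_zero]
    exact mul_nonneg hfac (add_nonneg hn1 hn2)

theorem abs_mul_sub_sq_le {a b c : ℝ} (ha0 : 0 ≤ a) (ha : a ≤ 1) (hc0 : 0 ≤ c) (hc : c ≤ 1) :
    |a * b - c * c| ≤ |a - c| + |b - c| := by
  have h : a * b - c * c = c * (a - c) + a * (b - c) := by ring
  rw [h]
  refine (abs_add_le _ _).trans ?_
  rw [abs_mul, abs_mul, abs_of_nonneg ha0, abs_of_nonneg hc0]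
  exact add_le_add (mul_le_of_le_one_left (abs_nonneg _) hc) (mul_le_of_le_one_left (abs_nonneg _) ha)

theorem integral_indicator_one_Icc {a b : ℝ} (hab : a ≤ b) :
    ∫ t, (Set.Icc a b).indicator (1 : ℝ → ℝ) t = b - a := by
  rw [integral_indicator_one measurableSet_Icc, Real.volume_real_Icc_of_le hab]

theorem integrable_indicator_one_Icc (a b : ℝ) :
    Integrable ((Set.Icc a b).indicator (1 : ℝ → ℝ)) :=
  IntegrableOn.integrable_indicator (by rw [Pi.one_def]; exact integrableOn_const (by simp))
    measurableSet_Icc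

/-- Two errors are made: replacing p and p' by vω lets the bumps drift by at most κT/v, and
replacing x by 0 costs ⟨x⟩^s R^{-s}. The latter occurs only in time windows of total length 4R/v,
and not T/v, which keeps it small relative to the main term of order R/v. -/
theorem abs_setIntegral_bump_mul_bump_sub_le
    (hL : ∀ x y : Rn n, |bump x - bump y| ≤ L * ‖x - y‖)
    (hL0 : 0 ≤ L) {s R v T κ : ℝ} (hs0 : 0 < s) (hs1 : s < 1) (hR : 0 < R) (hv : 0 < v) (hT : 0 < T) {ω p p' : Rn n} (hω : ‖ω‖ = 1)
    (hp : ‖p - v • ω‖ ≤ κ) (hp' : ‖p' - v • ω‖ ≤ κ) (x : Rn n) :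
    |(∫ t in Set.Icc (-(T / v)) (T / v), bump (R⁻¹ • (x - t • p)) * bump (R⁻¹ • (x - t • p'))) -
      ∫ t in Set.Icc (-(T / v)) (T / v), bump (R⁻¹ • ((0 : Rn n) - t • v • ω)) *
        bump (R⁻¹ • ((0 : Rn n) - t • v • ω))| ≤
      8 * (1 + L) * (R ^ (-s) * bracket x ^ s) * (R / v) + 4 * L * (R⁻¹ * (T / v) * κ) * (T / v) := by
  have hTv : 0 < T / v := by positivity
  have hRv : 0 < R / v := by positivity
  have hb := bracket_pos x
  have hκ : 0 ≤ κ := (norm_nonneg _).trans hp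
  set E : ℝ := (1 + L) * (R ^ (-s) * bracket x ^ s) with hE
  have hE0 : 0 ≤ E := by positivity
  set χ : ℝ → ℝ := fun t => (Set.Icc (-(R / v)) (R / v)).indicator 1 t +
    (Set.Icc ((inner ℝ x ω - R) / v) ((inner ℝ x ω + R) / v)).indicator 1 t with hχ
  have hχi : Integrable χ := (integrable_indicator_one_Icc _ _).add (integrable_indicator_one_Icc _ _)
  have hχ0 : ∀ t, 0 ≤ χ t := fun t => add_nonneg
    (Set.indicator_nonneg (fun _ _ => zero_le_one) _) (Set.indicator_nonneg (fun _ _ => zero_le_one) _)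
  have hχI : ∫ t, χ t = 4 * (R / v) := by
    rw [hχ, integral_add (integrable_indicator_one_Icc _ _) (integrable_indicator_one_Icc _ _),
      integral_indicator_one_Icc (by linarith), integral_indicator_one_Icc (by gcongr; linarith)]
    ring
  have hc := continuous_bump (n := n)
  have i1 : IntegrableOn (fun t : ℝ => bump (R⁻¹ • (x - t • p)) * bump (R⁻¹ • (x - t • p')))
      (Set.Icc (-(T / v)) (T / v)) := by
    refine Continuous.integrableOn_Icc ?_
    fun_prop
  have i2 : IntegrableOn (fun t : ℝ => bump (R⁻¹ • ((0 : Rn n) - t • v • ω)) *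
      bump (R⁻¹ • ((0 : Rn n) - t • v • ω))) (Set.Icc (-(T / v)) (T / v)) := by
    refine Continuous.integrableOn_Icc ?_
    fun_prop
  have hpt : ∀ t ∈ Set.Icc (-(T / v)) (T / v), ∀ r : Rn n, ‖r - v • ω‖ ≤ κ →
      |bump (R⁻¹ • (x - t • r)) - bump (R⁻¹ • ((0 : Rn n) - t • v • ω))| ≤
        L * (R⁻¹ * (T / v) * κ) + E * χ t := by
    intro t ht r hr
    refine (abs_sub_le _ (bump (R⁻¹ • (x - t • v • ω))) _).trans (add_le_add ?_
      (abs_bump_sub_bump_le hL hL0 hs0 hs1 hR hv hω x))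
    refine (hL _ _).trans (mul_le_mul_of_nonneg_left ?_ hL0)
    rw [← smul_sub, sub_sub_sub_cancel_left, ← smul_sub, norm_smul, norm_smul,
      Real.norm_of_nonneg (inv_nonneg.2 hR.le), mul_assoc, norm_sub_rev]
    gcongr
    exact abs_le.2 ht
  rw [← integral_sub i1 i2, ← Real.norm_eq_abs]
  have hci : IntegrableOn (fun _ : ℝ => 2 * (L * (R⁻¹ * (T / v) * κ)))
      (Set.Icc (-(T / v)) (T / v)) := integrableOn_const (by simp)
  have hbd : IntegrableOn (fun t => 2 * (L * (R⁻¹ * (T / v) * κ)) + 2 * E * χ t)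
      (Set.Icc (-(T / v)) (T / v)) :=
    Integrable.add hci (hχi.const_mul _).integrableOn
  refine (norm_integral_le_of_norm_le hbd ?_).trans ?_
  · filter_upwards [ae_restrict_mem measurableSet_Icc] with t ht
    rw [Real.norm_eq_abs]
    refine (abs_mul_sub_sq_le (bump_nonneg _) (bump_le_one _) (bump_nonneg _)
      (bump_le_one _)).trans ?_
    linarith [hpt t ht p hp, hpt t ht p' hp']
  · rw [integral_add hci (hχi.const_mul _).integrableOn,
      setIntegral_const, Real.volume_real_Icc_of_le (by linarith), smul_eq_mul, integral_const_mul]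
    have h1 : ∫ t in Set.Icc (-(T / v)) (T / v), χ t ≤ 4 * (R / v) := by
      rw [← hχI]
      exact setIntegral_le_integral hχi (Eventually.of_forall hχ0)
    have h2 := mul_le_mul_of_nonneg_left h1 (by positivity : 0 ≤ 2 * E)
    rw [hE] at h2 ⊢
    linarith

/-- The bump is 1 within half its radius, that is while v|t| ≤ R/2: a time interval of length R/v.
-/
theorem le_setIntegral_bump_mul_bump {R v T : ℝ} (hR : 0 < R) (hv : 0 < v) (hTR : R ≤ T)
    {ω : Rn n} (hω : ‖ω‖ = 1) :
    R / v ≤ ∫ t in Set.Icc (-(T / v)) (T / v), bump (R⁻¹ • ((0 : Rn n) - t • v • ω)) *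
        bump (R⁻¹ • ((0 : Rn n) - t • v • ω)) := by
  have hc := continuous_bump (n := n)
  have i2 : IntegrableOn (fun t : ℝ => bump (R⁻¹ • ((0 : Rn n) - t • v • ω)) *
      bump (R⁻¹ • ((0 : Rn n) - t • v • ω))) (Set.Icc (-(T / v)) (T / v)) := by
    refine Continuous.integrableOn_Icc ?_
    fun_prop
  have hsub : Set.Icc (-(R / v / 2)) (R / v / 2) ⊆ Set.Icc (-(T / v)) (T / v) := by
    have : R / v / 2 ≤ T / v := by
      rw [div_div, div_le_div_iff₀ (by positivity) hv]
      nlinarith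
    exact Set.Icc_subset_Icc (by linarith) this
  have hRv : 0 < R / v := by positivity
  calc R / v = ∫ t in Set.Icc (-(R / v / 2)) (R / v / 2), (1 : ℝ) := by
        rw [setIntegral_const, Real.volume_real_Icc_of_le (by linarith), smul_eq_mul]
        ring
    _ = ∫ t in Set.Icc (-(R / v / 2)) (R / v / 2), bump (R⁻¹ • ((0 : Rn n) - t • v • ω)) *
        bump (R⁻¹ • ((0 : Rn n) - t • v • ω)) := by
        refine setIntegral_congr_fun measurableSet_Icc fun t ht => ?_
        have h1 : |t| ≤ R / v / 2 := abs_le.2 ht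
        have : bump (R⁻¹ • ((0 : Rn n) - t • v • ω)) = 1 := by
          refine bump_eq_one ?_
          rw [zero_sub, norm_smul, norm_neg, norm_smul, norm_smul, hω, mul_one,
            Real.norm_of_nonneg (inv_nonneg.2 hR.le), Real.norm_of_nonneg hv.le, Real.norm_eq_abs,
            inv_mul_le_iff₀ hR]
          calc |t| * v ≤ R / v / 2 * v := by gcongr
            _ = R * (1 / 2) := by field_simp
        simp only [this, mul_one]
    _ ≤ _ := setIntegral_mono_set i2 (Eventually.of_forall fun t =>
        mul_nonneg (bump_nonneg _) (bump_nonneg _)) hsub.eventuallyLE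

end MovingBump

/-- The Fourier transform of `q` is recovered from the moving bumps. -/
theorem mul_norm_integral_exp_le {q : Rn n → ℝ} (hqc : Continuous q) {s M L R v T : ℝ}
    (hs0 : 0 < s) (hs1 : s < 1)
    (hq : Integrable fun x => bracket x ^ s * |q x|) (hM : ∫ x, bracket x ^ s * |q x| ≤ M)
    (hL0 : 0 ≤ L) (hL : ∀ x y : Rn n, |bump x - bump y| ≤ L * ‖x - y‖) (hR : 0 < R) (hv : 0 < v)
    (hTR : R ≤ T) {ω k : Rn n} (hω : ‖ω‖ = 1) :
    R * ‖∫ x, (q x : ℂ) * Complex.exp (((inner ℝ x k : ℝ) : ℂ) * Complex.I)‖ ≤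
      v * ‖∫ t in Set.Icc (-(T / v)) (T / v),
          movingIntegral q R (v • ω + (2 : ℝ)⁻¹ • k) (v • ω - (2 : ℝ)⁻¹ • k) t‖
        + M * (8 * (1 + L) * (R ^ (-s) * R) + 2 * L * (R⁻¹ * T * ‖k‖) * (T / v)) := by
  have hT : 0 < T := hR.trans_le hTR
  set p := v • ω + (2 : ℝ)⁻¹ • k with hp
  set p' := v • ω - (2 : ℝ)⁻¹ • k with hp'
  have hpp : p - p' = k := by
    rw [hp, hp', add_sub_sub_cancel, ← add_smul]
    norm_num
  have hpκ : ‖p - v • ω‖ ≤ ‖k‖ / 2 := by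
    rw [hp, add_sub_cancel_left, norm_smul, Real.norm_of_nonneg (by norm_num)]
    linarith
  have hpκ' : ‖p' - v • ω‖ ≤ ‖k‖ / 2 := by
    rw [hp', sub_sub_cancel_left, norm_neg, norm_smul, Real.norm_of_nonneg (by norm_num)]
    linarith
  have hb1 : ∀ x : Rn n, 1 ≤ bracket x ^ s := fun x => Real.one_le_rpow (one_le_bracket x) hs0.le
  have hle : ∀ x, |q x| ≤ bracket x ^ s * |q x| := fun x =>
    le_mul_of_one_le_left (abs_nonneg _) (hb1 x)
  have hqi : Integrable q := hq.mono' hqc.aestronglyMeasurable (Eventually.of_forall hle)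
  set Γ : Rn n → ℝ := fun x => ∫ t in Set.Icc (-(T / v)) (T / v),
    bump (R⁻¹ • (x - t • p)) * bump (R⁻¹ • (x - t • p')) with hΓ
  set c : ℝ := ∫ t in Set.Icc (-(T / v)) (T / v), bump (R⁻¹ • ((0 : Rn n) - t • v • ω)) *
        bump (R⁻¹ • ((0 : Rn n) - t • v • ω)) with hc
  have hcR : R / v ≤ c := le_setIntegral_bump_mul_bump hR hv hTR hω
  have hRv : 0 < R / v := by positivity
  have hmov := setIntegral_movingIntegral hqi hqc R p p' (-(T / v)) (T / v)
  simp only [hpp] at hmov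
  have hmi := (integrable_movingIntegrand hqi hqc R p p' (-(T / v)) (T / v)).integral_prod_right
  set e : Rn n → ℂ := fun x => (q x : ℂ) * Complex.exp (((inner ℝ x k : ℝ) : ℂ) * Complex.I) with he
  have hen : ∀ x, ‖e x‖ = |q x| := fun x => by
    rw [he, norm_mul, Complex.norm_exp_ofReal_mul_I, mul_one, Complex.norm_real, Real.norm_eq_abs]
  have hei : Integrable e := hqi.norm.mono' (by
    refine Continuous.aestronglyMeasurable ?_
    fun_prop) (Eventually.of_forall fun x => (hen x).le)
  have heΓi : Integrable fun x => e x * (Γ x : ℂ) := by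
    refine hmi.congr (Eventually.of_forall fun x => ?_)
    simp only [hpp]
    rw [integral_const_mul]
    exact congrArg _ integral_ofReal
  -- By Fubini the moving integral is q(x)e^{ix·k} integrated against the time average Γ. Freezing Γ
  -- at the constant c isolates the Fourier transform; the error Γ - c grows at most like ⟨x⟩^s, so
  -- it is integrable against q.
  have hid : (c : ℂ) * ∫ x, e x = (∫ t in Set.Icc (-(T / v)) (T / v), movingIntegral q R p p' t) -
      ∫ x, e x * ((Γ x - c : ℝ) : ℂ) := by
    rw [hmov, ← integral_sub heΓi ?_, ← integral_const_mul]
    · refine integral_congr_ae (Eventually.of_forall fun x => ?_)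
      simp only [Complex.ofReal_sub]
      ring
    · simp only [Complex.ofReal_sub, mul_sub]
      exact heΓi.sub (hei.mul_const _)
  have herr : ‖∫ x, e x * ((Γ x - c : ℝ) : ℂ)‖ ≤
      (8 * (1 + L) * (R ^ (-s) * R) + 2 * L * (R⁻¹ * T * ‖k‖) * (T / v)) / v * M := by
    set B : ℝ := (8 * (1 + L) * (R ^ (-s) * R) + 2 * L * (R⁻¹ * T * ‖k‖) * (T / v)) / v with hB
    have hB0 : 0 ≤ B := by positivity
    refine (norm_integral_le_of_norm_le (hq.const_mul B) (Eventually.of_forall fun x => ?_)).trans ?_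
    · rw [norm_mul, hen, Complex.norm_real, Real.norm_eq_abs]
      have h := abs_setIntegral_bump_mul_bump_sub_le hL hL0 hs0 hs1 hR hv hT hω hpκ hpκ' x
      have h2 : |Γ x - c| ≤ B * bracket x ^ s := by
        refine h.trans ?_
        have h3 : 4 * L * (R⁻¹ * (T / v) * (‖k‖ / 2)) * (T / v) ≤
            4 * L * (R⁻¹ * (T / v) * (‖k‖ / 2)) * (T / v) * bracket x ^ s :=
          le_mul_of_one_le_right (by positivity) (hb1 x)
        refine (add_le_add le_rfl h3).trans_eq ?_
        rw [hB]
        field_simp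
        ring
      calc |q x| * |Γ x - c| ≤ |q x| * (B * bracket x ^ s) :=
            mul_le_mul_of_nonneg_left h2 (abs_nonneg _)
        _ = _ := by ring
    · rw [integral_const_mul]
      exact mul_le_mul_of_nonneg_left hM hB0
  have hmain : R / v * ‖∫ x, e x‖ ≤
      ‖∫ t in Set.Icc (-(T / v)) (T / v), movingIntegral q R p p' t‖ +
      (8 * (1 + L) * (R ^ (-s) * R) + 2 * L * (R⁻¹ * T * ‖k‖) * (T / v)) / v * M := by
    calc R / v * ‖∫ x, e x‖ ≤ c * ‖∫ x, e x‖ := mul_le_mul_of_nonneg_right hcR (norm_nonneg _)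
      _ = ‖(c : ℂ) * ∫ x, e x‖ := by
        rw [norm_mul, Complex.norm_real, Real.norm_of_nonneg (hRv.le.trans hcR)]
      _ ≤ _ := by
        rw [hid]
        exact (norm_sub_le _ _).trans (add_le_add le_rfl herr)
  have h := mul_le_mul_of_nonneg_left hmain hv.le
  calc R * ‖∫ x, e x‖ = v * (R / v * ‖∫ x, e x‖) := by field_simp
    _ ≤ _ := h
    _ = _ := by field_simp

/-! ### Decay of the Fourier transform of the difference of two potentials -/

/-- The essential use of n ≥ 2. With ω ⟂ k the momenta vω ± k/2 have equal length and the same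
component v along ω. -/
theorem exists_norm_eq_one_inner_eq_zero (hn : 2 ≤ n) (k : Rn n) :
    ∃ ω : Rn n, ‖ω‖ = 1 ∧ inner ℝ k ω = 0 := by
  have hne : (Submodule.span ℝ {k})ᗮ ≠ ⊥ := fun h => by
    rw [Submodule.orthogonal_eq_bot_iff] at h
    have h1 := finrank_span_le_card (R := ℝ) ({k} : Set (Rn n))
    rw [h, finrank_top, finrank_euclideanSpace, Fintype.card_fin, Set.toFinset_singleton,
      Finset.card_singleton] at h1
    omega
  obtain ⟨y, hy, hy0⟩ := Submodule.exists_mem_ne_zero_of_ne_bot hne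
  refine ⟨‖y‖⁻¹ • y, by rw [norm_smul, norm_inv, norm_norm, inv_mul_cancel₀ (norm_ne_zero_iff.2 hy0)], ?_⟩
  rw [inner_smul_right, (Submodule.mem_orthogonal_singleton_iff_inner_right.1 hy), mul_zero]

/-- Bookkeeping, with U = T^{-(δ-1)/2}, Y = R^{-s}, P = R^{2n+4}, B = C₀R^{n+2}, k₀ = ‖k‖ and Q the
modulus of the Fourier integral. Division by R is needed only for the term with Y; elsewhere R ≥ 1
lets it be discarded. -/
theorem le_of_parameter_bound {K M L C₀ c₁ c₂ R T v ε U Y P Q B k₀ : ℝ} (hK : 0 ≤ K) (hM : 0 ≤ M)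
    (hL0 : 0 ≤ L) (hc₂0 : 0 ≤ c₂) (hR : 1 ≤ R) (hT1 : 1 ≤ T) (hv0 : 0 < v) (hε0 : 0 ≤ ε)
    (hU0 : 0 ≤ U) (hY0 : 0 ≤ Y) (hk0 : 0 ≤ k₀) (hP1 : 1 ≤ P) (hPA : B ^ 2 = C₀ ^ 2 * P)
    (h3 : R * Q ≤ v * (16 * B ^ 2 * ε + 2 * (32 * K * B * (v⁻¹ * c₁)) ^ 2
      + 256 * K * B ^ 2 * (U * (v⁻¹ * c₂)) + 20 * K * B ^ 2 * (T / v) * (3 / v + T / v))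
      + M * (8 * (1 + L) * (Y * R) + 2 * L * (R⁻¹ * T * k₀) * (T / v))) :
    Q ≤ (16 * C₀ ^ 2 + 256 * K * C₀ ^ 2 * c₂ + 2048 * K ^ 2 * C₀ ^ 2 * c₁ ^ 2 + 80 * K * C₀ ^ 2
      + 8 * M * (1 + L) + 2 * M * L) * (1 + k₀) * (P * (ε * v + U + T ^ 2 / v) + Y) := by
  have hR0 : 0 < R := by linarith
  have hT0 : 0 < T := by linarith
  obtain ⟨a₁, ha₁⟩ : ∃ a, a = 16 * C₀ ^ 2 := ⟨_, rfl⟩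
  obtain ⟨a₂, ha₂⟩ : ∃ a, a = 256 * K * C₀ ^ 2 * c₂ := ⟨_, rfl⟩
  obtain ⟨a₃, ha₃⟩ : ∃ a, a = 2048 * K ^ 2 * C₀ ^ 2 * c₁ ^ 2 := ⟨_, rfl⟩
  obtain ⟨a₄, ha₄⟩ : ∃ a, a = 80 * K * C₀ ^ 2 := ⟨_, rfl⟩
  obtain ⟨a₅, ha₅⟩ : ∃ a, a = 8 * M * (1 + L) := ⟨_, rfl⟩
  obtain ⟨a₆, ha₆⟩ : ∃ a, a = 2 * M * L := ⟨_, rfl⟩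
  have ha₁0 : 0 ≤ a₁ := by rw [ha₁]; positivity
  have ha₂0 : 0 ≤ a₂ := by rw [ha₂]; positivity
  have ha₃0 : 0 ≤ a₃ := by rw [ha₃]; positivity
  have ha₄0 : 0 ≤ a₄ := by rw [ha₄]; positivity
  have ha₅0 : 0 ≤ a₅ := by rw [ha₅]; positivity
  have ha₆0 : 0 ≤ a₆ := by rw [ha₆]; positivity
  rw [← ha₁, ← ha₂, ← ha₃, ← ha₄, ← ha₅, ← ha₆]
  have hX0 : 0 ≤ P * (ε * v) := by positivity
  have hZ0 : 0 ≤ P * (T ^ 2 / v) := by positivity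
  have hW0 : 0 ≤ P * U := by positivity
  have t1 : v * (16 * B ^ 2 * ε) = a₁ * (P * (ε * v)) := by
    rw [hPA, ha₁]; ring
  have t2 : v * (2 * (32 * K * B * (v⁻¹ * c₁)) ^ 2) ≤ a₃ * (P * (T ^ 2 / v)) := by
    have : v * (2 * (32 * K * B * (v⁻¹ * c₁)) ^ 2) = a₃ * (P * (1 / v)) := by
      have : v * (2 * (32 * K * B * (v⁻¹ * c₁)) ^ 2) =
        2048 * K ^ 2 * B ^ 2 * c₁ ^ 2 * (v * v⁻¹ * v⁻¹) := by ring
      rw [this, hPA, ha₃, mul_inv_cancel₀ hv0.ne']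
      ring
    rw [this]
    have hT2 : 1 ≤ T ^ 2 := one_le_pow₀ hT1
    gcongr
  have t3 : v * (256 * K * B ^ 2 * (U * (v⁻¹ * c₂))) = a₂ * (P * U) := by
    rw [hPA, ha₂]
    field_simp
  have t4 : v * (20 * K * B ^ 2 * (T / v) * (3 / v + T / v)) ≤
      a₄ * (P * (T ^ 2 / v)) := by
    have : v * (20 * K * B ^ 2 * (T / v) * (3 / v + T / v)) =
        20 * K * C₀ ^ 2 * (P * ((T * (3 + T)) / v)) := by
      rw [hPA]
      field_simp
    rw [this]
    have : 20 * K * C₀ ^ 2 * (P * ((T * (3 + T)) / v)) ≤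
        20 * K * C₀ ^ 2 * (P * ((4 * T ^ 2) / v)) := by
      have hT4 : T * (3 + T) ≤ 4 * T ^ 2 := by nlinarith
      gcongr
    refine this.trans_eq ?_
    rw [ha₄]
    ring
  have t5 : M * (8 * (1 + L) * (Y * R) + 2 * L * (R⁻¹ * T * k₀) * (T / v)) ≤
      a₅ * (Y * R) + a₆ * k₀ * (P * (T ^ 2 / v)) := by
    have : M * (8 * (1 + L) * (Y * R) + 2 * L * (R⁻¹ * T * k₀) * (T / v)) =
        a₅ * (Y * R) + a₆ * k₀ * (R⁻¹ * (T ^ 2 / v)) := by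
      rw [ha₅, ha₆]
      ring
    rw [this]
    have : R⁻¹ ≤ P := (inv_le_one_of_one_le₀ hR).trans hP1
    gcongr
  have h4 : R * Q ≤ a₁ * (P * (ε * v)) + a₂ * (P * U) + a₃ * (P * (T ^ 2 / v)) +
      a₄ * (P * (T ^ 2 / v)) + a₅ * (Y * R) + a₆ * k₀ * (P * (T ^ 2 / v)) := by
    simp only [mul_add v] at h3
    linarith
  obtain ⟨S, hS⟩ : ∃ a, a = P * (ε * v + U + T ^ 2 / v) + Y := ⟨_, rfl⟩
  have hSe : S = P * (ε * v) + P * U + P * (T ^ 2 / v) + Y := by rw [hS]; ring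
  rw [← hS]
  have hS0 : 0 ≤ S := by rw [hSe]; positivity
  have hSR : S ≤ S * R := le_mul_of_one_le_right hS0 hR
  have b1 : P * (ε * v) ≤ S * R := by linarith
  have b2 : P * U ≤ S * R := by linarith
  have b3 : P * (T ^ 2 / v) ≤ S * R := by linarith
  have b4 : Y * R ≤ S * R := mul_le_mul_of_nonneg_right (by linarith) hR0.le
  have h5 : R * Q ≤ R * ((a₁ + a₂ + a₃ + a₄ + a₅ + a₆) * (1 + k₀) * S) := by
    have e1 := mul_le_mul_of_nonneg_left b1 ha₁0
    have e2 := mul_le_mul_of_nonneg_left b2 ha₂0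
    have e3 := mul_le_mul_of_nonneg_left b3 ha₃0
    have e4 := mul_le_mul_of_nonneg_left b3 ha₄0
    have e5 := mul_le_mul_of_nonneg_left b4 ha₅0
    have e6 := mul_le_mul_of_nonneg_left b3 (mul_nonneg ha₆0 hk0)
    have e7 : 0 ≤ (a₁ + a₂ + a₃ + a₄ + a₅) * k₀ * (S * R) + a₆ * (S * R) := by positivity
    linarith
  exact le_of_mul_le_mul_left h5 hR0

/-- The stability estimate for the Fourier transform, with free parameters. -/
theorem exists_norm_integral_exp_le (hn : 2 ≤ n) {δ s M K : ℝ} (hδ1 : 1 < δ) (hδ2 : δ ≤ 2)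
    (hs0 : 0 < s) (hs1 : s < 1) (hM : 0 ≤ M) (hK : 0 ≤ K) :
    ∃ C : ℝ, 0 ≤ C ∧ ∀ V₁ ∈ shortRangeWith n δ K, ∀ V₂ ∈ shortRangeWith n δ K,
      Integrable (fun x => bracket x ^ s * |(V₁ - V₂) x|) →
      ∫ x, bracket x ^ s * |(V₁ - V₂) x| ≤ M → ∀ (R T v : ℝ) (k : Rn n), 1 ≤ R → R ≤ T → 1 ≤ v →
      ‖∫ x, ((V₁ - V₂) x : ℂ) * Complex.exp (((inner ℝ x k : ℝ) : ℂ) * Complex.I)‖ ≤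
        C * (1 + ‖k‖) * (R ^ (2 * n + 4) *
          (‖scatteringOperator V₁ - scatteringOperator V₂‖ * v + T ^ (-((δ - 1) / 2)) + T ^ 2 / v)
          + R ^ (-s)) := by
  obtain ⟨C₀, hC₀, hB⟩ := exists_boostNorm_bumpS_le n
  obtain ⟨L, hL0, hL⟩ := exists_lipschitz_bump (n := n)
  set c₁ := ∫ t : ℝ, (1 + |t|) ^ (-δ) with hc₁
  set c₂ := ∫ t : ℝ, (1 + |t|) ^ (-((δ + 1) / 2)) with hc₂
  have hc₁0 : 0 ≤ c₁ := integral_nonneg fun t => by positivity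
  have hc₂0 : 0 ≤ c₂ := integral_nonneg fun t => by positivity
  refine ⟨16 * C₀ ^ 2 + 256 * K * C₀ ^ 2 * c₂ + 2048 * K ^ 2 * C₀ ^ 2 * c₁ ^ 2 + 80 * K * C₀ ^ 2
    + 8 * M * (1 + L) + 2 * M * L, by positivity, ?_⟩
  intro V₁ hV₁ V₂ hV₂ hqi hqM R T v k hR hTR hv
  set ε := ‖scatteringOperator V₁ - scatteringOperator V₂‖ with hε
  have hR0 : 0 < R := by linarith
  have hv0 : 0 < v := by linarith
  have hT1 : 1 ≤ T := hR.trans hTR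
  have hT0 : 0 < T := by linarith
  obtain ⟨ω, hω, hkω⟩ := exists_norm_eq_one_inner_eq_zero hn k
  obtain ⟨hA, hA'⟩ := hB R hR0.ne' ω hR hω
  have hωω : inner ℝ ω ω = (1 : ℝ) := by rw [real_inner_self_eq_norm_sq, hω, one_pow]
  have hp : inner ℝ (v • ω + (2 : ℝ)⁻¹ • k) ω = v := by
    rw [inner_add_left, inner_smul_left, inner_smul_left, hωω, hkω]
    simp
  have hp' : inner ℝ (v • ω - (2 : ℝ)⁻¹ • k) ω = v := by
    rw [inner_sub_left, inner_smul_left, inner_smul_left, hωω, hkω]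
    simp
  have hpp : ‖v • ω + (2 : ℝ)⁻¹ • k‖ = ‖v • ω - (2 : ℝ)⁻¹ • k‖ := by
    rw [← sq_eq_sq₀ (norm_nonneg _) (norm_nonneg _), norm_add_sq_real, norm_sub_sq_real,
      inner_smul_left, inner_smul_right, real_inner_comm, hkω]
    simp
  have hV := sub_mem_shortRangeWith hV₁ hV₂
  have hqint : Integrable (V₁ - V₂) := hqi.mono' hV.1.continuous.aestronglyMeasurable
    (Eventually.of_forall fun x => le_mul_of_one_le_left (abs_nonneg _)
      (Real.one_le_rpow (one_le_bracket x) hs0.le))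
  have h1 := norm_setIntegral_movingIntegral_le (by omega) hδ1 hδ2 hV₁ hV₂ hqint hR0.ne' hω hv hp hp'
    hpp hT0 hA hA'
  have h2 := mul_norm_integral_exp_le hV.1.continuous hs0 hs1 hqi hqM hL0 hL hR0 hv0 hTR hω (k := k)
  refine le_of_parameter_bound hK hM hL0 hc₂0 hR hT1 hv0 (norm_nonneg _) (by positivity)
    (by positivity) (norm_nonneg _) (one_le_pow₀ hR) (B := C₀ * R ^ (n + 2)) ?_
    (h2.trans (add_le_add (mul_le_mul_of_nonneg_left h1 hv0.le) le_rfl))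
  rw [mul_pow, ← pow_mul]
  ring_nf

/-- The stability estimate for the Fourier transform, with parameters chosen in terms of the
size of the difference of the scattering operators. -/
theorem exists_norm_integral_exp_le_rpow (hn : 2 ≤ n) {δ s M K : ℝ} (hδ1 : 1 < δ) (hδ2 : δ ≤ 2)
    (hs0 : 0 < s) (hs1 : s < 1) (hM : 0 ≤ M) (hK : 0 ≤ K) {b : ℝ}
    (hb : b = 4 * (2 * n + 4 + s) / (δ - 1) + (2 * n + 4 + s)) :
    ∃ C : ℝ, 0 ≤ C ∧ ∀ V₁ ∈ shortRangeWith n δ K, ∀ V₂ ∈ shortRangeWith n δ K,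
      Integrable (fun x => bracket x ^ s * |(V₁ - V₂) x|) →
      ∫ x, bracket x ^ s * |(V₁ - V₂) x| ≤ M → ∀ l : ℝ, 1 ≤ l →
      ‖scatteringOperator V₁ - scatteringOperator V₂‖ ≤ l ^ (-(2 * b)) → ∀ k : Rn n,
      ‖∫ x, ((V₁ - V₂) x : ℂ) * Complex.exp (((inner ℝ x k : ℝ) : ℂ) * Complex.I)‖ ≤
        C * (1 + ‖k‖) * l ^ (-s) := by
  obtain ⟨C, hC, h⟩ := exists_norm_integral_exp_le hn hδ1 hδ2 hs0 hs1 hM hK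
  refine ⟨4 * C, by positivity, ?_⟩
  intro V₁ hV₁ V₂ hV₂ hqi hqM l hl hε k
  set ε := ‖scatteringOperator V₁ - scatteringOperator V₂‖ with hεd
  have hl0 : 0 < l := by linarith
  -- With R = l, each bracketed term must be at most l^{-m} in order to beat R^{2n+4} = l^{m-s}. T =
  -- l^a with a = 2m/(δ-1) gives T^{-(δ-1)/2} = l^{-m}; v = l^b with b = 2a + m gives T²/v = l^{-m};
  -- and ε ≤ l^{-2b} gives εv ≤ l^{-b} ≤ l^{-m}.
  set m : ℝ := 2 * n + 4 + s with hm
  have hm0 : 1 ≤ m := by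
    have : (0 : ℝ) ≤ n := Nat.cast_nonneg n
    rw [hm]; linarith
  have hδ' : 0 < δ - 1 := by linarith
  set a : ℝ := 2 * m / (δ - 1) with ha
  have ha1 : 1 ≤ a := by
    rw [ha, le_div_iff₀ hδ']
    linarith
  have hba : b = 2 * a + m := by rw [hb, ha]; ring
  have hla : l ≤ l ^ a := by simpa using Real.rpow_le_rpow_of_exponent_le hl ha1
  have hlb : 1 ≤ l ^ b := Real.one_le_rpow hl (by linarith)
  have hP : l ^ (2 * n + 4) = l ^ (m - s) := by
    rw [← Real.rpow_natCast, hm]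
    push_cast
    ring_nf
  refine (h V₁ hV₁ V₂ hV₂ hqi hqM l (l ^ a) (l ^ b) k hl hla hlb).trans ?_
  rw [← hεd, hP]
  have e1 : l ^ (m - s) * (ε * l ^ b) ≤ l ^ (-s) := by
    calc l ^ (m - s) * (ε * l ^ b) ≤ l ^ (m - s) * (l ^ (-(2 * b)) * l ^ b) := by gcongr
      _ = l ^ (-s + -(2 * a)) := by
        rw [← Real.rpow_add hl0, ← Real.rpow_add hl0, hba]
        ring_nf
      _ ≤ l ^ (-s) := Real.rpow_le_rpow_of_exponent_le hl (by linarith)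
  have e2 : l ^ (m - s) * (l ^ a) ^ (-((δ - 1) / 2)) = l ^ (-s) := by
    rw [← Real.rpow_mul hl0.le, ← Real.rpow_add hl0]
    congr 1
    rw [ha]
    field_simp
    ring
  have e3 : l ^ (m - s) * ((l ^ a) ^ 2 / l ^ b) = l ^ (-s) := by
    rw [← Real.rpow_natCast (l ^ a), ← Real.rpow_mul hl0.le, ← Real.rpow_sub hl0,
      ← Real.rpow_add hl0, hba]
    congr 1
    push_cast
    ring
  rw [mul_add (l ^ (m - s)), mul_add (l ^ (m - s)), e2, e3]
  have hk := norm_nonneg k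
  calc C * (1 + ‖k‖) * (l ^ (m - s) * (ε * l ^ b) + l ^ (-s) + l ^ (-s) + l ^ (-s)) ≤
        C * (1 + ‖k‖) * (l ^ (-s) + l ^ (-s) + l ^ (-s) + l ^ (-s)) := by gcongr
    _ = _ := by ring

/-! ### Plancherel's theorem and the Sobolev norm -/

theorem continuous_fourier {f : Rn n → ℂ} (hf : Integrable f) : Continuous (𝓕 f) :=
  VectorFourier.fourierIntegral_continuous Real.continuous_fourierChar
    (by exact continuous_inner) hf

theorem integral_mul_fourier {f : Rn n → ℂ} (hf : Integrable f) (g : 𝓢(Rn n, ℂ)) :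
    ∫ ξ, g ξ * 𝓕 f ξ = ∫ x, (𝓕 g) x * f x := by
  have h := VectorFourier.integral_fourierIntegral_smul_eq_flip (μ := (volume : Measure (Rn n)))
    (ν := volume) (L := innerₗ (Rn n)) Real.continuous_fourierChar (by exact continuous_inner)
    hf g.integrable
  rw [flip_innerₗ] at h
  simp only [smul_eq_mul] at h
  calc ∫ ξ, g ξ * 𝓕 f ξ = ∫ ξ, 𝓕 f ξ * g ξ := by simp only [mul_comm]
    _ = ∫ x, f x * (𝓕 (g : Rn n → ℂ)) x := h
    _ = _ := by simp only [mul_comm, SchwartzMap.fourier_coe]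

/-- The Fourier transform on `L¹ ∩ L²` agrees with the one on `L²`. -/
theorem coeFn_fourier_toLp {f : Rn n → ℂ} (hf : Integrable f) (hf2 : MemLp f 2) :
    ((𝓕 (hf2.toLp f) : L2 n) : Rn n → ℂ) =ᵐ[volume] 𝓕 f := by
  refine ae_eq_of_integral_contDiff_smul_eq ((Lp.memLp _).locallyIntegrable (by norm_num))
    (continuous_fourier hf).locallyIntegrable fun φ hφ hφc => ?_
  have hg₁ : HasCompactSupport (Complex.ofRealCLM ∘ φ) := hφc.comp_left rfl
  have hg₂ : ContDiff ℝ (⊤ : ℕ∞) (Complex.ofRealCLM ∘ φ) := Complex.ofRealCLM.contDiff.comp hφ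
  set G : 𝓢(Rn n, ℂ) := hg₁.toSchwartzMap hg₂ with hG
  have hGx : ∀ x, G x = φ x := fun x => rfl
  have h := congrArg (fun u : 𝓢'(Rn n, ℂ) => u G)
    (Lp.fourier_toTemperedDistribution_eq (hf2.toLp f))
  simp only [TemperedDistribution.fourier_apply, Lp.toTemperedDistribution_apply, smul_eq_mul] at h
  calc ∫ x, φ x • (𝓕 (hf2.toLp f) : L2 n) x = ∫ x, G x * (𝓕 (hf2.toLp f) : L2 n) x := by
        simp only [hGx, Complex.real_smul]
    _ = ∫ x, (𝓕 G) x * (hf2.toLp f) x := h.symm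
    _ = ∫ x, (𝓕 G) x * f x := integral_congr_ae (hf2.coeFn_toLp.mono fun x hx => by
        simp only [hx])
    _ = ∫ x, G x * 𝓕 f x := (integral_mul_fourier hf G).symm
    _ = ∫ x, φ x • 𝓕 f x := by simp only [hGx, Complex.real_smul]

/-- Plancherel's theorem on `L¹ ∩ L²`. -/
theorem eLpNorm_fourier {f : Rn n → ℂ} (hf : Integrable f) (hf2 : MemLp f 2) :
    eLpNorm (𝓕 f) 2 volume = eLpNorm f 2 volume := by
  rw [← eLpNorm_congr_ae (coeFn_fourier_toLp hf hf2), ← eLpNorm_congr_ae hf2.coeFn_toLp,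
    ← Lp.enorm_def, ← Lp.enorm_def, ← ofReal_norm, ← ofReal_norm, Lp.norm_fourier_eq]

theorem fourierHat_eq (q : Rn n → ℝ) (ξ : Rn n) :
    fourierHat q ξ = (((2 * Real.pi) ^ (-(n : ℝ) / 2) : ℝ) : ℂ) *
      𝓕 (fun x => (q x : ℂ)) ((2 * Real.pi)⁻¹ • ξ) := by
  rw [fourierHat, Real.fourier_eq']
  congr 1
  refine integral_congr_ae (Eventually.of_forall fun x => ?_)
  simp only [smul_eq_mul]
  congr 2
  rw [inner_smul_right]
  push_cast
  have : (Real.pi : ℂ) ≠ 0 := Complex.ofReal_ne_zero.2 Real.pi_ne_zero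
  field_simp

theorem norm_fourierHat (q : Rn n → ℝ) (ξ : Rn n) :
    ‖fourierHat q ξ‖ = (2 * Real.pi) ^ (-(n : ℝ) / 2) *
      ‖∫ x, (q x : ℂ) * Complex.exp (((inner ℝ x (-ξ) : ℝ) : ℂ) * Complex.I)‖ := by
  rw [fourierHat, norm_mul, Complex.norm_real, Real.norm_of_nonneg (by positivity)]
  congr 2
  refine integral_congr_ae (Eventually.of_forall fun x => ?_)
  simp only [inner_neg_right, Complex.ofReal_neg]
  rw [mul_comm, neg_mul, mul_comm Complex.I]

/-- Plancherel in the angular-frequency normalisation: the factor (2π)^{-n/2} cancels the square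
root of the Jacobian (2π)^n of the frequency dilation. -/
theorem eLpNorm_fourierHat {q : Rn n → ℝ} (hq : Integrable q) (hq2 : MemLp q 2) :
    eLpNorm (fourierHat q) 2 volume = eLpNorm q 2 volume := by
  have hpi : 0 < 2 * Real.pi := by positivity
  have hc : Integrable fun x => (q x : ℂ) := hq.ofReal
  have hc2 : MemLp (fun x => (q x : ℂ)) 2 := hq2.ofReal
  have hfun : fourierHat q = (((2 * Real.pi) ^ (-(n : ℝ) / 2) : ℝ) : ℂ) •
      ((𝓕 fun x => (q x : ℂ)) ∘ fun ξ => (2 * Real.pi)⁻¹ • ξ) := funext fun ξ => fourierHat_eq q ξ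
  have hmap := Measure.map_addHaar_smul (volume : Measure (Rn n)) (inv_ne_zero hpi.ne')
  have hq' : eLpNorm (fun x => (q x : ℂ)) 2 volume = eLpNorm q 2 volume :=
    eLpNorm_congr_norm_ae (Eventually.of_forall fun x => Complex.norm_real _)
  rw [hfun, eLpNorm_const_smul,
    ← eLpNorm_map_measure ((continuous_fourier hc).aestronglyMeasurable) (by fun_prop), hmap,
    eLpNorm_smul_measure_of_ne_top (by norm_num), eLpNorm_fourier hc hc2, hq', smul_eq_mul,
    ← mul_assoc]
  convert one_mul _
  rw [finrank_euclideanSpace, Fintype.card_fin, inv_pow, inv_inv, abs_of_pos (by positivity),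
    ← ofReal_norm, Complex.norm_real, Real.norm_of_nonneg (by positivity),
    ENNReal.ofReal_rpow_of_nonneg (by positivity) (by positivity),
    ← ENNReal.ofReal_mul (by positivity), ← Real.rpow_natCast, ← Real.rpow_mul hpi.le,
    ← Real.rpow_add hpi]
  have : -(n : ℝ) / 2 + (n : ℝ) * (1 / (2 : ℝ≥0∞)).toReal = 0 := by
    norm_num
    ring
  rw [this, Real.rpow_zero, ENNReal.ofReal_one]

theorem continuous_fourierHat {q : Rn n → ℝ} (hq : Integrable q) : Continuous (fourierHat q) := by
  have hfun : fourierHat q = fun ξ => (((2 * Real.pi) ^ (-(n : ℝ) / 2) : ℝ) : ℂ) *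
      (𝓕 fun x => (q x : ℂ)) ((2 * Real.pi)⁻¹ • ξ) := funext fun ξ => fourierHat_eq q ξ
  rw [hfun]
  exact continuous_const.mul ((continuous_fourier hq.ofReal).comp (by fun_prop))

theorem sobolevNorm_neg_one_le {q : Rn n → ℝ} (hq : Integrable q) (hq2 : MemLp q 2) :
    sobolevNorm (-1) q ≤ eLpNorm q 2 volume := by
  rw [sobolevNorm, ← eLpNorm_fourierHat hq hq2]
  refine eLpNorm_mono fun ξ => ?_
  rw [norm_mul, Complex.norm_real, Real.norm_of_nonneg (Real.rpow_nonneg (bracket_pos ξ).le _)]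
  exact mul_le_of_le_one_left (norm_nonneg _)
    (Real.rpow_le_one_of_one_le_of_nonpos (one_le_bracket ξ) (by norm_num))

/-- Low frequencies are controlled by a pointwise bound of the Fourier transform, high frequencies
by the `L²` norm. -/
theorem sobolevNorm_neg_one_le_of_split {q : Rn n → ℝ} (hq : Integrable q) (hq2 : MemLp q 2)
    {B ρ : ℝ} (hB : ∀ ξ, ‖fourierHat q ξ‖ ≤ B * bracket ξ) (hρ : 0 < ρ) :
    sobolevNorm (-1) q ≤ (ENNReal.ofReal (ρ ^ n) * volume (Metric.ball (0 : Rn n) 1)) ^ (2 : ℝ)⁻¹ *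
      ENNReal.ofReal B + ENNReal.ofReal ρ⁻¹ * eLpNorm q 2 volume := by
  rw [sobolevNorm, ← eLpNorm_fourierHat hq hq2]
  set F : Rn n → ℂ := fun ξ => ((bracket ξ ^ (-1 : ℝ) : ℝ) : ℂ) * fourierHat q ξ with hF
  have hnF : ∀ ξ, ‖F ξ‖ = (bracket ξ)⁻¹ * ‖fourierHat q ξ‖ := fun ξ => by
    rw [hF, norm_mul, Complex.norm_real, Real.norm_of_nonneg (Real.rpow_nonneg (bracket_pos ξ).le _),
      Real.rpow_neg_one]
  have hbc : Continuous fun ξ : Rn n => bracket ξ ^ (-1 : ℝ) :=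
    continuous_bracket.rpow_const fun ξ => Or.inl (bracket_pos ξ).ne'
  have hFc : Continuous F :=
    (Complex.continuous_ofReal.comp hbc).mul (continuous_fourierHat hq)
  set b : Set (Rn n) := Metric.closedBall 0 ρ with hb
  have hbm : MeasurableSet b := measurableSet_closedBall
  have hsplit : F = b.indicator F + bᶜ.indicator F := (Set.indicator_self_add_compl b F).symm
  rw [hsplit]
  refine (eLpNorm_add_le (hFc.aestronglyMeasurable.indicator hbm)
    (hFc.aestronglyMeasurable.indicator hbm.compl) (by norm_num)).trans (add_le_add ?_ ?_)
  · rw [eLpNorm_indicator_eq_eLpNorm_restrict hbm]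
    refine (eLpNorm_le_of_ae_bound (C := B) (Eventually.of_forall fun ξ => ?_)).trans_eq ?_
    -- The weight ⟨ξ⟩⁻¹ exactly absorbs the linear growth in the pointwise bound.
    · rw [hnF, inv_mul_le_iff₀ (bracket_pos ξ), mul_comm]
      exact hB ξ
    · rw [Measure.restrict_apply_univ, hb, Measure.addHaar_closedBall _ _ hρ.le,
        finrank_euclideanSpace, Fintype.card_fin]
      norm_num
  · refine eLpNorm_le_mul_eLpNorm_of_ae_le_mul (Eventually.of_forall fun ξ => ?_) 2
    by_cases hξ : ξ ∈ b
    · rw [Set.indicator_of_notMem (by simpa using hξ), norm_zero]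
      positivity
    · rw [Set.indicator_of_mem (by simpa using hξ), hnF]
      refine mul_le_mul_of_nonneg_right ?_ (norm_nonneg _)
      refine inv_anti₀ hρ ?_
      rw [hb, mem_closedBall_zero_iff, not_le] at hξ
      exact hξ.le.trans (norm_le_bracket ξ)

/-- The weight is positive, so the Fourier transform vanishes almost everywhere; Plancherel and
continuity of q upgrade this to equality at every point. -/
theorem eq_zero_of_sobolevNorm_eq_zero {q : Rn n → ℝ} (hqc : Continuous q) (hq : Integrable q)
    (hq2 : MemLp q 2) {r : ℝ} (h : sobolevNorm r q = 0) : q = 0 := by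
  have hbc : Continuous fun ξ : Rn n => bracket ξ ^ r :=
    continuous_bracket.rpow_const fun ξ => Or.inl (bracket_pos ξ).ne'
  have hFc : Continuous fun ξ : Rn n => ((bracket ξ ^ r : ℝ) : ℂ) * fourierHat q ξ :=
    (Complex.continuous_ofReal.comp hbc).mul (continuous_fourierHat hq)
  rw [sobolevNorm, eLpNorm_eq_zero_iff hFc.aestronglyMeasurable (by norm_num)] at h
  have h1 : fourierHat q =ᵐ[volume] 0 := h.mono fun ξ hξ => by
    refine (mul_eq_zero.1 hξ).resolve_left ?_
    exact Complex.ofReal_ne_zero.2 (Real.rpow_pos_of_pos (bracket_pos ξ) _).ne'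
  have h2 : eLpNorm q 2 volume = 0 := by
    rw [← eLpNorm_fourierHat hq hq2, eLpNorm_congr_ae h1, eLpNorm_zero]
  rw [eLpNorm_eq_zero_iff hqc.aestronglyMeasurable (by norm_num)] at h2
  exact hqc.ae_eq_iff_eq volume continuous_const |>.1 h2

/-! ### Stability and injectivity -/

theorem memLp_of_weightedNorm_le {q : Rn n → ℝ} (hqc : Continuous q) {s M : ℝ} (hM : 0 ≤ M)
    (h : weightedNorm s q ≤ ENNReal.ofReal M) :
    MemLp q 2 ∧ eLpNorm q 2 volume ≤ ENNReal.ofReal M ∧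
      Integrable (fun x => bracket x ^ s * |q x|) ∧ ∫ x, bracket x ^ s * |q x| ≤ M := by
  have h1 : eLpNorm q 2 volume ≤ ENNReal.ofReal M := le_self_add.trans h
  have h2 : eLpNorm (fun x => bracket x ^ s * q x) 1 volume ≤ ENNReal.ofReal M :=
    le_add_self.trans h
  have hbc : Continuous fun x : Rn n => bracket x ^ s :=
    continuous_bracket.rpow_const fun x => Or.inl (bracket_pos x).ne'
  have hi : Integrable fun x => bracket x ^ s * q x :=
    memLp_one_iff_integrable.1 ⟨(hbc.mul hqc).aestronglyMeasurable, h2.trans_lt ENNReal.ofReal_lt_top⟩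
  have habs : ∀ x, ‖bracket x ^ s * q x‖ = bracket x ^ s * |q x| := fun x => by
    rw [norm_mul, Real.norm_of_nonneg (Real.rpow_nonneg (bracket_pos x).le _), Real.norm_eq_abs]
  refine ⟨⟨hqc.aestronglyMeasurable, h1.trans_lt ENNReal.ofReal_lt_top⟩, h1,
    hi.norm.congr (Eventually.of_forall habs), ?_⟩
  rw [← integral_congr_ae (Eventually.of_forall habs), integral_norm_eq_lintegral_enorm hi.1, ← eLpNorm_one_eq_lintegral_enorm]
  exact ENNReal.toReal_le_of_le_ofReal hM h2

theorem weightedNorm_sub_le {f g : Rn n → ℝ} (hf : Continuous f) (hg : Continuous g) (s : ℝ) :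
    weightedNorm s (f - g) ≤ weightedNorm s f + weightedNorm s g := by
  have hbc : Continuous fun x : Rn n => bracket x ^ s :=
    continuous_bracket.rpow_const fun x => Or.inl (bracket_pos x).ne'
  have h1 := eLpNorm_sub_le (p := 2) (μ := volume) hf.aestronglyMeasurable hg.aestronglyMeasurable
    (by norm_num)
  have h2 := eLpNorm_sub_le (p := 1) (μ := volume) (hbc.mul hf).aestronglyMeasurable
    (hbc.mul hg).aestronglyMeasurable (by norm_num)
  have h3 : (fun x => bracket x ^ s * (f - g) x) =
      (fun x => bracket x ^ s * f x) - fun x => bracket x ^ s * g x := by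
    ext x
    simp only [Pi.sub_apply, mul_sub]
  rw [weightedNorm, h3]
  refine (add_le_add h1 h2).trans_eq ?_
  rw [weightedNorm, weightedNorm]
  exact add_add_add_comm _ _ _ _

/-- Split at frequency ρ = l^{s/n}. Low frequencies contribute ρ^{n/2}l^{-s} = l^{-s/2} ≤ l^{-s/n},
since n ≥ 2; high ones contribute Mρ⁻¹ = Ml^{-s/n}. M ≤ C is recorded for the regime of large ε. -/
theorem exists_sobolevNorm_le_rpow (hn : 2 ≤ n) {δ s M K : ℝ} (hδ1 : 1 < δ) (hδ2 : δ ≤ 2)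
    (hs0 : 0 < s) (hs1 : s < 1) (hM : 0 ≤ M) (hK : 0 ≤ K) {b : ℝ}
    (hb : b = 4 * (2 * n + 4 + s) / (δ - 1) + (2 * n + 4 + s)) :
    ∃ C : ℝ, 0 ≤ C ∧ M ≤ C ∧ ∀ V₁ ∈ shortRangeWith n δ K, ∀ V₂ ∈ shortRangeWith n δ K,
      weightedNorm s (V₁ - V₂) ≤ ENNReal.ofReal M → ∀ l : ℝ, 1 ≤ l →
      ‖scatteringOperator V₁ - scatteringOperator V₂‖ ≤ l ^ (-(2 * b)) →
      sobolevNorm (-1) (V₁ - V₂) ≤ ENNReal.ofReal (C * l ^ (-(s / n))) := by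
  obtain ⟨C, hC, h⟩ := exists_norm_integral_exp_le_rpow hn hδ1 hδ2 hs0 hs1 hM hK hb
  set D : ℝ := (2 * Real.pi) ^ (-(n : ℝ) / 2) * C * 2 with hD
  have hD0 : 0 ≤ D := by positivity
  set w : ℝ := (volume (Metric.ball (0 : Rn n) 1)).toReal with hw
  have hw0 : 0 ≤ w := ENNReal.toReal_nonneg
  have hwv : volume (Metric.ball (0 : Rn n) 1) = ENNReal.ofReal w :=
    (ENNReal.ofReal_toReal measure_ball_lt_top.ne).symm
  refine ⟨w ^ (2 : ℝ)⁻¹ * D + M, by positivity, le_add_of_nonneg_left (by positivity), ?_⟩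
  intro V₁ hV₁ V₂ hV₂ hqw l hl hε
  have hl0 : 0 < l := by linarith
  have hn0 : (2 : ℝ) ≤ n := by exact_mod_cast hn
  have hqc : Continuous (V₁ - V₂) := (sub_mem_shortRangeWith hV₁ hV₂).1.continuous
  obtain ⟨hq2, hq2M, hqi, hqM⟩ := memLp_of_weightedNorm_le hqc hM hqw
  have hq : Integrable (V₁ - V₂) := hqi.mono' hqc.aestronglyMeasurable
    (Eventually.of_forall fun x => le_mul_of_one_le_left (abs_nonneg _)
      (Real.one_le_rpow (one_le_bracket x) hs0.le))
  have hB : ∀ ξ, ‖fourierHat (V₁ - V₂) ξ‖ ≤ D * l ^ (-s) * bracket ξ := fun ξ => by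
    have h1 := h V₁ hV₁ V₂ hV₂ hqi hqM l hl hε (-ξ)
    rw [norm_fourierHat]
    refine (mul_le_mul_of_nonneg_left h1 (by positivity)).trans ?_
    rw [norm_neg]
    have h2 : 1 + ‖ξ‖ ≤ 2 * bracket ξ := by linarith [one_le_bracket ξ, norm_le_bracket ξ]
    calc (2 * Real.pi) ^ (-(n : ℝ) / 2) * (C * (1 + ‖ξ‖) * l ^ (-s)) ≤
          (2 * Real.pi) ^ (-(n : ℝ) / 2) * (C * (2 * bracket ξ) * l ^ (-s)) := by gcongr
      _ = _ := by rw [hD]; ring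
  have hρ : 0 < l ^ (s / n) := by positivity
  refine (sobolevNorm_neg_one_le_of_split hq hq2 hB hρ).trans ?_
  have hρn : (l ^ (s / n)) ^ n = l ^ s := by
    rw [← Real.rpow_natCast, ← Real.rpow_mul hl0.le]
    congr 1
    field_simp
  rw [hρn, hwv, ← ENNReal.ofReal_mul (by positivity), ENNReal.ofReal_rpow_of_nonneg (by positivity)
    (by positivity), ← ENNReal.ofReal_mul (by positivity)]
  refine (add_le_add le_rfl (mul_le_mul_right hq2M _)).trans ?_
  rw [← ENNReal.ofReal_mul (by positivity), ← ENNReal.ofReal_add (by positivity) (by positivity)]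
  refine ENNReal.ofReal_le_ofReal ?_
  rw [← Real.rpow_neg hl0.le, Real.mul_rpow (by positivity) hw0, ← Real.rpow_mul hl0.le, add_mul]
  refine add_le_add ?_ (mul_comm _ _).le
  calc l ^ (s * 2⁻¹) * w ^ (2 : ℝ)⁻¹ * (D * l ^ (-s)) =
        w ^ (2 : ℝ)⁻¹ * D * l ^ (s * 2⁻¹ + -s) := by
        rw [Real.rpow_add hl0]
        ring
    _ ≤ _ := by
        refine mul_le_mul_of_nonneg_left (Real.rpow_le_rpow_of_exponent_le hl ?_) (by positivity)
        have : s / n ≤ s / 2 := div_le_div_of_nonneg_left hs0.le two_pos hn0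
        linarith

/-- For 0 < ε ≤ 1 take l = ε^{-1/(2b)}; then l^{-s/n} = ε^ν with ν = s/(2bn). For ε = 0 let l tend
to infinity, and for ε ≥ 1 the a priori bound M suffices. The exponent b does not involve K, so
neither does ν. -/
theorem exists_holder_stability (hn : 2 ≤ n) {δ s M : ℝ} (hδ1 : 1 < δ) (hδ2 : δ ≤ 2)
    (hs0 : 0 < s) (hs1 : s < 1) (hM : 0 < M) :
    ∃ ν : ℝ, 0 < ν ∧ ν < 1 ∧ ∀ K : ℝ, 0 < K → ∃ C : ℝ, 0 < C ∧
      ∀ V₁ ∈ shortRangeWith n δ K, ∀ V₂ ∈ shortRangeWith n δ K,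
        weightedNorm s (V₁ - V₂) ≤ ENNReal.ofReal M →
        sobolevNorm (-1) (V₁ - V₂) ≤
          ENNReal.ofReal (C * ‖scatteringOperator V₁ - scatteringOperator V₂‖ ^ ν) := by
  obtain ⟨b, hb⟩ : ∃ b : ℝ, b = 4 * (2 * n + 4 + s) / (δ - 1) + (2 * n + 4 + s) := ⟨_, rfl⟩
  have hn0 : (2 : ℝ) ≤ n := by exact_mod_cast hn
  have hδ' : 0 < δ - 1 := by linarith
  have hb1 : 1 < b := by
    have : 0 ≤ 4 * (2 * n + 4 + s) / (δ - 1) := by positivity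
    linarith
  have hbn : 1 < 2 * b * n := by nlinarith
  refine ⟨s / (2 * b * n), by positivity, ?_, fun K hK => ?_⟩
  · rw [div_lt_one (by positivity)]
    linarith
  obtain ⟨C, hC, hMC, h⟩ := exists_sobolevNorm_le_rpow hn hδ1 hδ2 hs0 hs1 hM.le hK.le hb
  refine ⟨C, hM.trans_le hMC, fun V₁ hV₁ V₂ hV₂ hq => ?_⟩
  set ε := ‖scatteringOperator V₁ - scatteringOperator V₂‖ with hε
  have hε0 : 0 ≤ ε := norm_nonneg _
  have hνpos : 0 < s / (2 * b * n) := by positivity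
  rcases hε0.eq_or_lt with h0 | hpos
  · rw [← h0, Real.zero_rpow hνpos.ne', mul_zero, ENNReal.ofReal_zero]
    have hlim : Tendsto (fun l : ℝ => ENNReal.ofReal (C * l ^ (-(s / n)))) atTop (𝓝 0) := by
      have h1 : Tendsto (fun l : ℝ => l ^ (-(s / n))) atTop (𝓝 0) :=
        tendsto_rpow_neg_atTop (by positivity)
      simpa using ENNReal.tendsto_ofReal (h1.const_mul C)
    refine ge_of_tendsto hlim ?_
    filter_upwards [eventually_ge_atTop 1] with l hl
    exact h V₁ hV₁ V₂ hV₂ hq l hl (by rw [← hε, ← h0]; positivity)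
  · rcases le_total ε 1 with h1 | h1
    · have hl := h V₁ hV₁ V₂ hV₂ hq (ε ^ (-(1 / (2 * b)))) ?_ ?_
      · rw [← Real.rpow_mul hε0] at hl
        convert hl using 4
        field_simp
      · exact Real.one_le_rpow_of_pos_of_le_one_of_nonpos hpos h1
          (neg_nonpos.2 (by positivity))
      · rw [← Real.rpow_mul hε0, neg_mul_neg, one_div, inv_mul_cancel₀ (by positivity),
          Real.rpow_one]
    · have hqc : Continuous (V₁ - V₂) := (sub_mem_shortRangeWith hV₁ hV₂).1.continuous
      obtain ⟨hq2, hq2M, hqi, -⟩ := memLp_of_weightedNorm_le hqc hM.le hq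
      have hqi' : Integrable (V₁ - V₂) := hqi.mono' hqc.aestronglyMeasurable
        (Eventually.of_forall fun x => le_mul_of_one_le_left (abs_nonneg _)
          (Real.one_le_rpow (one_le_bracket x) hs0.le))
      refine (sobolevNorm_neg_one_le hqi' hq2).trans (hq2M.trans (ENNReal.ofReal_le_ofReal ?_))
      exact hMC.trans (le_mul_of_one_le_right hC (Real.one_le_rpow h1 hνpos.le))

/-- Stability with ε = 0, after placing both potentials in a common class; the triangle inequality
through V₀ replaces M by 2M. -/
theorem injOn_scatteringOperator (hn : 2 ≤ n) {δ s M : ℝ} (hδ1 : 1 < δ) (hδ2 : δ ≤ 2)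
    (hs0 : 0 < s) (hs1 : s < 1) (hM : 0 < M) {V₀ : Rn n → ℝ} (hV₀ : V₀ ∈ shortRange n δ) :
    Set.InjOn scatteringOperator
      {V | V ∈ shortRange n δ ∧ weightedNorm s (V - V₀) ≤ ENNReal.ofReal M} := by
  rintro V₁ ⟨⟨K₁, hV₁⟩, h₁⟩ V₂ ⟨⟨K₂, hV₂⟩, h₂⟩ hS
  obtain ⟨K₀, hV₀⟩ := hV₀
  have hK₁ := nonneg_of_mem_shortRangeWith hV₁
  have hK₂ := nonneg_of_mem_shortRangeWith hV₂
  have e₁ := shortRangeWith_mono le_rfl hK₁ (by linarith : K₁ ≤ K₁ + K₂ + 1) hV₁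
  have e₂ := shortRangeWith_mono le_rfl hK₂ (by linarith : K₂ ≤ K₁ + K₂ + 1) hV₂
  have hw : weightedNorm s (V₁ - V₂) ≤ ENNReal.ofReal (M + M) := by
    have h := weightedNorm_sub_le (hV₁.1.continuous.sub hV₀.1.continuous)
      (hV₂.1.continuous.sub hV₀.1.continuous) s
    rw [ENNReal.ofReal_add hM.le hM.le, ← sub_sub_sub_cancel_right V₁ V₂ V₀]
    exact h.trans (add_le_add h₁ h₂)
  obtain ⟨ν, hν, -, hH⟩ := exists_holder_stability hn hδ1 hδ2 hs0 hs1 (by linarith : 0 < M + M)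
  obtain ⟨C, -, hC⟩ := hH (K₁ + K₂ + 1) (by linarith)
  have h0 := hC V₁ e₁ V₂ e₂ hw
  rw [hS, sub_self, norm_zero, Real.zero_rpow hν.ne', mul_zero, ENNReal.ofReal_zero,
    nonpos_iff_eq_zero] at h0
  have hqc : Continuous (V₁ - V₂) := hV₁.1.continuous.sub hV₂.1.continuous
  obtain ⟨hq2, -, hqi, -⟩ := memLp_of_weightedNorm_le hqc (by linarith) hw
  have hqi' : Integrable (V₁ - V₂) := hqi.mono' hqc.aestronglyMeasurable
    (Eventually.of_forall fun x => le_mul_of_one_le_left (abs_nonneg _)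
      (Real.one_le_rpow (one_le_bracket x) hs0.le))
  exact sub_eq_zero.1 (eq_zero_of_sobolevNorm_eq_zero hqc hqi' hq2 h0)

end QuantumScattering
end

/-! ### The main theorem -/

theorem theorem1p1 (n : ℕ) (hn : 2 ≤ n) (M δ s : ℝ) (hM : 0 < M) (hδ : 1 < δ)
    (hs0 : 0 < s) (hs1 : s < 1) :
    -- the Schrödinger group and the wave operators are well defined on the whole class
    (∀ V ∈ QuantumScattering.shortRange n δ,
      QuantumScattering.IsSchrodingerGroup V (QuantumScattering.schrodingerGroup V) ∧
      QuantumScattering.IsWaveOperator V atTop (QuantumScattering.waveOperator V atTop) ∧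
      QuantumScattering.IsWaveOperator V atBot (QuantumScattering.waveOperator V atBot)) ∧
    -- Hölder stability
    (∃ ν : ℝ, 0 < ν ∧ ν < 1 ∧ ∀ K : ℝ, 0 < K → ∃ C : ℝ, 0 < C ∧
      ∀ V₁ ∈ QuantumScattering.shortRangeWith n δ K,
      ∀ V₂ ∈ QuantumScattering.shortRangeWith n δ K,
        QuantumScattering.weightedNorm s (V₁ - V₂) ≤ ENNReal.ofReal M →
        QuantumScattering.sobolevNorm (-1) (V₁ - V₂) ≤ ENNReal.ofReal
          (C * ‖QuantumScattering.scatteringOperator V₁ -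
                QuantumScattering.scatteringOperator V₂‖ ^ ν)) ∧
    -- local injectivity of the scattering map
    (∀ V₀ ∈ QuantumScattering.shortRange n δ,
      Set.InjOn QuantumScattering.scatteringOperator
        {V | V ∈ QuantumScattering.shortRange n δ ∧
          QuantumScattering.weightedNorm s (V - V₀) ≤ ENNReal.ofReal M}) := by
  -- The t⁻² decay in the weight ⟨x⟩⁻² serves decay rates up to 2 only. Since ⟨x⟩ ≥ 1, lowering δ to
  -- min(δ, 2) > 1 enlarges the class with the same K, so nothing is lost.
  set δ' := min δ 2 with hδ'
  have h1 : 1 < δ' := lt_min hδ one_lt_two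
  have h2 : δ' ≤ 2 := min_le_right _ _
  have hle : δ' ≤ δ := min_le_left _ _
  have hsub : ∀ {K : ℝ}, QuantumScattering.shortRangeWith n δ K ⊆
      QuantumScattering.shortRangeWith n δ' K := fun hV =>
    QuantumScattering.shortRangeWith_mono hle
      (QuantumScattering.nonneg_of_mem_shortRangeWith hV) le_rfl hV
  have hsub' : QuantumScattering.shortRange n δ ⊆ QuantumScattering.shortRange n δ' :=
    fun _ ⟨K, hV⟩ => ⟨K, hsub hV⟩
  refine ⟨?_, ?_, ?_⟩
  · rintro V ⟨K, hV⟩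
    exact ⟨QuantumScattering.isSchrodingerGroup_schrodingerGroup
        (QuantumScattering.isBoundedSymbol_of_mem (by linarith) hV),
      QuantumScattering.isWaveOperator_of_mem (by omega) h1 h2 (hsub hV) (Or.inl rfl),
      QuantumScattering.isWaveOperator_of_mem (by omega) h1 h2 (hsub hV) (Or.inr rfl)⟩
  · obtain ⟨ν, hν0, hν1, h⟩ := QuantumScattering.exists_holder_stability hn h1 h2 hs0 hs1 hM
    refine ⟨ν, hν0, hν1, fun K hK => ?_⟩
    obtain ⟨C, hC, hCV⟩ := h K hK
    exact ⟨C, hC, fun V₁ hV₁ V₂ hV₂ => hCV V₁ (hsub hV₁) V₂ (hsub hV₂)⟩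
  · intro V₀ hV₀
    exact (QuantumScattering.injOn_scatteringOperator hn h1 h2 hs0 hs1 hM (hsub' hV₀)).mono
      (Set.inter_subset_inter_left _ hsub')
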